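/- Let $n\in\{1,2,3\}$, let $\Omega\subset\mathbb R^n$ be a nonempty bounded convex open set, $T>0$, $Q:=\Omega\times(0,T)$ and $Q_-:=\Omega\times(-T,T)$. On subspaces of $H^1$ consisting of functions that vanish on the lateral boundary we use the norm $|v|_{H^1}:=(\|\partial_t v\|_{L^2}^2+\|\nabla_x v\|_{L^2}^2)^{1/2}$. Set \[ H^{1,1}_{0;0,}(Q):=\{u\in L^2(0,T;H^1_0(\Omega))\cap H^1(0,T;L^2(\Omega)) : u(\cdot,0)=0\}, \] let $Y:=H^{1,1}_{0;,0}(Q)$ be the analogous space with the terminal condition $q(\cdot,T)=0$ instead, normed by $\|q\|_Y:=|q|_{H^1(Q)}$, and let $H^1_0(Q_-)$ (the closure of $C_c^\infty(Q_-)$ in $H^1(Q_-)$) be normed by $|\cdot|_{H^1(Q_-)}$; dual spaces carry the dual norms. For $u\in L^2(Q)$ let $\widetilde u$ be its extension by zero to $Q_-$ and let $\Box\widetilde u$ be the distribution $\langle\Box\widetilde u,\varphi\rangle:=\int_{Q_-}\widetilde u\,(\partial_{tt}\varphi-\Delta_x\varphi)\,dx\,dt$, $\varphi\in C_c^\infty(Q_-)$.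 Let $\mathcal H(Q):=\{u\in L^2(Q):\Box\widetilde u\in[H^1_0(Q_-)]^*\}$ with the graph norm $(\|u\|_{L^2(Q)}^2+\|\Box\widetilde u\|_{[H^1_0(Q_-)]^*}^2)^{1/2}$, and let $X$ be the closure of $H^{1,1}_{0;0,}(Q)$ in $\mathcal H(Q)$, normed by $\|u\|_X:=\|\Box\widetilde u\|_{[H^1_0(Q_-)]^*}$. Define $A:Y\to Y^*$ by $\langle Aw,q\rangle:=\langle\partial_t w,\partial_t q\rangle_{L^2(Q)}+\langle\nabla_x w,\nabla_x q\rangle_{L^2(Q)}$. Let $\mathcal E:Y\to H^1_0(Q_-)$ be any bounded linear extension operator, i.e. $(\mathcal Eq)_{|Q}=q$, with $|\mathcal Eq|_{H^1(Q_-)}\le 2\,\|q\|_Y$ for all $q\in Y$. Define $B:X\to Y^*$ by $\langle Bu,q\rangle:=\langle\Box\widetilde u,\mathcal Eq\rangle$, and let $B^*:Y\to X^*$ be its dual operator, $\langle B^*q,u\rangle:=\langle Bu,q\rangle$. Then the reflection in time $(\mathcal Eq)(x,t):=q(x,|t|)$ is such an extension operator, $A$ is an isomorphism of $Y$ onto $Y^*$,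 and for every such $\mathcal E$ the operator $S:=B^*A^{-1}B:X\to X^*$ is bounded and elliptic, \[ \|Su\|_{X^*}\le 4\,\|u\|_X,\qquad \langle Su,u\rangle\ge\|u\|_X^2\qquad\text{for all }u\in X . \] Moreover, $\|u\|_S:=\langle Su,u\rangle^{1/2}$ defines a norm on $X$ that is equivalent to $\|\cdot\|_X$: \[ \|u\|_X\le\|u\|_S\le 2\,\|u\|_X\qquad\text{for all }u\in X . \] -/

import Mathlib

open MeasureTheory Set Filter TopologicalSpace
open scoped Topology ENNReal Distributions

namespace WaveControl

/-! ### Lebesgue spaces, test functions, weak derivatives -/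

/-- The space `ℝⁿ` with its Euclidean norm. -/
abbrev Space (n : ℕ) : Type := EuclideanSpace ℝ (Fin n)

/-- Points `(x, t)` of space-time `ℝⁿ × ℝ`, with the Lebesgue (product) measure. -/
abbrev Spacetime (n : ℕ) : Type := Space n × ℝ

/-- `L²(U)` for an open set `U`. -/
abbrev L2 {F : Type} [NormedAddCommGroup F] [MeasureSpace F] (U : Opens F) : Type :=
  Lp ℝ 2 (volume.restrict (U : Set F))

/-- The coordinate directions of space. -/
noncomputable def spaceDir (n : ℕ) (i : Fin n) : Space n := EuclideanSpace.single i 1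

/-- The coordinate directions of space-time: `none` is the time direction and `some i` is the
`i`-th spatial direction. -/
noncomputable def stDir (n : ℕ) : Option (Fin n) → Spacetime n
  | none => (0, 1)
  | some i => (spaceDir n i, 0)

/-- The cylinder `Ω × (a, b)`. -/
def cyl {n : ℕ} (Ω : Opens (Space n)) (a b : ℝ) : Opens (Spacetime n) :=
  ⟨(Ω : Set (Space n)) ×ˢ Ioo a b, Ω.isOpen.prod isOpen_Ioo⟩

/-- `f` belongs to `H¹₀(U)`, the closure of `C_c^∞(U)` in `H¹(U)`, and `g i` is its weak derivative
in the direction `e i`: there are test functions `φₖ` with `φₖ → f` and `∂ᵢ φₖ → g i` in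
`L²(U)`. -/
def IsH10With {F ι : Type} [NormedAddCommGroup F] [NormedSpace ℝ F] [MeasureSpace F]
    (U : Opens F) (e : ι → F) (f : F → ℝ) (g : ι → F → ℝ) : Prop :=
  ∃ φ : ℕ → 𝓓(U, ℝ),
    Tendsto (fun k => eLpNorm (fun x => φ k x - f x) 2 (volume.restrict (U : Set F)))
      atTop (𝓝 0) ∧
    ∀ i, Tendsto (fun k => eLpNorm (fun x => fderiv ℝ (φ k) x (e i) - g i x) 2
      (volume.restrict (U : Set F))) atTop (𝓝 0)

section IsH10With

variable {F ι : Type} [NormedAddCommGroup F] [NormedSpace ℝ F] [MeasureSpace F] [BorelSpace F]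
  {U : Opens F} {e : ι → F}

theorem measurable_test [SecondCountableTopology F] (φ : 𝓓(U, ℝ)) :
    AEStronglyMeasurable (fun x => φ x) (volume.restrict (U : Set F)) :=
  φ.continuous.aestronglyMeasurable

theorem contDiff_fderiv_test (φ : 𝓓(U, ℝ)) (v : F) :
    ContDiff ℝ ((⊤ : ℕ∞) : WithTop ℕ∞) (fun x => fderiv ℝ φ x v) := by
  have h : ContDiff ℝ ((⊤ : ℕ∞) : WithTop ℕ∞) (fderiv ℝ φ) :=
    φ.contDiff.fderiv_right (by simp)
  exact h.clm_apply contDiff_const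

theorem measurable_fderiv_test [SecondCountableTopology F] (φ : 𝓓(U, ℝ)) (v : F) :
    AEStronglyMeasurable (fun x => fderiv ℝ φ x v) (volume.restrict (U : Set F)) :=
  (contDiff_fderiv_test φ v).continuous.aestronglyMeasurable

theorem differentiable_test (φ : 𝓓(U, ℝ)) (x : F) : DifferentiableAt ℝ φ x :=
  (φ.contDiff.differentiable (by simp)) x

theorem tendsto_eLpNorm_add {μ : Measure F} {a b c : ℕ → F → ℝ}
    (ha : Tendsto (fun k => eLpNorm (a k) 2 μ) atTop (𝓝 0))
    (hb : Tendsto (fun k => eLpNorm (b k) 2 μ) atTop (𝓝 0))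
    (hma : ∀ k, AEStronglyMeasurable (a k) μ) (hmb : ∀ k, AEStronglyMeasurable (b k) μ)
    (hc : ∀ k, c k = a k + b k) :
    Tendsto (fun k => eLpNorm (c k) 2 μ) atTop (𝓝 0) := by
  refine tendsto_of_tendsto_of_tendsto_of_le_of_le tendsto_const_nhds
    (by simpa using ha.add hb) (fun _ => zero_le) (fun k => ?_)
  show eLpNorm (c k) 2 μ ≤ _
  rw [hc k]
  exact eLpNorm_add_le (hma k) (hmb k) (by norm_num)

theorem IsH10With.add [SecondCountableTopology F] {f₁ f₂ : F → ℝ} {g₁ g₂ : ι → F → ℝ}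
    (h₁ : IsH10With U e f₁ g₁) (h₂ : IsH10With U e f₂ g₂)
    (hf₁ : AEStronglyMeasurable f₁ (volume.restrict (U : Set F)))
    (hf₂ : AEStronglyMeasurable f₂ (volume.restrict (U : Set F)))
    (hg₁ : ∀ i, AEStronglyMeasurable (g₁ i) (volume.restrict (U : Set F)))
    (hg₂ : ∀ i, AEStronglyMeasurable (g₂ i) (volume.restrict (U : Set F))) :
    IsH10With U e (f₁ + f₂) (g₁ + g₂) := by
  obtain ⟨φ, hφ, hφ'⟩ := h₁
  obtain ⟨ψ, hψ, hψ'⟩ := h₂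
  refine ⟨fun k => φ k + ψ k, ?_, fun i => ?_⟩
  · refine tendsto_eLpNorm_add hφ hψ (fun k => (measurable_test _).sub hf₁)
      (fun k => (measurable_test _).sub hf₂) (fun k => ?_)
    ext x
    simp
    ring
  · refine tendsto_eLpNorm_add (hφ' i) (hψ' i)
      (fun k => (measurable_fderiv_test _ _).sub (hg₁ i))
      (fun k => (measurable_fderiv_test _ _).sub (hg₂ i)) (fun k => ?_)
    ext x
    have h2 : fderiv ℝ (⇑(φ k + ψ k)) x = fderiv ℝ (φ k) x + fderiv ℝ (ψ k) x :=
      fderiv_add (differentiable_test _ x) (differentiable_test _ x)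
    rw [h2]
    simp only [FunLike.coe_add, Pi.add_apply]
    ring

theorem IsH10With.smul {f : F → ℝ} {g : ι → F → ℝ} (c : ℝ)
    (h : IsH10With U e f g) : IsH10With U e (c • f) (c • g) := by
  obtain ⟨φ, hφ, hφ'⟩ := h
  refine ⟨fun k => c • φ k, ?_, fun i => ?_⟩
  · have : ∀ k, (fun x => (c • φ k) x - (c • f) x) = c • fun x => φ k x - f x := by
      intro k
      ext x
      simp
      ring
    simp only [this, eLpNorm_const_smul]
    simpa using ENNReal.Tendsto.const_mul hφ (Or.inr (by simp))
  · have : ∀ k, (fun x => fderiv ℝ (⇑(c • φ k)) x (e i) - (c • g) i x)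
        = c • fun x => fderiv ℝ (φ k) x (e i) - g i x := by
      intro k
      ext x
      have h2 : fderiv ℝ (⇑(c • φ k)) x = c • fderiv ℝ (φ k) x :=
        fderiv_const_smul (differentiable_test _ x) c
      rw [h2]
      simp only [FunLike.coe_smul, Pi.smul_apply, smul_eq_mul]
      ring
    simp only [this, eLpNorm_const_smul]
    simpa using ENNReal.Tendsto.const_mul (hφ' i) (Or.inr (by simp))

theorem IsH10With.congr {f f' : F → ℝ} {g g' : ι → F → ℝ} (h : IsH10With U e f g)
    (hf : f =ᵐ[volume.restrict (U : Set F)] f')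
    (hg : ∀ i, g i =ᵐ[volume.restrict (U : Set F)] g' i) : IsH10With U e f' g' := by
  obtain ⟨φ, hφ, hφ'⟩ := h
  refine ⟨φ, hφ.congr fun k => eLpNorm_congr_ae ?_, fun i => (hφ' i).congr fun k =>
    eLpNorm_congr_ae ?_⟩
  · filter_upwards [hf] with x hx
    simp [hx]
  · filter_upwards [hg i] with x hx
    simp [hx]

theorem IsH10With.of_test (φ : 𝓓(U, ℝ)) :
    IsH10With U e φ (fun i x => fderiv ℝ φ x (e i)) :=
  ⟨fun _ => φ, by simp, by simp⟩

theorem IsH10With.zero : IsH10With U e (0 : F → ℝ) (0 : ι → F → ℝ) := by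
  refine (IsH10With.of_test (U := U) (e := e) 0).congr (by rfl) (fun i => ?_)
  refine Eventually.of_forall fun x => ?_
  simp

end IsH10With

/-! ### The Sobolev spaces `H¹(U)` and `H¹₀(U)` of a space-time domain -/

section Sobolev

variable {n : ℕ} {U : Opens (Spacetime n)}

/-- `g ∈ L²(U)` is the weak derivative of `u ∈ L²(U)` in the direction `v`. -/
def IsWeakDeriv (U : Opens (Spacetime n)) (v : Spacetime n) (u g : L2 U) : Prop :=
  ∀ φ : 𝓓(U, ℝ), ∫ z in (U : Set (Spacetime n)), u z * fderiv ℝ φ z v =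
    -∫ z in (U : Set (Spacetime n)), g z * φ z

theorem memLp_test (φ : 𝓓(U, ℝ)) :
    MemLp (fun z => φ z) 2 (volume.restrict (U : Set (Spacetime n))) :=
  (φ.continuous.memLp_of_hasCompactSupport φ.hasCompactSupport).restrict _

theorem memLp_fderiv_test (φ : 𝓓(U, ℝ)) (v : Spacetime n) :
    MemLp (fun z => fderiv ℝ φ z v) 2 (volume.restrict (U : Set (Spacetime n))) :=
  ((contDiff_fderiv_test φ v).continuous.memLp_of_hasCompactSupport
    (φ.hasCompactSupport.fderiv_apply (𝕜 := ℝ) v)).restrict _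

theorem integrable_mul (u : L2 U) {f : Spacetime n → ℝ}
    (hf : MemLp f 2 (volume.restrict (U : Set (Spacetime n)))) :
    Integrable (fun z => u z * f z) (volume.restrict (U : Set (Spacetime n))) :=
  (Lp.memLp u).integrable_mul hf

theorem IsWeakDeriv.unique {v : Spacetime n} {u g₁ g₂ : L2 U}
    (h₁ : IsWeakDeriv U v u g₁) (h₂ : IsWeakDeriv U v u g₂) : g₁ = g₂ := by
  rw [← sub_eq_zero]
  have hloc : LocallyIntegrableOn (⇑(g₁ - g₂)) (U : Set (Spacetime n)) volume :=
    locallyIntegrableOn_of_locallyIntegrable_restrict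
      ((Lp.memLp (g₁ - g₂)).locallyIntegrable (by norm_num))
  have key := U.isOpen.ae_eq_zero_of_integral_contDiff_smul_eq_zero hloc (by
    intro φ hφ hc hs
    let ψ : 𝓓(U, ℝ) := ⟨φ, hφ, hc, hs⟩
    have e₁ := h₁ ψ
    have e₂ := h₂ ψ
    have hsub : ∫ z in (U : Set (Spacetime n)), (g₁ - g₂) z * ψ z = 0 := by
      have : ∫ z in (U : Set (Spacetime n)), (g₁ - g₂) z * ψ z =
          ∫ z in (U : Set (Spacetime n)), (g₁ z * ψ z - g₂ z * ψ z) := by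
        refine integral_congr_ae ?_
        filter_upwards [Lp.coeFn_sub g₁ g₂] with z hz
        rw [hz, Pi.sub_apply]
        ring
      rw [this, integral_sub (integrable_mul g₁ (memLp_test ψ))
        (integrable_mul g₂ (memLp_test ψ))]
      linarith
    rw [← hsub, ← setIntegral_eq_integral_of_forall_compl_eq_zero (s := (U : Set (Spacetime n)))]
    · refine integral_congr_ae (Eventually.of_forall fun z => ?_)
      show φ z • _ = _ * φ z
      rw [smul_eq_mul, mul_comm]
    · intro z hz
      have : φ z = 0 := by
        by_contra hne
        exact hz (hs (subset_tsupport _ hne))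
      simp [this])
  refine Lp.ext ?_
  have := (ae_restrict_iff' U.isOpen.measurableSet).2 key
  filter_upwards [this, Lp.coeFn_zero ℝ 2 (volume.restrict (U : Set (Spacetime n)))] with z h1 h2
  rw [h1, h2, Pi.zero_apply]

theorem integral_add_mul (w₁ w₂ : L2 U) {f : Spacetime n → ℝ}
    (hf : MemLp f 2 (volume.restrict (U : Set (Spacetime n)))) :
    ∫ z in (U : Set (Spacetime n)), (w₁ + w₂) z * f z =
      (∫ z in (U : Set (Spacetime n)), w₁ z * f z) +
        ∫ z in (U : Set (Spacetime n)), w₂ z * f z := by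
  rw [← integral_add (integrable_mul w₁ hf) (integrable_mul w₂ hf)]
  refine integral_congr_ae ?_
  filter_upwards [Lp.coeFn_add w₁ w₂] with z hz
  rw [hz, Pi.add_apply]
  ring

theorem integral_smul_mul (c : ℝ) (w : L2 U) (f : Spacetime n → ℝ) :
    ∫ z in (U : Set (Spacetime n)), (c • w) z * f z =
      c * ∫ z in (U : Set (Spacetime n)), w z * f z := by
  rw [← integral_const_mul]
  refine integral_congr_ae ?_
  filter_upwards [Lp.coeFn_smul c w] with z hz
  rw [hz, Pi.smul_apply, smul_eq_mul]
  ring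

theorem integral_zero_mul (f : Spacetime n → ℝ) :
    ∫ z in (U : Set (Spacetime n)), (0 : L2 U) z * f z = 0 := by
  have h := integral_smul_mul 0 (0 : L2 U) f
  rwa [zero_smul, zero_mul] at h

theorem IsWeakDeriv.add {v : Spacetime n} {u₁ u₂ g₁ g₂ : L2 U}
    (h₁ : IsWeakDeriv U v u₁ g₁) (h₂ : IsWeakDeriv U v u₂ g₂) :
    IsWeakDeriv U v (u₁ + u₂) (g₁ + g₂) := by
  intro φ
  rw [integral_add_mul _ _ (memLp_fderiv_test φ v), integral_add_mul _ _ (memLp_test φ),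
    h₁ φ, h₂ φ, neg_add]

theorem IsWeakDeriv.smul {v : Spacetime n} {u g : L2 U} (c : ℝ)
    (h : IsWeakDeriv U v u g) : IsWeakDeriv U v (c • u) (c • g) := by
  intro φ
  rw [integral_smul_mul, integral_smul_mul, h φ, mul_neg]

theorem isWeakDeriv_zero (v : Spacetime n) : IsWeakDeriv U v 0 0 := by
  intro φ
  rw [integral_zero_mul, integral_zero_mul, neg_zero]

/-- `H¹(U)`: the functions in `L²(U)` all of whose first order weak partial derivatives are in
`L²(U)`. -/
def H1 (U : Opens (Spacetime n)) : Submodule ℝ (L2 U) where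
  carrier := {u | ∀ j, ∃ g : L2 U, IsWeakDeriv U (stDir n j) u g}
  zero_mem' := fun _ => ⟨0, isWeakDeriv_zero _⟩
  add_mem' := fun h₁ h₂ j => by
    obtain ⟨g₁, hg₁⟩ := h₁ j
    obtain ⟨g₂, hg₂⟩ := h₂ j
    exact ⟨g₁ + g₂, hg₁.add hg₂⟩
  smul_mem' := fun c _ h j => by
    obtain ⟨g, hg⟩ := h j
    exact ⟨c • g, hg.smul c⟩

/-- The weak partial derivative `∂ⱼ : H¹(U) → L²(U)` (`∂ₜ` for `j = none`, `∂_{xᵢ}` for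
`j = some i`). -/
noncomputable def weakDeriv (U : Opens (Spacetime n)) (j : Option (Fin n)) : H1 U →ₗ[ℝ] L2 U where
  toFun u := (u.2 j).choose
  map_add' u₁ u₂ := ((u₁ + u₂).2 j).choose_spec.unique
    ((u₁.2 j).choose_spec.add (u₂.2 j).choose_spec)
  map_smul' c u := ((c • u).2 j).choose_spec.unique ((u.2 j).choose_spec.smul c)

theorem isWeakDeriv_weakDeriv (j : Option (Fin n)) (u : H1 U) :
    IsWeakDeriv U (stDir n j) u (weakDeriv U j u) := (u.2 j).choose_spec

theorem weakDeriv_eq {j : Option (Fin n)} {u : H1 U} {g : L2 U}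
    (h : IsWeakDeriv U (stDir n j) u g) : weakDeriv U j u = g :=
  (isWeakDeriv_weakDeriv j u).unique h

/-- `H¹₀(U)`: the closure of the test functions in `H¹(U)`. -/
def H10 (U : Opens (Spacetime n)) : Submodule ℝ (H1 U) where
  carrier := {u | IsH10With U (stDir n) (u : L2 U) (fun j => weakDeriv U j u)}
  zero_mem' := by
    refine IsH10With.zero.congr ?_ (fun j => ?_)
    · exact (Lp.coeFn_zero ℝ 2 (volume.restrict (U : Set (Spacetime n)))).symm
    · rw [map_zero]
      exact (Lp.coeFn_zero ℝ 2 (volume.restrict (U : Set (Spacetime n)))).symm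
  add_mem' := fun {u₁ u₂} h₁ h₂ => by
    refine (IsH10With.add h₁ h₂ (Lp.aestronglyMeasurable _) (Lp.aestronglyMeasurable _)
      (fun j => Lp.aestronglyMeasurable _) (fun j => Lp.aestronglyMeasurable _)).congr ?_
      (fun j => ?_)
    · exact (Lp.coeFn_add (u₁ : L2 U) (u₂ : L2 U)).symm
    · rw [map_add]
      exact (Lp.coeFn_add _ _).symm
  smul_mem' := fun c u h => by
    refine (IsH10With.smul c h).congr ?_ (fun j => ?_)
    · exact (Lp.coeFn_smul c (u : L2 U)).symm
    · rw [map_smul]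
      exact (Lp.coeFn_smul c _).symm

/-- A subspace of `H¹(U)`, as a space of its own that is equipped with the norm
`(‖∂ₜ u‖² + ‖∇ₓ u‖²)^{1/2} = |u|_{H¹(U)}` (and not with the `L²(U)` norm). -/
def Energy (V : Submodule ℝ (H1 U)) : Type := V

noncomputable instance (V : Submodule ℝ (H1 U)) : AddCommGroup (Energy V) :=
  inferInstanceAs (AddCommGroup V)

noncomputable instance (V : Submodule ℝ (H1 U)) : Module ℝ (Energy V) :=
  inferInstanceAs (Module ℝ V)

/-- The underlying function in `H¹(U)`. -/
noncomputable def Energy.toH1 {V : Submodule ℝ (H1 U)} : Energy V →ₗ[ℝ] H1 U := V.subtype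

/-- The underlying function in `L²(U)`. -/
noncomputable def Energy.toL2 {V : Submodule ℝ (H1 U)} : Energy V →ₗ[ℝ] L2 U :=
  (H1 U).subtype ∘ₗ Energy.toH1

/-- The full gradient `(∂ₜ u, ∇ₓ u)`, as an element of the Hilbert space `L²(U)ⁿ⁺¹`. -/
noncomputable def Energy.grad {V : Submodule ℝ (H1 U)} :
    Energy V →ₗ[ℝ] PiLp 2 (fun _ : Option (Fin n) => L2 U) :=
  (WithLp.linearEquiv 2 ℝ (Option (Fin n) → L2 U)).symm.toLinearMap ∘ₗ
    LinearMap.pi (fun j => weakDeriv U j ∘ₗ Energy.toH1)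

noncomputable instance (V : Submodule ℝ (H1 U)) : SeminormedAddCommGroup (Energy V) :=
  SeminormedAddCommGroup.induced _ _ Energy.grad

noncomputable instance (V : Submodule ℝ (H1 U)) : NormedSpace ℝ (Energy V) :=
  NormedSpace.induced ℝ _ _ Energy.grad

theorem Energy.norm_eq {V : Submodule ℝ (H1 U)} (q : Energy V) : ‖q‖ = ‖Energy.grad q‖ := rfl

/-- The operator `A : V → V*`, `⟨A w, q⟩ = ⟨∂ₜ w, ∂ₜ q⟩ + ⟨∇ₓ w, ∇ₓ q⟩`. -/
noncomputable def opA (V : Submodule ℝ (H1 U)) : Energy V →L[ℝ] StrongDual ℝ (Energy V) :=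
  LinearMap.mkContinuous₂
    ((innerₗ (PiLp 2 (fun _ : Option (Fin n) => L2 U))).compl₁₂ Energy.grad Energy.grad) 1
    (fun w q => by
      rw [one_mul, Energy.norm_eq, Energy.norm_eq]
      exact norm_inner_le_norm (𝕜 := ℝ) (Energy.grad w) (Energy.grad q))

/-- A test function as an element of `L²(U)`. -/
noncomputable def testL2 (φ : 𝓓(U, ℝ)) : L2 U := (memLp_test φ).toLp _

theorem isWeakDeriv_test (φ : 𝓓(U, ℝ)) (v : Spacetime n) :
    IsWeakDeriv U v (testL2 φ) ((memLp_fderiv_test φ v).toLp _) := by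
  intro ψ
  have : (volume : Measure (Spacetime n)).IsAddHaarMeasure :=
    inferInstanceAs ((volume : Measure (Space n)).prod (volume : Measure ℝ)).IsAddHaarMeasure
  have hi : ∀ {f g : Spacetime n → ℝ}, Continuous f → Continuous g → HasCompactSupport g →
      Integrable (fun z => f z * g z) volume := fun hf hg hgc =>
    (hf.mul hg).integrable_of_hasCompactSupport hgc.mul_left
  have hφc := (contDiff_fderiv_test φ v).continuous
  have hψc := (contDiff_fderiv_test ψ v).continuous
  have key := integral_mul_fderiv_eq_neg_fderiv_mul_of_integrable (𝕜 := ℝ) (μ := volume)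
    (f := φ) (g := ψ) (v := v) (hi hφc ψ.continuous ψ.hasCompactSupport)
    (hi φ.continuous hψc (ψ.hasCompactSupport.fderiv_apply (𝕜 := ℝ) v))
    (hi φ.continuous ψ.continuous ψ.hasCompactSupport)
    (fun z _ => differentiable_test φ z) (fun z _ => differentiable_test ψ z)
  have hz : ∀ z, z ∉ (U : Set (Spacetime n)) → φ z = 0 := fun z hz => by
    by_contra hne
    exact hz (φ.tsupport_subset (subset_tsupport _ hne))
  have hz' : ∀ z, z ∉ (U : Set (Spacetime n)) → ψ z = 0 := fun z hz => by
    by_contra hne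
    exact hz (ψ.tsupport_subset (subset_tsupport _ hne))
  rw [← setIntegral_eq_integral_of_forall_compl_eq_zero (s := (U : Set (Spacetime n)))
      (fun z h => by rw [hz z h, zero_mul]),
    ← setIntegral_eq_integral_of_forall_compl_eq_zero (s := (U : Set (Spacetime n)))
      (f := fun z => fderiv ℝ φ z v * ψ z) (fun z h => by rw [hz' z h, mul_zero])] at key
  have e₁ : ∫ z in (U : Set (Spacetime n)), testL2 φ z * fderiv ℝ ψ z v =
      ∫ z in (U : Set (Spacetime n)), φ z * fderiv ℝ ψ z v := by
    refine integral_congr_ae ?_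
    filter_upwards [(memLp_test φ).coeFn_toLp] with z hz
    simp only [testL2, hz]
  have e₂ : ∫ z in (U : Set (Spacetime n)), ((memLp_fderiv_test φ v).toLp _ : L2 U) z * ψ z =
      ∫ z in (U : Set (Spacetime n)), fderiv ℝ φ z v * ψ z := by
    refine integral_congr_ae ?_
    filter_upwards [(memLp_fderiv_test φ v).coeFn_toLp] with z hz
    simp only [hz]
  rw [e₁, e₂, key]

/-- A test function as an element of `H¹(U)`. -/
noncomputable def testH1 (φ : 𝓓(U, ℝ)) : H1 U :=
  ⟨testL2 φ, fun j => ⟨_, isWeakDeriv_test φ (stDir n j)⟩⟩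

theorem weakDeriv_testH1 (φ : 𝓓(U, ℝ)) (j : Option (Fin n)) :
    weakDeriv U j (testH1 φ) = (memLp_fderiv_test φ (stDir n j)).toLp _ :=
  weakDeriv_eq (isWeakDeriv_test φ (stDir n j))

/-- A test function as an element of `H¹₀(U)`. -/
noncomputable def testH10 (φ : 𝓓(U, ℝ)) : Energy (H10 U) :=
  (⟨testH1 φ, by
    refine (IsH10With.of_test φ).congr (memLp_test φ).coeFn_toLp.symm (fun j => ?_)
    rw [weakDeriv_testH1]
    exact (memLp_fderiv_test φ (stDir n j)).coeFn_toLp.symm⟩ : H10 U)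

/-- Test functions are dense in `H¹₀(U)`. -/
theorem denseRange_testH10 : DenseRange (testH10 (U := U)) := by
  intro w
  obtain ⟨φ, -, hφ⟩ : IsH10With U (stDir n) (w.toL2) (fun j => weakDeriv U j w.toH1) := w.2
  refine mem_closure_of_tendsto (b := atTop) (f := fun k => testH10 (φ k)) ?_
    (Eventually.of_forall fun k => mem_range_self _)
  rw [tendsto_iff_norm_sub_tendsto_zero]
  have hnorm : ∀ k, ‖testH10 (φ k) - w‖ =
      Real.sqrt (∑ j, (eLpNorm (fun z => fderiv ℝ (φ k) z (stDir n j) - weakDeriv U j w.toH1 z) 2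
        (volume.restrict (U : Set (Spacetime n)))).toReal ^ 2) := by
    intro k
    rw [Energy.norm_eq, PiLp.norm_eq_of_L2]
    congr 1
    refine Finset.sum_congr rfl fun j _ => ?_
    congr 1
    have : (Energy.grad (testH10 (φ k) - w)) j =
        weakDeriv U j (testH1 (φ k)) - weakDeriv U j w.toH1 := by
      rw [map_sub]
      rfl
    rw [this, weakDeriv_testH1, Lp.norm_def]
    congr 1
    refine eLpNorm_congr_ae ?_
    filter_upwards [Lp.coeFn_sub ((memLp_fderiv_test (φ k) (stDir n j)).toLp _)
      (weakDeriv U j w.toH1), (memLp_fderiv_test (φ k) (stDir n j)).coeFn_toLp] with z h1 h2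
    rw [h1, Pi.sub_apply, h2]
  simp only [hnorm]
  have h0 : ∀ j, Tendsto (fun k => (eLpNorm (fun z => fderiv ℝ (φ k) z (stDir n j) -
      weakDeriv U j w.toH1 z) 2 (volume.restrict (U : Set (Spacetime n)))).toReal ^ 2)
      atTop (𝓝 0) := fun j => by
    simpa using ((ENNReal.tendsto_toReal (by simp)).comp (hφ j)).pow 2
  have h1 := (Real.continuous_sqrt.tendsto _).comp
    (tendsto_finsetSum Finset.univ fun j _ => h0 j)
  rw [Finset.sum_const_zero, Real.sqrt_zero] at h1
  exact h1

end Sobolev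

/-! ### The anisotropic spaces on the cylinder `Q = Ω × (0, T)` -/

section Cylinder

variable {n : ℕ}

/-- The continuous representative of `u : [0, T] → L²(Ω)` vanishes at the time `t₀`. -/
def TraceZeroAt (Ω : Opens (Space n)) (T t₀ : ℝ) (u : L2 (cyl Ω 0 T)) : Prop :=
  ∃ γ : ℝ → L2 Ω, ContinuousOn γ (Icc 0 T) ∧
    (∀ᵐ t ∂(volume.restrict (Ioo 0 T)),
      γ t =ᵐ[volume.restrict (Ω : Set (Space n))] fun x => u (x, t)) ∧
    γ t₀ = 0

theorem ae_slice {Ω : Opens (Space n)} {T : ℝ} {f g : Spacetime n → ℝ}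
    (h : f =ᵐ[volume.restrict (cyl Ω 0 T : Set (Spacetime n))] g) :
    ∀ᵐ t ∂(volume.restrict (Ioo 0 T)), (fun x => f (x, t))
      =ᵐ[volume.restrict (Ω : Set (Space n))] fun x => g (x, t) := by
  have e : (volume.restrict (cyl Ω 0 T : Set (Spacetime n))) =
      (volume.restrict (Ω : Set (Space n))).prod (volume.restrict (Ioo 0 T)) := by
    rw [Measure.prod_restrict]
    rfl
  rw [e, ← Measure.prod_swap] at h
  have h' := ae_of_ae_map measurable_swap.aemeasurable h
  exact Measure.ae_ae_of_ae_prod h'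

theorem aestronglyMeasurable_slice {U : Opens (Spacetime n)} (u : L2 U) (t : ℝ)
    (μ : Measure (Space n)) : AEStronglyMeasurable (fun x => u (x, t)) μ :=
  ((Lp.stronglyMeasurable u).comp_measurable (by fun_prop)).aestronglyMeasurable

/-- `L²(0, T; H¹₀(Ω)) ∩ H¹(0, T; L²(Ω))` with vanishing trace at the time `t₀`: the functions
`u ∈ H¹(Q)` such that `u(·, t) ∈ H¹₀(Ω)`, with gradient `∇ₓ u(·, t)`, for almost all `t`, and
`u(·, t₀) = 0`. -/
def H11 (Ω : Opens (Space n)) (T t₀ : ℝ) : Submodule ℝ (H1 (cyl Ω 0 T)) where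
  carrier := {u |
    (∀ᵐ t ∂(volume.restrict (Ioo 0 T)), IsH10With Ω (spaceDir n)
      (fun x => (u : L2 (cyl Ω 0 T)) (x, t))
      (fun i x => weakDeriv (cyl Ω 0 T) (some i) u (x, t))) ∧
    TraceZeroAt Ω T t₀ u}
  zero_mem' := by
    have h0 := ae_slice (Lp.coeFn_zero ℝ 2 (volume.restrict (cyl Ω 0 T : Set (Spacetime n))))
    refine ⟨?_, fun _ => 0, continuousOn_const, ?_, rfl⟩
    · filter_upwards [h0] with t ht
      refine IsH10With.zero.congr ht.symm (fun i => ?_)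
      rw [map_zero]
      exact ht.symm
    · filter_upwards [h0] with t ht
      exact (Lp.coeFn_zero ℝ 2 (volume.restrict (Ω : Set (Space n)))).trans ht.symm
  add_mem' := by
    rintro u₁ u₂ ⟨h₁, γ₁, c₁, e₁, z₁⟩ ⟨h₂, γ₂, c₂, e₂, z₂⟩
    have ha := ae_slice (Lp.coeFn_add (u₁ : L2 (cyl Ω 0 T)) (u₂ : L2 (cyl Ω 0 T)))
    have hd : ∀ᵐ t ∂(volume.restrict (Ioo 0 T)), ∀ i : Fin n, _ := ae_all_iff.2 fun i =>
      ae_slice (Lp.coeFn_add (weakDeriv (cyl Ω 0 T) (some i) u₁)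
        (weakDeriv (cyl Ω 0 T) (some i) u₂))
    refine ⟨?_, fun t => γ₁ t + γ₂ t, c₁.add c₂, ?_, by simp [z₁, z₂]⟩
    · filter_upwards [h₁, h₂, ha, hd] with t t₁ t₂ ta td
      refine (t₁.add t₂ (aestronglyMeasurable_slice _ _ _) (aestronglyMeasurable_slice _ _ _)
        (fun i => aestronglyMeasurable_slice _ _ _)
        (fun i => aestronglyMeasurable_slice _ _ _)).congr ta.symm (fun i => ?_)
      rw [map_add]
      exact (td i).symm
    · filter_upwards [e₁, e₂, ha] with t t₁ t₂ ta
      exact ((Lp.coeFn_add _ _).trans (t₁.add t₂)).trans ta.symm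
  smul_mem' := by
    rintro c u ⟨h, γ, hc, e, z⟩
    have ha := ae_slice (Lp.coeFn_smul c (u : L2 (cyl Ω 0 T)))
    have hd : ∀ᵐ t ∂(volume.restrict (Ioo 0 T)), ∀ i : Fin n, _ := ae_all_iff.2 fun i =>
      ae_slice (Lp.coeFn_smul c (weakDeriv (cyl Ω 0 T) (some i) u))
    refine ⟨?_, fun t => c • γ t, hc.const_smul c, ?_, by simp [z]⟩
    · filter_upwards [h, ha, hd] with t t₁ ta td
      refine (t₁.smul c).congr ta.symm (fun i => ?_)
      rw [map_smul]
      exact (td i).symm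
    · filter_upwards [e, ha] with t t₁ ta
      exact ((Lp.coeFn_smul _ _).trans (t₁.const_smul c)).trans ta.symm

/-- `H^{1,1}_{0;0,}(Q)`: zero initial condition `u(·, 0) = 0`. -/
abbrev H11init (Ω : Opens (Space n)) (T : ℝ) : Submodule ℝ (H1 (cyl Ω 0 T)) := H11 Ω T 0

/-- `H^{1,1}_{0;,0}(Q)`: zero terminal condition `q(·, T) = 0`. -/
abbrev H11term (Ω : Opens (Space n)) (T : ℝ) : Submodule ℝ (H1 (cyl Ω 0 T)) := H11 Ω T T

/-- The test space `Y = H^{1,1}_{0;,0}(Q)` with its norm `|·|_{H¹(Q)}`. -/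
abbrev Y (Ω : Opens (Space n)) (T : ℝ) : Type := Energy (H11term Ω T)

/-- The space `H¹₀(Q₋)`, `Q₋ = Ω × (-T, T)`, with its norm `|·|_{H¹(Q₋)}`. -/
abbrev H10m (Ω : Opens (Space n)) (T : ℝ) : Type := Energy (H10 (cyl Ω (-T) T))

/-! ### The distributional wave operator and the ansatz space -/

/-- The wave operator `□ φ = ∂ₜₜ φ - Δₓ φ` on smooth functions. -/
noncomputable def box (φ : Spacetime n → ℝ) (z : Spacetime n) : ℝ :=
  fderiv ℝ (fun y => fderiv ℝ φ y (stDir n none)) z (stDir n none) -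
    ∑ i : Fin n, fderiv ℝ (fun y => fderiv ℝ φ y (stDir n (some i))) z (stDir n (some i))

/-- The zero extension `ũ` of `u ∈ L²(Q)`. -/
noncomputable def zeroExt (Ω : Opens (Space n)) (T : ℝ) (u : L2 (cyl Ω 0 T)) :
    Spacetime n → ℝ :=
  (cyl Ω 0 T : Set (Spacetime n)).indicator u

/-- `F ∈ [H¹₀(Q₋)]*` represents the distribution `□ ũ` on `Q₋`. -/
def IsBox (Ω : Opens (Space n)) (T : ℝ) (u : L2 (cyl Ω 0 T)) (F : StrongDual ℝ (H10m Ω T)) :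
    Prop :=
  ∀ φ : 𝓓(cyl Ω (-T) T, ℝ),
    F (testH10 φ) = ∫ z in (cyl Ω (-T) T : Set (Spacetime n)), zeroExt Ω T u z * box φ z

variable {Ω : Opens (Space n)} {T : ℝ}

theorem IsBox.unique {u : L2 (cyl Ω 0 T)} {F₁ F₂ : StrongDual ℝ (H10m Ω T)}
    (h₁ : IsBox Ω T u F₁) (h₂ : IsBox Ω T u F₂) : F₁ = F₂ :=
  DFunLike.coe_injective (denseRange_testH10.equalizer F₁.continuous F₂.continuous
    (funext fun φ => (h₁ φ).trans (h₂ φ).symm))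

theorem memLp_box {U : Opens (Spacetime n)} (φ : 𝓓(U, ℝ)) (V : Opens (Spacetime n)) :
    MemLp (box φ) 2 (volume.restrict (V : Set (Spacetime n))) := by
  have h : ∀ v : Spacetime n, MemLp (fun z => fderiv ℝ (fun y => fderiv ℝ φ y v) z v) 2
      (volume : Measure (Spacetime n)) := fun v => by
    have h1 : ContDiff ℝ ((⊤ : ℕ∞) : WithTop ℕ∞)
        (fderiv ℝ (fun y => fderiv ℝ φ y v)) :=
      (contDiff_fderiv_test φ v).fderiv_right (by simp)
    exact (h1.clm_apply contDiff_const).continuous.memLp_of_hasCompactSupport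
      ((φ.hasCompactSupport.fderiv_apply (𝕜 := ℝ) v).fderiv_apply (𝕜 := ℝ) v)
  exact ((h _).sub (memLp_finsetSum _ fun i _ => h _)).restrict _

theorem zeroExt_integral (u : L2 (cyl Ω 0 T)) (f : Spacetime n → ℝ) :
    ∫ z in (cyl Ω (-T) T : Set (Spacetime n)), zeroExt Ω T u z * f z =
      ∫ z in (cyl Ω 0 T : Set (Spacetime n)), u z * f z := by
  have hsub : (cyl Ω 0 T : Set (Spacetime n)) ⊆ cyl Ω (-T) T :=
    fun z hz => ⟨hz.1, by
      have h1 := hz.2.1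
      have h2 := hz.2.2
      linarith, hz.2.2⟩
  have : (fun z => zeroExt Ω T u z * f z) =
      (cyl Ω 0 T : Set (Spacetime n)).indicator (fun z => u z * f z) := by
    ext z
    by_cases hz : z ∈ (cyl Ω 0 T : Set (Spacetime n)) <;> simp [zeroExt, hz]
  rw [this, setIntegral_indicator (cyl Ω 0 T).isOpen.measurableSet,
    inter_eq_self_of_subset_right hsub]

theorem IsBox.add {u₁ u₂ : L2 (cyl Ω 0 T)} {F₁ F₂ : StrongDual ℝ (H10m Ω T)}
    (h₁ : IsBox Ω T u₁ F₁) (h₂ : IsBox Ω T u₂ F₂) : IsBox Ω T (u₁ + u₂) (F₁ + F₂) := by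
  intro φ
  have a₁ := h₁ φ
  have a₂ := h₂ φ
  rw [zeroExt_integral] at a₁ a₂ ⊢
  rw [integral_add_mul _ _ (memLp_box φ _), ← a₁, ← a₂]
  rfl

theorem IsBox.smul {u : L2 (cyl Ω 0 T)} {F : StrongDual ℝ (H10m Ω T)} (c : ℝ)
    (h : IsBox Ω T u F) : IsBox Ω T (c • u) (c • F) := by
  intro φ
  have a := h φ
  rw [zeroExt_integral] at a ⊢
  rw [integral_smul_mul, ← a]
  rfl

/-- `𝓗(Q)`: the functions `u ∈ L²(Q)` with `□ ũ ∈ [H¹₀(Q₋)]*`. -/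
def calH (Ω : Opens (Space n)) (T : ℝ) : Submodule ℝ (L2 (cyl Ω 0 T)) where
  carrier := {u | ∃ F : StrongDual ℝ (H10m Ω T), IsBox Ω T u F}
  zero_mem' := ⟨0, fun φ => by
    rw [zeroExt_integral, integral_zero_mul]
    rfl⟩
  add_mem' := by
    rintro u₁ u₂ ⟨F₁, h₁⟩ ⟨F₂, h₂⟩
    exact ⟨F₁ + F₂, h₁.add h₂⟩
  smul_mem' := by
    rintro c u ⟨F, h⟩
    exact ⟨c • F, h.smul c⟩

/-- The map `u ↦ □ ũ` from `𝓗(Q)` to `[H¹₀(Q₋)]*`. -/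
noncomputable def boxDual (Ω : Opens (Space n)) (T : ℝ) :
    calH Ω T →ₗ[ℝ] StrongDual ℝ (H10m Ω T) where
  toFun u := u.2.choose
  map_add' u₁ u₂ := (u₁ + u₂).2.choose_spec.unique (u₁.2.choose_spec.add u₂.2.choose_spec)
  map_smul' c u := (c • u).2.choose_spec.unique (u.2.choose_spec.smul c)

theorem isBox_boxDual (u : calH Ω T) : IsBox Ω T u (boxDual Ω T u) := u.2.choose_spec

/-- `u ↦ (u, □ ũ)`; the graph norm of `𝓗(Q)` is `‖graphH u‖ = (‖u‖² + ‖□ ũ‖²)^{1/2}`. -/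
noncomputable def graphH (Ω : Opens (Space n)) (T : ℝ) :
    calH Ω T →ₗ[ℝ] WithLp 2 (L2 (cyl Ω 0 T) × StrongDual ℝ (H10m Ω T)) :=
  (WithLp.linearEquiv 2 ℝ (L2 (cyl Ω 0 T) × StrongDual ℝ (H10m Ω T))).symm.toLinearMap ∘ₗ
    (calH Ω T).subtype.prod (boxDual Ω T)

/-- `𝓗_{0;0,}(Q)`: the closure of `H^{1,1}_{0;0,}(Q)` in `𝓗(Q)` with respect to the graph norm. -/
def calH0 (Ω : Opens (Space n)) (T : ℝ) : Submodule ℝ (calH Ω T) where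
  carrier := {u | ∀ ε > 0, ∃ w : calH Ω T, (∃ w' ∈ H11init Ω T, (w' : L2 (cyl Ω 0 T)) = w) ∧
    ‖graphH Ω T (u - w)‖ < ε}
  zero_mem' := fun ε hε => ⟨0, ⟨0, zero_mem _, rfl⟩, by simpa using hε⟩
  add_mem' := by
    intro u₁ u₂ h₁ h₂ ε hε
    obtain ⟨w₁, ⟨v₁, hv₁, e₁⟩, b₁⟩ := h₁ (ε / 2) (by linarith)
    obtain ⟨w₂, ⟨v₂, hv₂, e₂⟩, b₂⟩ := h₂ (ε / 2) (by linarith)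
    refine ⟨w₁ + w₂, ⟨v₁ + v₂, add_mem hv₁ hv₂, by simp [e₁, e₂]⟩, ?_⟩
    rw [add_sub_add_comm, map_add]
    exact (norm_add_le _ _).trans_lt (by linarith)
  smul_mem' := by
    intro c u h ε hε
    obtain ⟨w, ⟨v, hv, e⟩, b⟩ := h (ε / (|c| + 1)) (by positivity)
    refine ⟨c • w, ⟨c • v, Submodule.smul_mem _ c hv, by simp [e]⟩, ?_⟩
    rw [← smul_sub, map_smul, norm_smul, Real.norm_eq_abs]
    rw [lt_div_iff₀ (by positivity)] at b
    nlinarith [norm_nonneg (graphH Ω T (u - w)), abs_nonneg c]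

/-- The ansatz space `X = 𝓗_{0;0,}(Q)`, equipped with the norm `‖u‖_X = ‖□ ũ‖_{[H¹₀(Q₋)]*}`
(and not with the `L²(Q)` norm). -/
def X (Ω : Opens (Space n)) (T : ℝ) : Type := calH0 Ω T

noncomputable instance : AddCommGroup (X Ω T) := inferInstanceAs (AddCommGroup (calH0 Ω T))

noncomputable instance : Module ℝ (X Ω T) := inferInstanceAs (Module ℝ (calH0 Ω T))

/-- The map `u ↦ □ ũ` on `X`. -/
noncomputable def X.box : X Ω T →ₗ[ℝ] StrongDual ℝ (H10m Ω T) :=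
  boxDual Ω T ∘ₗ (calH0 Ω T).subtype

noncomputable instance : SeminormedAddCommGroup (X Ω T) :=
  SeminormedAddCommGroup.induced _ _ (X.box (Ω := Ω) (T := T))

noncomputable instance : NormedSpace ℝ (X Ω T) :=
  NormedSpace.induced ℝ _ _ (X.box (Ω := Ω) (T := T))

theorem X.norm_eq (u : X Ω T) : ‖u‖ = ‖X.box u‖ := rfl

/-! ### The operators `B` and `S = B* A⁻¹ B` -/

/-- `E` is an extension operator: `E q` restricted to `Q` is `q`. -/
def IsExtension (E : Y Ω T →L[ℝ] H10m Ω T) : Prop :=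
  ∀ q : Y Ω T, ∀ᵐ z ∂(volume.restrict (cyl Ω 0 T : Set (Spacetime n))), (E q).toL2 z = q.toL2 z

/-- `E` is the extension by reflection in time: `(E q)(x, t) = q(x, |t|)`. -/
def IsTimeReflection (E : Y Ω T →L[ℝ] H10m Ω T) : Prop :=
  ∀ q : Y Ω T, ∀ᵐ z ∂(volume.restrict (cyl Ω (-T) T : Set (Spacetime n))),
    (E q).toL2 z = q.toL2 (z.1, |z.2|)

/-- `B : X → Y*`, `⟨B u, q⟩ = ⟨□ ũ, E q⟩`. -/
noncomputable def opB (E : Y Ω T →L[ℝ] H10m Ω T) : X Ω T →L[ℝ] StrongDual ℝ (Y Ω T) :=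
  LinearMap.mkContinuous₂
    (LinearMap.mk₂ ℝ (fun u q => X.box u (E q))
      (fun u v q => by simp) (fun c u q => by simp)
      (fun u p q => by simp) (fun c u q => by simp)) ‖E‖
    (fun u q => by
      calc ‖X.box u (E q)‖ ≤ ‖X.box u‖ * ‖E q‖ := (X.box u).le_opNorm _
        _ ≤ ‖X.box u‖ * (‖E‖ * ‖q‖) := by gcongr; exact E.le_opNorm q
        _ = ‖E‖ * ‖u‖ * ‖q‖ := by rw [← X.norm_eq]; ring)

/-- The dual operator `B* : Y → X*`, `⟨B* q, u⟩ = ⟨B u, q⟩`. -/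
noncomputable def opBstar (E : Y Ω T →L[ℝ] H10m Ω T) : Y Ω T →L[ℝ] StrongDual ℝ (X Ω T) :=
  (opB E).flip

/-- `S = B* A⁻¹ B : X → X*`. Here `inverse` is the inverse operator `A⁻¹ : Y* → Y` as soon as `A`
is invertible (an isomorphism of `Y` onto `Y*`). -/
noncomputable def opS (E : Y Ω T →L[ℝ] H10m Ω T) : X Ω T →L[ℝ] StrongDual ℝ (X Ω T) :=
  opBstar E ∘L (opA (H11term Ω T)).inverse ∘L opB E

/-- `‖u‖_S = ⟨S u, u⟩^{1/2}`. -/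
noncomputable def normS (E : Y Ω T →L[ℝ] H10m Ω T) (u : X Ω T) : ℝ := Real.sqrt (opS E u u)

end Cylinder

end WaveControl

open WaveControl

/-!
With `w = A⁻¹ B u` one has `⟨S u, v⟩ = ⟨B v, w⟩`. The form of `A` is the inner product of `Y`, and `Y`
is complete, so `A` is the Riesz isomorphism and an isometry onto `Y*` (`opA_isInvertible`,
`norm_opA`). Therefore `⟨S u, u⟩ = ⟨A w, w⟩ = ‖w‖² = ‖B u‖²`, that is, `‖u‖_S = ‖B u‖`
(`normS_eq`), and everything reduces to comparing `‖B u‖` with `‖u‖_X`. The upper bounds follow from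
`‖E‖ ≤ 2`. For the lower bound (`norm_le_norm_opB`), note that for `u ∈ X` the value `⟨□ ũ, φ⟩` only
depends on the restriction of `φ` to `Q` (`X.box_eq_zero`). For `u ∈ H^{1,1}_{0;0,}(Q)` this is the
formula `⟨□ ũ, φ⟩ = -⟨∂ₜ u, ∂ₜ φ⟩_Q + ⟨∇ₓ u, ∇ₓ φ⟩_Q` (`boxDual_eq_derivPairing`), and it passes to
limits. Hence a test function `φ` on `Q₋` may be replaced by `E (φ|_Q)`, and
`‖φ|_Q‖_Y ≤ |φ|_{H¹(Q₋)}`.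

Completeness of `Y` (`isClosed_range_grad`) and the definiteness of the norm rest on the fact that a
function in `H¹(Q)` with vanishing trace at `t₀` is the primitive in time of its time derivative
(`TraceZeroAt.ae_eq_prim`), which is a form of the du Bois-Reymond lemma. That `□ ũ = 0` implies
`u = 0` for `u ∈ X` is a consequence of an a priori estimate of `‖u‖_{L²(Q)}` by `‖□ ũ‖`
(`norm_le_norm_boxDual`). It comes from testing with `v(·, t) = ∫ₜᵀ e^{-2s} u(·, s) ds`, extended
to `Q₋` by `E`.

The even reflection of `q ∈ Y` in time has a square integrable gradient on `Q₋`, and its norm is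
`√2 ‖q‖_Y`. What remains is that it is a limit of test functions (`reflH1_mem_H10`). Its extension
by zero is weakly differentiable on all of space-time, because `q` can be integrated by parts
against any smooth function of compact support. A dilation about a point of the convex set `Q₋`
moves the support into a compact subset of `Q₋` (`isH10With_of_convex`), where mollification
applies (`isH10With_of_compact`). Memberships in `H¹₀` are handled throughout by duality: as a closed
subspace of `L²(U)^{1 + ι}`, the space `H¹₀(U)` is its own double orthogonal complement
(`isH10With_iff_orthogonal`).
-/

namespace WaveControl

/-! ### Primitives of functions of one variable -/

theorem contDiff_one_absCont {ψ : ℝ → ℝ} (hψ : ContDiff ℝ 1 ψ) (a b : ℝ) :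
    AbsolutelyContinuousOnInterval ψ a b :=
  hψ.contDiffOn.absolutelyContinuousOnInterval

/-- Integration by parts for the primitive of a merely integrable function. The boundary terms at
`0` and `T` vanish through one of the two factors. -/
theorem integral_primitive_mul_deriv {f ψ : ℝ → ℝ} {T t₀ : ℝ} (ht₀ : t₀ ∈ uIcc 0 T)
    (hf : IntervalIntegrable f volume 0 T) (hψ : ContDiff ℝ 1 ψ)
    (h0 : t₀ = 0 ∨ ψ 0 = 0) (hT : t₀ = T ∨ ψ T = 0) :
    ∫ t in 0..T, (∫ s in t₀..t, f s) * deriv ψ t = -∫ t in 0..T, f t * ψ t := by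
  have hac := hf.absolutelyContinuousOnInterval_intervalIntegral ht₀
  rw [hac.integral_mul_deriv_eq_deriv_mul (contDiff_one_absCont hψ 0 T)]
  have e0 : (∫ s in t₀..0, f s) * ψ 0 = 0 := by
    rcases h0 with h | h
    · simp [h]
    · simp [h]
  have eT : (∫ s in t₀..T, f s) * ψ T = 0 := by
    rcases hT with h | h
    · simp [h]
    · simp [h]
  rw [e0, eT, sub_zero, zero_sub]
  congr 1
  refine intervalIntegral.integral_congr_ae ?_
  filter_upwards [hf.ae_hasDerivAt_integral] with t ht h
  rw [(ht (uIoc_subset_uIcc h) t₀ ht₀).deriv]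

/-- The energy identity `2 ∫ F' F w = [F² w] - ∫ F² w'` for a primitive `F` of an integrable
function and a smooth weight `w`. -/
theorem integral_mul_primitive_mul {f w : ℝ → ℝ} {T t₀ : ℝ} (ht₀ : t₀ ∈ uIcc 0 T)
    (hf : IntervalIntegrable f volume 0 T) (hw : ContDiff ℝ 1 w) :
    2 * ∫ t in 0..T, f t * (∫ s in t₀..t, f s) * w t =
      (∫ s in t₀..T, f s) ^ 2 * w T - (∫ s in t₀..0, f s) ^ 2 * w 0 -
        ∫ t in 0..T, (∫ s in t₀..t, f s) ^ 2 * deriv w t := by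
  have hac := hf.absolutelyContinuousOnInterval_intervalIntegral ht₀
  have h := (hac.fun_mul hac).integral_mul_deriv_eq_deriv_mul (contDiff_one_absCont hw 0 T)
  simp only [← pow_two] at h
  rw [h]
  have : ∫ t in 0..T, deriv (fun t => (∫ s in t₀..t, f s) ^ 2) t * w t =
      2 * ∫ t in 0..T, f t * (∫ s in t₀..t, f s) * w t := by
    rw [← intervalIntegral.integral_const_mul]
    refine intervalIntegral.integral_congr_ae ?_
    filter_upwards [hf.ae_hasDerivAt_integral] with t ht h
    rw [((ht (uIoc_subset_uIcc h) t₀ ht₀).fun_pow 2).deriv]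
    push_cast
    ring
  rw [this]
  ring

/-- A case of the Cauchy–Schwarz inequality. -/
theorem sq_integral_le {f : ℝ → ℝ} {T a b : ℝ} (ha : a ∈ Icc 0 T) (hb : b ∈ Icc 0 T)
    (hf : MemLp f 2 (volume.restrict (Ioo 0 T))) :
    (∫ s in a..b, f s) ^ 2 ≤ |b - a| * ∫ s in Ioo 0 T, f s ^ 2 := by
  wlog hab : a ≤ b generalizing a b
  · rw [intervalIntegral.integral_symm, neg_sq, abs_sub_comm]
    exact this hb ha (le_of_not_ge hab)
  rw [intervalIntegral.integral_of_le hab, integral_Ioc_eq_integral_Ioo,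
    abs_of_nonneg (sub_nonneg.2 hab)]
  have hsub : Ioo a b ⊆ Ioo 0 T := Ioo_subset_Ioo ha.1 hb.2
  have hf' : MemLp f 2 (volume.restrict (Ioo a b)) :=
    hf.mono_measure (Measure.restrict_mono hsub le_rfl)
  have hint : Integrable f (volume.restrict (Ioo a b)) := hf'.integrable (by norm_num)
  have hsq : Integrable (fun s => f s ^ 2) (volume.restrict (Ioo a b)) := hf'.integrable_sq
  have hmono : ∫ s in Ioo a b, f s ^ 2 ≤ ∫ s in Ioo 0 T, f s ^ 2 :=
    setIntegral_mono_set hf.integrable_sq (Eventually.of_forall fun s => sq_nonneg _)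
      hsub.eventuallyLE
  refine le_trans ?_ (mul_le_mul_of_nonneg_left hmono (sub_nonneg.2 hab))
  set m := ∫ s in Ioo a b, f s with hm
  -- the variance of `f` on `(a, b)` is nonnegative
  have key : 0 ≤ ∫ s in Ioo a b, ((b - a) * f s - m) ^ 2 :=
    integral_nonneg fun s => sq_nonneg _
  have e : ∫ s in Ioo a b, ((b - a) * f s - m) ^ 2 =
      (b - a) ^ 2 * (∫ s in Ioo a b, f s ^ 2) - 2 * (b - a) * m * m + (b - a) * m ^ 2 := by
    have : ∀ s, ((b - a) * f s - m) ^ 2 =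
        (b - a) ^ 2 * f s ^ 2 - 2 * (b - a) * m * f s + m ^ 2 := fun s => by ring
    simp only [this]
    rw [integral_add (f := fun s => (b - a) ^ 2 * f s ^ 2 - 2 * (b - a) * m * f s)
        ((hsq.const_mul _).sub (hint.const_mul _)) (integrable_const _),
      integral_sub (hsq.const_mul _) (hint.const_mul _), integral_const_mul, integral_const_mul,
      ← hm]
    simp [hab]
  rw [e] at key
  rcases hab.eq_or_lt with rfl | hlt
  · simp [hm]
  · have hpos : 0 < b - a := sub_pos.2 hlt
    have : 0 ≤ (b - a) * ((b - a) * (∫ s in Ioo a b, f s ^ 2) - m ^ 2) := by linarith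
    have := nonneg_of_mul_nonneg_right this hpos
    linarith

/-! ### Fubini on the cylinder -/

section Cylinder

variable {n : ℕ} {Ω : Opens (Space n)} {T : ℝ}

theorem restrict_cyl (Ω : Opens (Space n)) (a b : ℝ) :
    (volume.restrict (cyl Ω a b : Set (Spacetime n))) =
      (volume.restrict (Ω : Set (Space n))).prod (volume.restrict (Ioo a b)) := by
  rw [Measure.prod_restrict]
  rfl

theorem integral_cyl {a b : ℝ} {f : Spacetime n → ℝ}
    (hf : Integrable f (volume.restrict (cyl Ω a b : Set (Spacetime n)))) :
    ∫ z in (cyl Ω a b : Set (Spacetime n)), f z =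
      ∫ x in (Ω : Set (Space n)), ∫ t in Ioo a b, f (x, t) := by
  rw [restrict_cyl] at hf ⊢
  exact integral_prod f hf

theorem integral_cyl_swap {a b : ℝ} {f : Spacetime n → ℝ}
    (hf : Integrable f (volume.restrict (cyl Ω a b : Set (Spacetime n)))) :
    ∫ z in (cyl Ω a b : Set (Spacetime n)), f z =
      ∫ t in Ioo a b, ∫ x in (Ω : Set (Space n)), f (x, t) := by
  rw [restrict_cyl] at hf ⊢
  exact integral_prod_symm f hf

theorem memLp_fst {a b : ℝ} {f : Spacetime n → ℝ}
    (hf : MemLp f 2 (volume.restrict (cyl Ω a b : Set (Spacetime n)))) :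
    ∀ᵐ x ∂volume.restrict (Ω : Set (Space n)),
      MemLp (fun t => f (x, t)) 2 (volume.restrict (Ioo a b)) := by
  rw [restrict_cyl] at hf
  filter_upwards [hf.1.prodMk_left, hf.integrable_sq.prod_right_ae] with x h1 h2
  exact (memLp_two_iff_integrable_sq h1).2 h2

theorem memLp_snd {a b : ℝ} {f : Spacetime n → ℝ}
    (hf : MemLp f 2 (volume.restrict (cyl Ω a b : Set (Spacetime n)))) :
    ∀ᵐ t ∂volume.restrict (Ioo a b),
      MemLp (fun x => f (x, t)) 2 (volume.restrict (Ω : Set (Space n))) := by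
  rw [restrict_cyl] at hf
  filter_upwards [hf.1.prod_swap.prodMk_left, hf.integrable_sq.prod_left_ae] with x h1 h2
  exact (memLp_two_iff_integrable_sq h1).2 h2

/-! ### Primitives in time -/

/-- The primitive in time of `g` that vanishes at the time `t₀`. For `g ∈ L²(Q)`, almost every slice
`g(x, ·)` is integrable, so the junk value of the integral only occurs on a null set of `x`. -/
noncomputable def prim (t₀ : ℝ) (g : Spacetime n → ℝ) (z : Spacetime n) : ℝ :=
  ∫ s in t₀..z.2, g (z.1, s)

theorem stronglyMeasurable_prim {g : Spacetime n → ℝ} (t₀ : ℝ) (h : StronglyMeasurable g) :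
    StronglyMeasurable (prim t₀ g) := by
  have hm : ∀ c d : Spacetime n → ℝ, Measurable c → Measurable d →
      StronglyMeasurable fun z : Spacetime n => ∫ s in Ioc (c z) (d z), g (z.1, s) := by
    intro c d hc hd
    let S : Set (Spacetime n × ℝ) := {p | c p.1 < p.2 ∧ p.2 ≤ d p.1}
    have hS : MeasurableSet S :=
      (measurableSet_lt (hc.comp measurable_fst) measurable_snd).inter
        (measurableSet_le measurable_snd (hd.comp measurable_fst))
    let G : Spacetime n × ℝ → ℝ := fun p => g (p.1.1, p.2)
    have hG : StronglyMeasurable G := h.comp_measurable (by fun_prop)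
    have e : (fun z : Spacetime n => ∫ s in Ioc (c z) (d z), g (z.1, s)) = fun z =>
        ∫ s, S.indicator G (z, s) := by
      ext z
      rw [← integral_indicator measurableSet_Ioc]
      rfl
    rw [e]
    exact StronglyMeasurable.integral_prod_right' (hG.indicator hS)
  exact (hm _ _ measurable_const measurable_snd).sub (hm _ _ measurable_snd measurable_const)

/-- The squared norm in time, `x ↦ ∫₀ᵀ g(x, s)² ds`. -/
noncomputable def timeSq (T : ℝ) (g : Spacetime n → ℝ) (x : Space n) : ℝ :=
  ∫ s in Ioo 0 T, g (x, s) ^ 2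

section prim

variable {g : Spacetime n → ℝ} {t₀ : ℝ}

theorem integrable_timeSq (hg : MemLp g 2 (volume.restrict (cyl Ω 0 T : Set (Spacetime n)))) :
    Integrable (timeSq T g) (volume.restrict (Ω : Set (Space n))) := by
  have h := hg.integrable_sq
  rw [restrict_cyl] at h
  exact h.integral_prod_left

theorem integral_timeSq (hg : MemLp g 2 (volume.restrict (cyl Ω 0 T : Set (Spacetime n)))) :
    ∫ x in (Ω : Set (Space n)), timeSq T g x =
      ∫ z in (cyl Ω 0 T : Set (Spacetime n)), g z ^ 2 :=
  (integral_cyl hg.integrable_sq).symm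

theorem intervalIntegrable_of_memLp {f : ℝ → ℝ} {a b : ℝ} (ha : a ∈ Icc 0 T) (hb : b ∈ Icc 0 T)
    (hf : MemLp f 2 (volume.restrict (Ioo 0 T))) : IntervalIntegrable f volume a b := by
  have h : IntegrableOn f (Icc 0 T) :=
    (integrableOn_Icc_iff_integrableOn_Ioo).2 (hf.integrable (by norm_num))
  exact (h.mono_set (uIcc_subset_Icc ha hb)).intervalIntegrable

theorem prim_sub_sq_le (ht₀ : t₀ ∈ Icc 0 T)
    (hg : MemLp g 2 (volume.restrict (cyl Ω 0 T : Set (Spacetime n)))) :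
    ∀ᵐ x ∂volume.restrict (Ω : Set (Space n)), ∀ s ∈ Icc 0 T, ∀ t ∈ Icc 0 T,
      (prim t₀ g (x, t) - prim t₀ g (x, s)) ^ 2 ≤ |t - s| * timeSq T g x := by
  filter_upwards [memLp_fst hg] with x hx s hs t ht
  have : prim t₀ g (x, t) - prim t₀ g (x, s) = ∫ r in s..t, g (x, r) :=
    intervalIntegral.integral_interval_sub_left (intervalIntegrable_of_memLp ht₀ ht hx)
      (intervalIntegrable_of_memLp ht₀ hs hx)
  rw [this]
  exact sq_integral_le hs ht hx

theorem prim_self (x : Space n) : prim t₀ g (x, t₀) = 0 := by simp [prim]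

theorem prim_sq_le (ht₀ : t₀ ∈ Icc 0 T)
    (hg : MemLp g 2 (volume.restrict (cyl Ω 0 T : Set (Spacetime n)))) :
    ∀ᵐ x ∂volume.restrict (Ω : Set (Space n)), ∀ t ∈ Icc 0 T,
      prim t₀ g (x, t) ^ 2 ≤ T * timeSq T g x := by
  filter_upwards [prim_sub_sq_le ht₀ hg] with x hx t ht
  have h := hx t₀ ht₀ t ht
  rw [prim_self, sub_zero] at h
  refine h.trans ?_
  gcongr
  · exact integral_nonneg fun s => sq_nonneg _
  · rw [abs_le]
    constructor <;> linarith [ht.1, ht.2, ht₀.1, ht₀.2]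

theorem ae_cyl_of_fst {p : Space n → Prop}
    (h : ∀ᵐ x ∂volume.restrict (Ω : Set (Space n)), p x) {a b : ℝ} :
    ∀ᵐ z ∂volume.restrict (cyl Ω a b : Set (Spacetime n)), p z.1 := by
  rw [restrict_cyl]
  exact Measure.quasiMeasurePreserving_fst.ae h

theorem ae_cyl_mem (Ω : Opens (Space n)) (a b : ℝ) :
    ∀ᵐ z ∂volume.restrict (cyl Ω a b : Set (Spacetime n)), z.1 ∈ Ω ∧ z.2 ∈ Ioo a b :=
  ae_restrict_mem (cyl Ω a b).isOpen.measurableSet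

theorem integral_prim_sq_le (ht₀ : t₀ ∈ Icc 0 T) (hm : StronglyMeasurable g)
    (hg : MemLp g 2 (volume.restrict (cyl Ω 0 T : Set (Spacetime n)))) :
    MemLp (prim t₀ g) 2 (volume.restrict (cyl Ω 0 T : Set (Spacetime n))) ∧
    ∫ z in (cyl Ω 0 T : Set (Spacetime n)), prim t₀ g z ^ 2 ≤
      T ^ 2 * ∫ z in (cyl Ω 0 T : Set (Spacetime n)), g z ^ 2 := by
  have hT : 0 ≤ T := ht₀.1.trans ht₀.2
  have hN : Integrable (fun z : Spacetime n => T * timeSq T g z.1)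
      (volume.restrict (cyl Ω 0 T : Set (Spacetime n))) := by
    rw [restrict_cyl]
    exact ((integrable_timeSq hg).const_mul T).comp_fst _
  have hle : ∀ᵐ z ∂volume.restrict (cyl Ω 0 T : Set (Spacetime n)),
      prim t₀ g z ^ 2 ≤ T * timeSq T g z.1 := by
    filter_upwards [ae_cyl_of_fst (prim_sq_le ht₀ hg), ae_cyl_mem Ω 0 T] with z hz hz'
    exact hz z.2 ⟨hz'.2.1.le, hz'.2.2.le⟩
  have hmeas := (stronglyMeasurable_prim t₀ hm).aestronglyMeasurable
    (μ := volume.restrict (cyl Ω 0 T : Set (Spacetime n)))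
  have hint : Integrable (fun z => prim t₀ g z ^ 2)
      (volume.restrict (cyl Ω 0 T : Set (Spacetime n))) := by
    refine hN.mono' (hmeas.pow 2) ?_
    filter_upwards [hle] with z hz
    rwa [Real.norm_of_nonneg (sq_nonneg _)]
  refine ⟨(memLp_two_iff_integrable_sq hmeas).2 hint, ?_⟩
  refine (integral_mono_ae hint hN hle).trans_eq ?_
  rw [integral_cyl hN, ← integral_timeSq hg]
  simp [integral_const_mul, hT]
  ring

theorem memLp_prim (ht₀ : t₀ ∈ Icc 0 T) (hm : StronglyMeasurable g)
    (hg : MemLp g 2 (volume.restrict (cyl Ω 0 T : Set (Spacetime n)))) :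
    MemLp (prim t₀ g) 2 (volume.restrict (cyl Ω 0 T : Set (Spacetime n))) :=
  (integral_prim_sq_le ht₀ hm hg).1

theorem memLp_prim_slice (ht₀ : t₀ ∈ Icc 0 T) (hm : StronglyMeasurable g)
    (hg : MemLp g 2 (volume.restrict (cyl Ω 0 T : Set (Spacetime n)))) {t : ℝ}
    (ht : t ∈ Icc 0 T) :
    MemLp (fun x => prim t₀ g (x, t)) 2 (volume.restrict (Ω : Set (Space n))) := by
  have hmeas : AEStronglyMeasurable (fun x => prim t₀ g (x, t))
      (volume.restrict (Ω : Set (Space n))) :=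
    ((stronglyMeasurable_prim t₀ hm).comp_measurable (by fun_prop)).aestronglyMeasurable
  refine (memLp_two_iff_integrable_sq hmeas).2 ?_
  refine ((integrable_timeSq hg).const_mul T).mono' (hmeas.pow 2) ?_
  filter_upwards [prim_sq_le ht₀ hg] with x hx
  rw [Real.norm_of_nonneg (sq_nonneg _)]
  exact hx t ht

/-- The squared `L²` norm as an integral. -/
theorem norm_toLp_sq {α : Type*} [MeasurableSpace α] {μ : Measure α} {f : α → ℝ}
    (hf : MemLp f 2 μ) : ‖hf.toLp f‖ ^ 2 = ∫ x, f x ^ 2 ∂μ := by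
  rw [← real_inner_self_eq_norm_sq, L2.inner_def]
  refine integral_congr_ae ?_
  filter_upwards [hf.coeFn_toLp] with x hx
  simp [hx, pow_two]

/-- The primitive in time is a continuous function of time with values in `L²(Ω)`; on `[0, T]` its
modulus of continuity is `|t - s|^{1/2} ‖g‖`. -/
theorem exists_continuousOn_prim (ht₀ : t₀ ∈ Icc 0 T) (hm : StronglyMeasurable g)
    (hg : MemLp g 2 (volume.restrict (cyl Ω 0 T : Set (Spacetime n)))) :
    ∃ γ : ℝ → L2 Ω, ContinuousOn γ (Icc 0 T) ∧
      (∀ t ∈ Icc 0 T, γ t =ᵐ[volume.restrict (Ω : Set (Space n))] fun x => prim t₀ g (x, t)) ∧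
      γ t₀ = 0 := by
  classical
  let γ : ℝ → L2 Ω := fun t => if ht : t ∈ Icc 0 T then (memLp_prim_slice ht₀ hm hg ht).toLp _
    else 0
  have hγ : ∀ t ∈ Icc 0 T,
      γ t =ᵐ[volume.restrict (Ω : Set (Space n))] fun x => prim t₀ g (x, t) := by
    intro t ht
    simp only [γ, dif_pos ht]
    exact MemLp.coeFn_toLp _
  refine ⟨γ, ?_, hγ, ?_⟩
  · set C := ∫ z in (cyl Ω 0 T : Set (Spacetime n)), g z ^ 2 with hC
    have hbound : ∀ s ∈ Icc 0 T, ∀ t ∈ Icc 0 T, ‖γ t - γ s‖ ^ 2 ≤ |t - s| * C := by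
      intro s hs t ht
      rw [← real_inner_self_eq_norm_sq, L2.inner_def, hC, ← integral_timeSq hg,
        ← integral_const_mul]
      refine integral_mono_ae (L2.integrable_inner _ _) ((integrable_timeSq hg).const_mul _) ?_
      filter_upwards [prim_sub_sq_le ht₀ hg, hγ t ht, hγ s hs, Lp.coeFn_sub (γ t) (γ s)] with x hx
        h1 h2 h3
      rw [h3, Pi.sub_apply, h1, h2]
      simpa [pow_two] using hx s hs t ht
    intro s hs
    have h1 : Tendsto (fun t => Real.sqrt (|t - s| * C)) (𝓝[Icc 0 T] s) (𝓝 0) := by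
      have : Continuous fun t : ℝ => Real.sqrt (|t - s| * C) := by fun_prop
      have h := this.tendsto s
      simp only [sub_self, abs_zero, zero_mul, Real.sqrt_zero] at h
      exact h.mono_left nhdsWithin_le_nhds
    rw [ContinuousWithinAt, tendsto_iff_norm_sub_tendsto_zero]
    refine squeeze_zero' (Eventually.of_forall fun t => norm_nonneg _) ?_ h1
    filter_upwards [self_mem_nhdsWithin] with t ht
    exact Real.le_sqrt_of_sq_le (hbound s hs t ht)
  · refine Lp.ext ?_
    filter_upwards [hγ t₀ ht₀, Lp.coeFn_zero ℝ 2 (volume.restrict (Ω : Set (Space n)))] with x h1 h2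
    rw [h1, h2, prim_self, Pi.zero_apply]

end prim

end Cylinder

/-! ### The space `H¹₀` as a double orthogonal complement -/

section Orthogonal

set_option linter.unusedSectionVars false

variable {F ι : Type} [NormedAddCommGroup F] [NormedSpace ℝ F] [MeasureSpace F] [BorelSpace F]
  [SecondCountableTopology F] [IsFiniteMeasureOnCompacts (volume : Measure F)] [Fintype ι]
  {U : Opens F} {e : ι → F}

theorem memLp_testFunction (φ : 𝓓(U, ℝ)) :
    MemLp (fun z => φ z) 2 (volume.restrict (U : Set F)) :=
  (φ.continuous.memLp_of_hasCompactSupport φ.hasCompactSupport).restrict _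

theorem memLp_fderiv_testFunction (φ : 𝓓(U, ℝ)) (v : F) :
    MemLp (fun z => fderiv ℝ φ z v) 2 (volume.restrict (U : Set F)) :=
  ((contDiff_fderiv_test φ v).continuous.memLp_of_hasCompactSupport
    (φ.hasCompactSupport.fderiv_apply (𝕜 := ℝ) v)).restrict _

theorem fderiv_test_add (φ ψ : 𝓓(U, ℝ)) (x : F) :
    fderiv ℝ (⇑(φ + ψ)) x = fderiv ℝ φ x + fderiv ℝ ψ x :=
  fderiv_add (differentiable_test _ x) (differentiable_test _ x)

theorem fderiv_test_smul (c : ℝ) (φ : 𝓓(U, ℝ)) (x : F) :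
    fderiv ℝ (⇑(c • φ)) x = c • fderiv ℝ φ x :=
  fderiv_const_smul (differentiable_test _ x) c

/-- The pair `(f, g)` of a function and its gradient as an element of the Hilbert space
`L²(U)^{1 + ι}`. -/
noncomputable def jet {f : F → ℝ} {g : ι → F → ℝ}
    (hf : MemLp f 2 (volume.restrict (U : Set F)))
    (hg : ∀ i, MemLp (g i) 2 (volume.restrict (U : Set F))) :
    PiLp 2 (fun _ : Option ι => L2 U) :=
  WithLp.toLp 2 fun o => o.elim (hf.toLp f) fun i => (hg i).toLp (g i)

/-- `φ ↦ (φ, ∇ φ)` on test functions. -/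
noncomputable def testJet (U : Opens F) (e : ι → F) :
    𝓓(U, ℝ) →ₗ[ℝ] PiLp 2 (fun _ : Option ι => L2 U) where
  toFun φ := jet (memLp_testFunction φ) fun i => memLp_fderiv_testFunction φ (e i)
  map_add' φ ψ := by
    refine PiLp.ext fun o => ?_
    cases o with
    | none => rfl
    | some i =>
      show (memLp_fderiv_testFunction (φ + ψ) (e i)).toLp _ =
        (memLp_fderiv_testFunction φ (e i)).toLp _ + (memLp_fderiv_testFunction ψ (e i)).toLp _
      rw [← MemLp.toLp_add]
      congr 1
      ext x
      rw [fderiv_test_add]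
      rfl
  map_smul' c φ := by
    refine PiLp.ext fun o => ?_
    cases o with
    | none => rfl
    | some i =>
      show (memLp_fderiv_testFunction (c • φ) (e i)).toLp _ =
        c • (memLp_fderiv_testFunction φ (e i)).toLp _
      rw [← MemLp.toLp_const_smul]
      congr 1
      ext x
      rw [fderiv_test_smul]
      rfl

theorem inner_jet (p : PiLp 2 (fun _ : Option ι => L2 U)) {f : F → ℝ} {g : ι → F → ℝ}
    (hf : MemLp f 2 (volume.restrict (U : Set F)))
    (hg : ∀ i, MemLp (g i) 2 (volume.restrict (U : Set F))) :
    inner ℝ p (jet hf hg) = (∫ x in (U : Set F), p none x * f x) +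
      ∑ i, ∫ x in (U : Set F), p (some i) x * g i x := by
  have h : ∀ {f : F → ℝ} (hf : MemLp f 2 (volume.restrict (U : Set F))) (q : L2 U),
      inner ℝ q (hf.toLp f) = ∫ x in (U : Set F), q x * f x := by
    intro f hf q
    rw [L2.inner_def]
    refine integral_congr_ae ?_
    filter_upwards [hf.coeFn_toLp] with x hx
    rw [hx]
    simp [mul_comm]
  rw [PiLp.inner_apply, Fintype.sum_option]
  simp only [jet, Option.elim_none, Option.elim_some, h]

theorem isH10With_iff_mem_closure {f : F → ℝ} {g : ι → F → ℝ}
    (hf : MemLp f 2 (volume.restrict (U : Set F)))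
    (hg : ∀ i, MemLp (g i) 2 (volume.restrict (U : Set F))) :
    IsH10With U e f g ↔ jet hf hg ∈ closure (range (testJet U e)) := by
  have key : ∀ φ : ℕ → 𝓓(U, ℝ), (Tendsto (fun k => testJet U e (φ k)) atTop (𝓝 (jet hf hg)) ↔
      Tendsto (fun k => eLpNorm (fun x => φ k x - f x) 2 (volume.restrict (U : Set F)))
        atTop (𝓝 0) ∧
      ∀ i, Tendsto (fun k => eLpNorm (fun x => fderiv ℝ (φ k) x (e i) - g i x) 2
        (volume.restrict (U : Set F))) atTop (𝓝 0)) := by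
    intro φ
    have h1 : ∀ {f : F → ℝ} (hf : MemLp f 2 (volume.restrict (U : Set F))) {a : ℕ → F → ℝ}
        (ha : ∀ k, MemLp (a k) 2 (volume.restrict (U : Set F))),
        Tendsto (fun k => (ha k).toLp (a k)) atTop (𝓝 (hf.toLp f)) ↔
          Tendsto (fun k => eLpNorm (fun x => a k x - f x) 2 (volume.restrict (U : Set F)))
            atTop (𝓝 0) := fun hf a ha => Lp.tendsto_Lp_iff_tendsto_eLpNorm'' a ha _ hf
    rw [← h1 hf fun k => memLp_testFunction (φ k)]
    simp only [← fun i => h1 (hg i) fun k => memLp_fderiv_testFunction (φ k) (e i)]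
    rw [(PiLp.homeomorph 2 (fun _ : Option ι => L2 U)).isInducing.tendsto_nhds_iff,
      tendsto_pi_nhds, Option.forall]
    rfl
  rw [mem_closure_iff_seq_limit]
  constructor
  · rintro ⟨φ, hφ⟩
    exact ⟨fun k => testJet U e (φ k), fun k => mem_range_self _, (key φ).2 hφ⟩
  · rintro ⟨a, ha, hlim⟩
    choose φ hφ using ha
    obtain rfl : (fun k => testJet U e (φ k)) = a := funext hφ
    exact ⟨φ, (key φ).1 hlim⟩

/-- `L²(U)^{1 + ι}`-orthogonality of `p` to all test functions, in the inner product of `H¹`. -/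
def OrthTests (U : Opens F) (e : ι → F) (p : PiLp 2 (fun _ : Option ι => L2 U)) : Prop :=
  ∀ φ : 𝓓(U, ℝ), (∫ x in (U : Set F), p none x * φ x) +
    ∑ i, ∫ x in (U : Set F), p (some i) x * fderiv ℝ φ x (e i) = 0

/-- `H¹₀(U)` is closed, hence equal to its double orthogonal complement in `L²(U)^{1 + ι}`. -/
theorem isH10With_iff_orthogonal {f : F → ℝ} {g : ι → F → ℝ}
    (hf : MemLp f 2 (volume.restrict (U : Set F)))
    (hg : ∀ i, MemLp (g i) 2 (volume.restrict (U : Set F))) :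
    IsH10With U e f g ↔ ∀ p, OrthTests U e p → (∫ x in (U : Set F), p none x * f x) +
      ∑ i, ∫ x in (U : Set F), p (some i) x * g i x = 0 := by
  have h1 : closure (range (testJet U e)) =
      (((LinearMap.range (testJet U e))ᗮᗮ : Submodule ℝ _) :
        Set (PiLp 2 (fun _ : Option ι => L2 U))) := by
    rw [Submodule.orthogonal_orthogonal_eq_closure, Submodule.topologicalClosure_coe,
      LinearMap.coe_range]
  rw [isH10With_iff_mem_closure hf hg, h1, SetLike.mem_coe, Submodule.mem_orthogonal]
  refine forall_congr' fun p => ?_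
  rw [inner_jet]
  refine imp_congr_left ?_
  rw [Submodule.mem_orthogonal']
  constructor
  · intro h φ
    have := h _ (LinearMap.mem_range_self (testJet U e) φ)
    rwa [testJet, LinearMap.coe_mk, AddHom.coe_mk, inner_jet] at this
  · rintro h _ ⟨φ, rfl⟩
    rw [testJet, LinearMap.coe_mk, AddHom.coe_mk, inner_jet]
    exact h φ

end Orthogonal

/-! ### Integration by parts on the cylinder -/

section ByParts

theorem test_eq_zero {F : Type} [NormedAddCommGroup F] [NormedSpace ℝ F] {U : Opens F}
    (φ : 𝓓(U, ℝ)) {x : F} (hx : x ∉ (U : Set F)) : φ x = 0 := by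
  by_contra h
  exact hx (φ.tsupport_subset (subset_tsupport _ h))

theorem setIntegral_mul_test {F : Type} [NormedAddCommGroup F] [NormedSpace ℝ F] [MeasureSpace F]
    {U : Opens F} (f : F → ℝ) (φ : 𝓓(U, ℝ)) :
    ∫ x in (U : Set F), f x * φ x = ∫ x, f x * φ x :=
  setIntegral_eq_integral_of_forall_compl_eq_zero fun x hx => by rw [test_eq_zero φ hx, mul_zero]

theorem fderiv_test_eq_zero {F : Type} [NormedAddCommGroup F] [NormedSpace ℝ F] {U : Opens F}
    (φ : 𝓓(U, ℝ)) {x : F} (hx : x ∉ (U : Set F)) (v : F) : fderiv ℝ φ x v = 0 := by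
  have : x ∉ tsupport (fderiv ℝ φ) := fun h =>
    hx (φ.tsupport_subset (tsupport_fderiv_subset ℝ h))
  rw [image_eq_zero_of_notMem_tsupport this]
  rfl

theorem integrable_mul_of_memLp {α : Type*} [MeasurableSpace α] {μ : Measure α} {f g : α → ℝ}
    (hf : MemLp f 2 μ) (hg : MemLp g 2 μ) : Integrable (fun x => f x * g x) μ :=
  hf.integrable_mul hg

theorem memLp_of_contDiff {F : Type} [NormedAddCommGroup F] [NormedSpace ℝ F] [MeasureSpace F]
    [BorelSpace F] [SecondCountableTopology F] [IsFiniteMeasureOnCompacts (volume : Measure F)]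
    {ψ : F → ℝ} (hψ : Continuous ψ) (hc : HasCompactSupport ψ) (s : Set F) :
    MemLp ψ 2 (volume.restrict s) :=
  (hψ.memLp_of_hasCompactSupport hc).restrict _

theorem continuous_fderiv_dir {F : Type} [NormedAddCommGroup F] [NormedSpace ℝ F] {ψ : F → ℝ}
    (hψ : ContDiff ℝ 1 ψ) (v : F) : Continuous fun x => fderiv ℝ ψ x v :=
  (hψ.continuous_fderiv one_ne_zero).clm_apply continuous_const

theorem integral_mul_fderiv_test {F : Type} [NormedAddCommGroup F] [NormedSpace ℝ F]
    [FiniteDimensional ℝ F] [MeasureSpace F] [BorelSpace F]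
    [(volume : Measure F).IsAddHaarMeasure] {U : Opens F} {ψ : F → ℝ} (hψ : ContDiff ℝ 1 ψ)
    (φ : 𝓓(U, ℝ)) (v : F) :
    ∫ x in (U : Set F), ψ x * fderiv ℝ φ x v = -∫ x in (U : Set F), fderiv ℝ ψ x v * φ x := by
  have hi : ∀ {f g : F → ℝ}, Continuous f → Continuous g → HasCompactSupport g →
      Integrable (fun z => f z * g z) volume := fun hf hg hgc =>
    (hf.mul hg).integrable_of_hasCompactSupport hgc.mul_left
  rw [setIntegral_mul_test, setIntegral_eq_integral_of_forall_compl_eq_zero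
    fun x hx => by rw [fderiv_test_eq_zero φ hx, mul_zero]]
  exact integral_mul_fderiv_eq_neg_fderiv_mul_of_integrable (𝕜 := ℝ) (μ := volume)
    (hi (continuous_fderiv_dir hψ v) φ.continuous φ.hasCompactSupport)
    (hi hψ.continuous (contDiff_fderiv_test φ v).continuous
      (φ.hasCompactSupport.fderiv_apply (𝕜 := ℝ) v))
    (hi hψ.continuous φ.continuous φ.hasCompactSupport)
    (fun z _ => hψ.differentiable one_ne_zero z) (fun z _ => differentiable_test φ z)

/-- A function in `H¹₀(U)` may be integrated by parts against every `C¹` function of compact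
support: no boundary term arises, although the second function need not vanish on `∂U`. -/
theorem IsH10With.integral_mul_fderiv {F ι : Type} [NormedAddCommGroup F] [NormedSpace ℝ F]
    [FiniteDimensional ℝ F] [MeasureSpace F] [BorelSpace F]
    [(volume : Measure F).IsAddHaarMeasure] [Fintype ι] {U : Opens F} {e : ι → F}
    {f : F → ℝ} {g : ι → F → ℝ} (h : IsH10With U e f g)
    (hf : MemLp f 2 (volume.restrict (U : Set F)))
    (hg : ∀ i, MemLp (g i) 2 (volume.restrict (U : Set F)))
    {ψ : F → ℝ} (hψ : ContDiff ℝ 1 ψ) (hc : HasCompactSupport ψ) (i : ι) :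
    ∫ x in (U : Set F), f x * fderiv ℝ ψ x (e i) = -∫ x in (U : Set F), g i x * ψ x := by
  classical
  have m1 := memLp_of_contDiff hψ.continuous hc (U : Set F)
  have m2 := memLp_of_contDiff (continuous_fderiv_dir hψ (e i))
    (hc.fderiv_apply (𝕜 := ℝ) (e i)) (U : Set F)
  -- `(∂ᵢ ψ, ψ)` is orthogonal to the test functions, hence to all of `H¹₀(U)`
  let p : PiLp 2 (fun _ : Option ι => L2 U) := WithLp.toLp 2 fun o =>
    o.elim (m2.toLp _) fun j => if j = i then m1.toLp _ else 0
  have hp : ∀ (a : F → ℝ) (b : ι → F → ℝ), (∫ x in (U : Set F), p none x * a x) +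
      ∑ j, ∫ x in (U : Set F), p (some j) x * b j x =
      (∫ x in (U : Set F), a x * fderiv ℝ ψ x (e i)) + ∫ x in (U : Set F), b i x * ψ x := by
    intro a b
    rw [Finset.sum_eq_single i]
    · congr 1
      · refine integral_congr_ae ?_
        filter_upwards [m2.coeFn_toLp] with x hx
        simp only [p, Option.elim_none, hx, mul_comm]
      · refine integral_congr_ae ?_
        filter_upwards [m1.coeFn_toLp] with x hx
        simp only [p, Option.elim_some, if_true, hx, mul_comm]
    · intro j _ hj
      refine integral_eq_zero_of_ae ?_
      filter_upwards [Lp.coeFn_zero ℝ 2 (volume.restrict (U : Set F))] with x hx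
      simp only [p, Option.elim_some, if_neg hj, hx, Pi.zero_apply, zero_mul]
    · simp
  have h1 := (isH10With_iff_orthogonal hf hg).1 h p fun φ => by
    rw [hp]
    have := integral_mul_fderiv_test hψ φ (e i)
    simp only [mul_comm] at this ⊢
    linarith
  rw [hp] at h1
  linarith

variable {n : ℕ} {Ω : Opens (Space n)} {T : ℝ}

theorem hasCompactSupport_slice {ψ : Spacetime n → ℝ} (hc : HasCompactSupport ψ) (t : ℝ) :
    HasCompactSupport fun x => ψ (x, t) := by
  refine HasCompactSupport.intro (hc.isCompact.image continuous_fst) fun x hx => ?_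
  by_contra h
  exact hx ⟨(x, t), subset_tsupport _ h, rfl⟩

theorem fderiv_slice_space {ψ : Spacetime n → ℝ} (hψ : ContDiff ℝ 1 ψ) (x v : Space n) (t : ℝ) :
    fderiv ℝ (fun x => ψ (x, t)) x v = fderiv ℝ ψ (x, t) (v, 0) := by
  have h := (hψ.differentiable one_ne_zero (x, t)).hasFDerivAt.comp (f := fun x => (x, t)) x
    (hasFDerivAt_prodMk_left x t)
  have e : (ψ ∘ fun x => (x, t)) = fun x => ψ (x, t) := rfl
  rw [e] at h
  rw [h.fderiv]
  simp

theorem deriv_slice_time {ψ : Spacetime n → ℝ} (hψ : ContDiff ℝ 1 ψ) (x : Space n) (t : ℝ) :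
    deriv (fun t => ψ (x, t)) t = fderiv ℝ ψ (x, t) (stDir n none) := by
  have h := (hψ.differentiable one_ne_zero (x, t)).hasFDerivAt.comp (f := fun t => (x, t)) t
    (hasFDerivAt_prodMk_right x t)
  have e : (ψ ∘ fun t => (x, t)) = fun t => ψ (x, t) := rfl
  rw [e] at h
  rw [h.hasDerivAt.deriv]
  simp [stDir]

/-- Integration by parts in space, for a function whose slices are in `H¹₀(Ω)`. -/
theorem integral_cyl_mul_fderiv_space {u : Spacetime n → ℝ} {g : Fin n → Spacetime n → ℝ}
    (hu : MemLp u 2 (volume.restrict (cyl Ω 0 T : Set (Spacetime n))))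
    (hg : ∀ i, MemLp (g i) 2 (volume.restrict (cyl Ω 0 T : Set (Spacetime n))))
    (hs : ∀ᵐ t ∂volume.restrict (Ioo 0 T),
      IsH10With Ω (spaceDir n) (fun x => u (x, t)) (fun i x => g i (x, t)))
    {ψ : Spacetime n → ℝ} (hψ : ContDiff ℝ 1 ψ) (hc : HasCompactSupport ψ) (i : Fin n) :
    ∫ z in (cyl Ω 0 T : Set (Spacetime n)), u z * fderiv ℝ ψ z (stDir n (some i)) =
      -∫ z in (cyl Ω 0 T : Set (Spacetime n)), g i z * ψ z := by
  have m1 := memLp_of_contDiff hψ.continuous hc (cyl Ω 0 T : Set (Spacetime n))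
  have m2 := memLp_of_contDiff (continuous_fderiv_dir hψ (stDir n (some i)))
    (hc.fderiv_apply (𝕜 := ℝ) (stDir n (some i))) (cyl Ω 0 T : Set (Spacetime n))
  rw [integral_cyl_swap (integrable_mul_of_memLp hu m2),
    integral_cyl_swap (integrable_mul_of_memLp (hg i) m1),
    ← integral_neg]
  refine integral_congr_ae ?_
  filter_upwards [hs, memLp_snd hu, ae_all_iff.2 fun i => memLp_snd (hg i)] with t h1 h2 h3
  have hψt : ContDiff ℝ 1 fun x => ψ (x, t) := hψ.comp (contDiff_id.prodMk contDiff_const)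
  have := h1.integral_mul_fderiv h2 h3 hψt (hasCompactSupport_slice hc t) i
  simp only [fderiv_slice_space hψ] at this
  exact this

theorem integral_Ioo_eq_interval (hT : 0 ≤ T) (f : ℝ → ℝ) :
    ∫ t in Ioo 0 T, f t = ∫ t in 0..T, f t := by
  rw [intervalIntegral.integral_of_le hT, integral_Ioc_eq_integral_Ioo]

/-- Integration by parts in time, for a primitive in time. -/
theorem integral_prim_mul_fderiv {t₀ : ℝ} (ht₀ : t₀ ∈ Icc 0 T) {g : Spacetime n → ℝ}
    (hm : StronglyMeasurable g)
    (hg : MemLp g 2 (volume.restrict (cyl Ω 0 T : Set (Spacetime n))))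
    {ψ : Spacetime n → ℝ} (hψ : ContDiff ℝ 1 ψ) (hc : HasCompactSupport ψ)
    (h0 : t₀ = 0 ∨ ∀ x ∈ Ω, ψ (x, 0) = 0) (h1 : t₀ = T ∨ ∀ x ∈ Ω, ψ (x, T) = 0) :
    ∫ z in (cyl Ω 0 T : Set (Spacetime n)), prim t₀ g z * fderiv ℝ ψ z (stDir n none) =
      -∫ z in (cyl Ω 0 T : Set (Spacetime n)), g z * ψ z := by
  have hT : 0 ≤ T := ht₀.1.trans ht₀.2
  have m1 := memLp_of_contDiff hψ.continuous hc (cyl Ω 0 T : Set (Spacetime n))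
  have m2 := memLp_of_contDiff (continuous_fderiv_dir hψ (stDir n none))
    (hc.fderiv_apply (𝕜 := ℝ) (stDir n none)) (cyl Ω 0 T : Set (Spacetime n))
  rw [integral_cyl (integrable_mul_of_memLp (memLp_prim ht₀ hm hg) m2),
    integral_cyl (integrable_mul_of_memLp hg m1), ← integral_neg]
  refine integral_congr_ae ?_
  filter_upwards [memLp_fst hg, ae_restrict_mem Ω.isOpen.measurableSet] with x hx hxΩ
  have hψx : ContDiff ℝ 1 fun t => ψ (x, t) := hψ.comp (contDiff_const.prodMk contDiff_id)
  have := integral_primitive_mul_deriv (t₀ := t₀) (by rwa [uIcc_of_le hT])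
    (intervalIntegrable_of_memLp ⟨le_rfl, hT⟩ ⟨hT, le_rfl⟩ hx) hψx
    (h0.imp_right fun h => h x hxΩ) (h1.imp_right fun h => h x hxΩ)
  simp only [deriv_slice_time hψ] at this
  rw [integral_Ioo_eq_interval hT, integral_Ioo_eq_interval hT]
  exact this

/-- Multiplication by a bounded function of time. -/
theorem memLp_weight {w : ℝ → ℝ} (hw : Continuous w) {f : Spacetime n → ℝ}
    (hf : MemLp f 2 (volume.restrict (cyl Ω 0 T : Set (Spacetime n)))) :
    MemLp (fun z => w z.2 * f z) 2 (volume.restrict (cyl Ω 0 T : Set (Spacetime n))) := by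
  obtain ⟨C, hC⟩ := isCompact_Icc.exists_bound_of_continuousOn (s := Icc 0 T) hw.continuousOn
  refine hf.of_le_mul (c := C)
    ((hw.comp continuous_snd).aestronglyMeasurable.mul hf.aestronglyMeasurable) ?_
  filter_upwards [ae_cyl_mem Ω 0 T] with z hz
  rw [norm_mul]
  gcongr
  exact hC _ ⟨hz.2.1.le, hz.2.2.le⟩

/-- For a primitive `F` with `F(0) = 0`, `∫ e^{-2t} F² ≤ ∫ e^{-2t} F F'`: integrate
`(e^{-2t} F²)'`. -/
theorem integral_mul_prim_zero {g : Spacetime n → ℝ} (hT : 0 ≤ T)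
    (hm : StronglyMeasurable g)
    (hg : MemLp g 2 (volume.restrict (cyl Ω 0 T : Set (Spacetime n)))) :
    ∫ z in (cyl Ω 0 T : Set (Spacetime n)), Real.exp (-2 * z.2) * prim 0 g z * prim 0 g z ≤
      ∫ z in (cyl Ω 0 T : Set (Spacetime n)), Real.exp (-2 * z.2) * prim 0 g z * g z := by
  have hw : ContDiff ℝ 1 fun t : ℝ => Real.exp (-2 * t) := by fun_prop
  have m := memLp_prim (t₀ := 0) ⟨le_rfl, hT⟩ hm hg
  have mw := memLp_weight hw.continuous m
  have i1 := integrable_mul_of_memLp mw m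
  have i2 := integrable_mul_of_memLp mw hg
  have j1 := i1
  have j2 := i2
  rw [restrict_cyl] at j1 j2
  rw [integral_cyl i1, integral_cyl i2]
  refine integral_mono_ae j1.integral_prod_left j2.integral_prod_left ?_
  filter_upwards [memLp_fst hg] with x hx
  have key := integral_mul_primitive_mul (t₀ := 0) (by simp)
    (intervalIntegrable_of_memLp ⟨le_rfl, hT⟩ ⟨hT, le_rfl⟩ hx) hw
  have hd : ∀ t, deriv (fun t : ℝ => Real.exp (-2 * t)) t = -2 * Real.exp (-2 * t) := by
    intro t
    simp [mul_comm]
  simp only [hd] at key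
  simp only [prim, integral_Ioo_eq_interval hT]
  have e1 : ∫ t in 0..T, (∫ s in 0..t, g (x, s)) ^ 2 * (-2 * Real.exp (-2 * t)) =
      -2 * ∫ t in 0..T, Real.exp (-2 * t) * (∫ s in 0..t, g (x, s)) *
        ∫ s in 0..t, g (x, s) := by
    rw [← intervalIntegral.integral_const_mul]
    congr 1
    ext t
    ring
  have e2 : ∫ t in 0..T, g (x, t) * (∫ s in 0..t, g (x, s)) * Real.exp (-2 * t) =
      ∫ t in 0..T, Real.exp (-2 * t) * (∫ s in 0..t, g (x, s)) * g (x, t) := by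
    congr 1
    ext t
    ring
  rw [e1, e2] at key
  have hpos : 0 ≤ (∫ s in 0..T, g (x, s)) ^ 2 * Real.exp (-2 * T) := by positivity
  simp only [intervalIntegral.integral_same] at key
  linarith

/-- For a primitive `F` with `F(T) = 0`, `∫ e^{2t} F² ≤ -∫ e^{2t} F F'`: integrate
`(e^{2t} F²)'`. -/
theorem integral_mul_prim_final {g : Spacetime n → ℝ} (hT : 0 ≤ T)
    (hm : StronglyMeasurable g)
    (hg : MemLp g 2 (volume.restrict (cyl Ω 0 T : Set (Spacetime n)))) :
    ∫ z in (cyl Ω 0 T : Set (Spacetime n)), Real.exp (2 * z.2) * prim T g z * prim T g z ≤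
      -∫ z in (cyl Ω 0 T : Set (Spacetime n)), Real.exp (2 * z.2) * prim T g z * g z := by
  have hw : ContDiff ℝ 1 fun t : ℝ => Real.exp (2 * t) := by fun_prop
  have m := memLp_prim (t₀ := T) ⟨hT, le_rfl⟩ hm hg
  have mw := memLp_weight hw.continuous m
  have i1 := integrable_mul_of_memLp mw m
  have i2 := integrable_mul_of_memLp mw hg
  have j1 := i1
  have j2 := i2
  rw [restrict_cyl] at j1 j2
  rw [integral_cyl i1, integral_cyl i2, ← integral_neg]
  refine integral_mono_ae j1.integral_prod_left j2.integral_prod_left.neg ?_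
  filter_upwards [memLp_fst hg] with x hx
  have key := integral_mul_primitive_mul (t₀ := T) (by simp)
    (intervalIntegrable_of_memLp ⟨le_rfl, hT⟩ ⟨hT, le_rfl⟩ hx) hw
  have hd : ∀ t, deriv (fun t : ℝ => Real.exp (2 * t)) t = 2 * Real.exp (2 * t) := by
    intro t
    simp [mul_comm]
  simp only [hd] at key
  simp only [prim, integral_Ioo_eq_interval hT]
  have e1 : ∫ t in 0..T, (∫ s in T..t, g (x, s)) ^ 2 * (2 * Real.exp (2 * t)) =
      2 * ∫ t in 0..T, Real.exp (2 * t) * (∫ s in T..t, g (x, s)) *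
        ∫ s in T..t, g (x, s) := by
    rw [← intervalIntegral.integral_const_mul]
    congr 1
    ext t
    ring
  have e2 : ∫ t in 0..T, g (x, t) * (∫ s in T..t, g (x, s)) * Real.exp (2 * t) =
      ∫ t in 0..T, Real.exp (2 * t) * (∫ s in T..t, g (x, s)) * g (x, t) := by
    congr 1
    ext t
    ring
  rw [e1, e2] at key
  have hpos : 0 ≤ (∫ s in T..0, g (x, s)) ^ 2 * Real.exp (2 * 0) := by positivity
  simp only [intervalIntegral.integral_same] at key
  linarith

end ByParts

/-! ### Zero trace and primitives in time -/

section Trace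

theorem contDiff_primitive {χ : ℝ → ℝ} (hχ : ContDiff ℝ ((⊤ : ℕ∞) : WithTop ℕ∞) χ) (a : ℝ) :
    ContDiff ℝ ((⊤ : ℕ∞) : WithTop ℕ∞) (fun t => ∫ s in a..t, χ s) ∧
      deriv (fun t => ∫ s in a..t, χ s) = χ := by
  have hd : ∀ t, HasDerivAt (fun t => ∫ s in a..t, χ s) (χ t) t := fun t =>
    intervalIntegral.integral_hasDerivAt_right (hχ.continuous.intervalIntegrable _ _)
      (hχ.continuous.stronglyMeasurableAtFilter _ _) hχ.continuous.continuousAt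
  have he : deriv (fun t => ∫ s in a..t, χ s) = χ := funext fun t => (hd t).deriv
  refine ⟨?_, he⟩
  rw [contDiff_infty_iff_deriv, he]
  exact ⟨fun t => (hd t).differentiableAt, hχ⟩

/-- A smooth function of mean zero with compact support in an interval is the derivative of
such a function. -/
theorem exists_primitive_test {T : ℝ} {χ : ℝ → ℝ}
    (hχ : ContDiff ℝ ((⊤ : ℕ∞) : WithTop ℕ∞) χ) (hc : HasCompactSupport χ)
    (hs : tsupport χ ⊆ Ioo 0 T) (h0 : ∫ t, χ t = 0) :
    ∃ α : ℝ → ℝ, ContDiff ℝ ((⊤ : ℕ∞) : WithTop ℕ∞) α ∧ HasCompactSupport α ∧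
      tsupport α ⊆ Ioo 0 T ∧ deriv α = χ := by
  obtain ⟨a, b, hab, hK⟩ : ∃ a b, Icc a b ⊆ Ioo 0 T ∧ tsupport χ ⊆ Icc a b := by
    rcases (tsupport χ).eq_empty_or_nonempty with he | hne
    · exact ⟨1, 0, by simp, by simp [he]⟩
    · have hbd := hc.isCompact
      refine ⟨sInf (tsupport χ), sSup (tsupport χ), fun t ht => ?_, fun t ht =>
        ⟨csInf_le hbd.bddBelow ht, le_csSup hbd.bddAbove ht⟩⟩
      exact ⟨(hs (hbd.sInf_mem hne)).1.trans_le ht.1, ht.2.trans_lt (hs (hbd.sSup_mem hne)).2⟩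
  have hz : ∀ t, t ∉ Icc a b → χ t = 0 := fun t ht =>
    image_eq_zero_of_notMem_tsupport fun h => ht (hK h)
  have hα : ∀ t, t ∉ Icc a b → ∫ s in a..t, χ s = 0 := by
    intro t ht
    by_cases hta : t < a
    · refine intervalIntegral.integral_zero_ae ?_
      refine (Measure.ae_ne volume a).mono fun s hsa hs' => hz s fun h => ?_
      rw [uIoc_of_ge hta.le] at hs'
      exact hsa (le_antisymm hs'.2 h.1)
    · have htb : b < t := by
        by_contra h
        exact ht ⟨not_lt.1 hta, not_lt.1 h⟩
      rw [← h0, intervalIntegral.integral_of_le (not_lt.1 hta)]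
      refine (setIntegral_eq_integral_of_ae_compl_eq_zero ?_)
      refine (Measure.ae_ne volume a).mono fun s hsa hs' => hz s fun h => hs' ?_
      exact ⟨lt_of_le_of_ne h.1 hsa.symm, h.2.trans htb.le⟩
  have hsub : tsupport (fun t => ∫ s in a..t, χ s) ⊆ Icc a b :=
    closure_minimal (fun t ht => by
      by_contra h
      exact ht (hα t h)) isClosed_Icc
  obtain ⟨h1, h2⟩ := contDiff_primitive hχ a
  exact ⟨_, h1, isCompact_Icc.of_isClosed_subset (isClosed_tsupport _) hsub,
    hsub.trans hab, h2⟩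

/-- The du Bois-Reymond lemma: a continuous function with vanishing weak derivative is constant. -/
theorem eq_of_integral_mul_deriv_eq_zero {T : ℝ} (hT : 0 < T) {f : ℝ → ℝ}
    (hf : ContinuousOn f (Icc 0 T))
    (h : ∀ α : ℝ → ℝ, ContDiff ℝ ((⊤ : ℕ∞) : WithTop ℕ∞) α → HasCompactSupport α →
      tsupport α ⊆ Ioo 0 T → ∫ t in Ioo 0 T, f t * deriv α t = 0)
    {s t : ℝ} (hs : s ∈ Icc 0 T) (ht : t ∈ Icc 0 T) : f s = f t := by
  let B : ContDiffBump (T / 2) := ⟨T / 8, T / 4, by linarith, by linarith⟩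
  let ψ₀ := B.normed volume
  have hψ₀ : ContDiff ℝ ((⊤ : ℕ∞) : WithTop ℕ∞) ψ₀ := B.contDiff_normed
  have hψ₀c : HasCompactSupport ψ₀ := B.hasCompactSupport_normed
  have hψ₀s : tsupport ψ₀ ⊆ Ioo 0 T := by
    rw [B.tsupport_normed_eq]
    intro x hx
    rw [Metric.mem_closedBall, Real.dist_eq, abs_le] at hx
    have h4 : B.rOut = T / 4 := rfl
    rw [h4] at hx
    constructor <;> linarith [hx.1, hx.2]
  have hψ₀i : ∫ t, ψ₀ t = 1 := B.integral_normed
  have hfint : IntegrableOn f (Ioo 0 T) :=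
    (hf.integrableOn_compact isCompact_Icc).mono_set Ioo_subset_Icc_self
  have hmul : ∀ {ψ : ℝ → ℝ}, Continuous ψ → HasCompactSupport ψ →
      IntegrableOn (fun t => f t * ψ t) (Ioo 0 T) := by
    intro ψ hψ hψc
    obtain ⟨C, hC⟩ := hψ.bounded_above_of_compact_support hψc
    exact hfint.mul_bdd (c := C) hψ.aestronglyMeasurable (Eventually.of_forall hC)
  set c := ∫ t in Ioo 0 T, f t * ψ₀ t with hcdef
  have hset : ∀ {ψ : ℝ → ℝ} (g : ℝ → ℝ), tsupport ψ ⊆ Ioo 0 T →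
      ∫ t in Ioo 0 T, g t * ψ t = ∫ t, g t * ψ t := fun g hψ =>
    setIntegral_eq_integral_of_forall_compl_eq_zero fun x hx => by
      rw [image_eq_zero_of_notMem_tsupport fun h => hx (hψ h), mul_zero]
  have hae : ∀ᵐ t, t ∈ Ioo 0 T → f t - c = 0 := by
    refine isOpen_Ioo.ae_eq_zero_of_integral_contDiff_smul_eq_zero
      ((hfint.sub (integrableOn_const (by simp))).locallyIntegrableOn) ?_
    intro ψ hψ hψc hψs
    -- `ψ - m ψ₀` has mean zero, hence is the derivative of a test function
    set m := ∫ t, ψ t with hm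
    have hψi : Integrable ψ := hψ.continuous.integrable_of_hasCompactSupport hψc
    have hψ₀int : Integrable ψ₀ := hψ₀.continuous.integrable_of_hasCompactSupport hψ₀c
    have hχs : tsupport (fun t => ψ t - m * ψ₀ t) ⊆ Ioo 0 T :=
      (tsupport_sub _ _).trans (union_subset hψs
        ((tsupport_mul_subset_right (f := fun _ => m) (g := ψ₀)).trans hψ₀s))
    obtain ⟨α, h1, h2, h3, h4⟩ := exists_primitive_test (T := T)
      (χ := fun t => ψ t - m * ψ₀ t) (hψ.sub (contDiff_const.mul hψ₀))
      (hψc.sub (hψ₀c.mul_left (f := fun _ => m))) hχs (by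
        rw [integral_sub hψi (hψ₀int.const_mul m), integral_const_mul, hψ₀i, mul_one, ← hm,
          sub_self])
    have e := h α h1 h2 h3
    simp only [h4, mul_sub, mul_left_comm _ m] at e
    rw [integral_sub (hmul hψ.continuous hψc) ((hmul hψ₀.continuous hψ₀c).const_mul m),
      integral_const_mul, ← hcdef] at e
    have e2 : ∫ t, ψ t • (f t - c) = ∫ t in Ioo 0 T, (f t * ψ t - c * ψ t) := by
      have : ∫ t, ψ t • (f t - c) = ∫ t, (f t - c) * ψ t :=
        integral_congr_ae (Eventually.of_forall fun t => mul_comm _ _)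
      rw [this, ← hset (fun t => f t - c) hψs]
      simp only [sub_mul]
    rw [e2, integral_sub (hmul hψ.continuous hψc) (hψi.integrableOn.const_mul c),
      hset (fun _ => c) hψs, integral_const_mul, ← hm]
    linarith
  have hc : EqOn f (fun _ => c) (Icc 0 T) := by
    refine Measure.eqOn_Icc_of_ae_eq volume hT.ne ?_ hf continuousOn_const
    rw [← Measure.restrict_congr_set Ioo_ae_eq_Icc]
    refine (ae_restrict_iff' measurableSet_Ioo).2 ?_
    filter_upwards [hae] with t ht h
    exact sub_eq_zero.1 (ht h)
  rw [hc hs, hc ht]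

variable {n : ℕ} {Ω : Opens (Space n)} {T : ℝ}

/-- The product `β(x) α(t)` of test functions is a test function on the cylinder. -/
noncomputable def tensorTest {a b : ℝ} (β : 𝓓(Ω, ℝ)) (α : ℝ → ℝ)
    (hα : ContDiff ℝ ((⊤ : ℕ∞) : WithTop ℕ∞) α) (hc : HasCompactSupport α)
    (hs : tsupport α ⊆ Ioo a b) : 𝓓(cyl Ω a b, ℝ) where
  toFun z := β z.1 * α z.2
  contDiff' := (β.contDiff.comp contDiff_fst).mul (hα.comp contDiff_snd)
  hasCompactSupport' := by
    refine HasCompactSupport.intro (β.hasCompactSupport.isCompact.prod hc.isCompact)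
      fun z hz => ?_
    by_contra h
    exact hz ⟨subset_tsupport _ (left_ne_zero_of_mul h), subset_tsupport _ (right_ne_zero_of_mul h)⟩
  tsupport_subset' := by
    have h : tsupport (fun z : Spacetime n => β z.1 * α z.2) ⊆ tsupport β ×ˢ tsupport α :=
      closure_minimal (fun z h => ⟨subset_tsupport _ (left_ne_zero_of_mul h),
        subset_tsupport _ (right_ne_zero_of_mul h)⟩)
        ((isClosed_tsupport _).prod (isClosed_tsupport _))
    exact h.trans (prod_mono β.tsupport_subset hs)

theorem test_contDiff_one {F : Type} [NormedAddCommGroup F] [NormedSpace ℝ F] {U : Opens F}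
    (φ : 𝓓(U, ℝ)) : ContDiff ℝ 1 φ := φ.contDiff.of_le (by simp)

theorem ae_cyl_of_snd {a b : ℝ} {p : Spacetime n → Prop} (hp : MeasurableSet {z | p z})
    (h : ∀ᵐ t ∂volume.restrict (Ioo a b), ∀ᵐ x ∂volume.restrict (Ω : Set (Space n)), p (x, t)) :
    ∀ᵐ z ∂volume.restrict (cyl Ω a b : Set (Spacetime n)), p z := by
  rw [restrict_cyl, ← Measure.prod_swap, ae_map_iff measurable_swap.aemeasurable hp]
  exact (Measure.ae_prod_iff_ae_ae (measurable_swap hp)).2 h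

/-- An element of `L²(Ω)` that is orthogonal to all test functions vanishes. -/
theorem eq_zero_of_integral_mul_test {v : L2 Ω}
    (h : ∀ β : 𝓓(Ω, ℝ), ∫ x in (Ω : Set (Space n)), v x * β x = 0) : v = 0 := by
  have hloc : LocallyIntegrableOn v (Ω : Set (Space n)) volume :=
    locallyIntegrableOn_of_locallyIntegrable_restrict
      ((Lp.memLp v).locallyIntegrable (by norm_num))
  have key := Ω.isOpen.ae_eq_zero_of_integral_contDiff_smul_eq_zero hloc fun φ hφ hc hs => by
    let β : 𝓓(Ω, ℝ) := ⟨φ, hφ, hc, hs⟩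
    rw [← h β, setIntegral_mul_test]
    exact integral_congr_ae (Eventually.of_forall fun x => mul_comm _ _)
  refine Lp.ext ?_
  have := (ae_restrict_iff' Ω.isOpen.measurableSet).2 key
  filter_upwards [this, Lp.coeFn_zero ℝ 2 (volume.restrict (Ω : Set (Space n)))] with z h1 h2
  rw [h1, h2, Pi.zero_apply]

/-- A function in `H¹(Q)` whose trace at the time `t₀` vanishes is the primitive of its time
derivative: tested against any `β ∈ C_c^∞(Ω)`, the continuous representatives of both functions have
the same weak derivative in time and the same value at `t₀`. -/
theorem TraceZeroAt.ae_eq_prim (hT : 0 < T) {t₀ : ℝ} (ht₀ : t₀ ∈ Icc 0 T)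
    {u g : L2 (cyl Ω 0 T)} (hu : TraceZeroAt Ω T t₀ u)
    (hg : IsWeakDeriv (cyl Ω 0 T) (stDir n none) u g) :
    u =ᵐ[volume.restrict (cyl Ω 0 T : Set (Spacetime n))] prim t₀ g := by
  obtain ⟨γ, hγc, hγ, hγ0⟩ := hu
  have gm := Lp.stronglyMeasurable g
  have gL := Lp.memLp g
  have pm := stronglyMeasurable_prim t₀ gm
  have pL := memLp_prim ht₀ gm gL
  obtain ⟨γ', hγc', hγ', hγ0'⟩ := exists_continuousOn_prim ht₀ gm gL
  have hdiff : ∀ t ∈ Icc 0 T, γ t - γ' t = 0 := by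
    intro t ht
    refine eq_zero_of_integral_mul_test fun β => ?_
    have βL := memLp_testFunction β
    have hin : ∀ v : L2 Ω, ∫ x in (Ω : Set (Space n)), v x * β x = inner ℝ (βL.toLp _) v := by
      intro v
      rw [L2.inner_def]
      refine integral_congr_ae ?_
      filter_upwards [βL.coeFn_toLp] with x hx
      simp [hx]
    have hcont : ContinuousOn (fun t => ∫ x in (Ω : Set (Space n)), (γ t - γ' t) x * β x)
        (Icc 0 T) := by
      simp only [hin]
      exact continuousOn_const.inner (hγc.sub hγc')
    rw [eq_of_integral_mul_deriv_eq_zero hT hcont ?_ ht ht₀, hγ0, hγ0', sub_self]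
    · refine integral_eq_zero_of_ae ?_
      filter_upwards [Lp.coeFn_zero ℝ 2 (volume.restrict (Ω : Set (Space n)))] with x hx
      rw [hx]
      simp
    · intro α hα hαc hαs
      let φ := tensorTest β α hα hαc hαs
      have hφ : ∀ x t, fderiv ℝ φ (x, t) (stDir n none) = β x * deriv α t := by
        intro x t
        rw [← deriv_slice_time (test_contDiff_one φ)]
        exact ((hα.differentiable (by simp) t).hasDerivAt.const_mul (β x)).deriv
      have φL := memLp_fderiv_test φ (stDir n none)
      have e1 := hg φ
      have e2 := integral_prim_mul_fderiv ht₀ gm gL (test_contDiff_one φ) φ.hasCompactSupport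
        (Or.inr fun x _ => test_eq_zero φ fun h => lt_irrefl _ h.2.1)
        (Or.inr fun x _ => test_eq_zero φ fun h => lt_irrefl _ h.2.2)
      have i1 := integrable_mul_of_memLp (Lp.memLp u) φL
      have i2 := integrable_mul_of_memLp pL φL
      have e3 : ∫ z in (cyl Ω 0 T : Set (Spacetime n)), (u z * fderiv ℝ φ z (stDir n none) -
          prim t₀ g z * fderiv ℝ φ z (stDir n none)) = 0 := by
        rw [integral_sub i1 i2, e1, e2, sub_self]
      rw [integral_cyl_swap (f := fun z => u z * fderiv ℝ φ z (stDir n none) -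
        prim t₀ g z * fderiv ℝ φ z (stDir n none)) (i1.sub i2)] at e3
      refine Eq.trans (integral_congr_ae ?_) e3
      filter_upwards [hγ, ae_restrict_mem measurableSet_Ioo] with s hs hs'
      rw [← integral_mul_const]
      refine integral_congr_ae ?_
      filter_upwards [hs, hγ' s ⟨hs'.1.le, hs'.2.le⟩, Lp.coeFn_sub (γ s) (γ' s)] with x h1 h2 h3
      rw [h3, Pi.sub_apply, h1, h2, hφ]
      ring
  have hmeas : MeasurableSet {z : Spacetime n | u z = prim t₀ g z} :=
    measurableSet_eq_fun (Lp.stronglyMeasurable u).measurable pm.measurable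
  refine ae_cyl_of_snd hmeas ?_
  filter_upwards [hγ, ae_restrict_mem measurableSet_Ioo] with t h1 h2
  have h3 : γ t = γ' t := sub_eq_zero.1 (hdiff t ⟨h2.1.le, h2.2.le⟩)
  filter_upwards [h1, hγ' t ⟨h2.1.le, h2.2.le⟩] with x h4 h5
  show u (x, t) = prim t₀ g (x, t)
  rw [← h4, ← h5, h3]

/-- A primitive in time whose slices are in `H¹₀(Ω)` belongs to `H^{1,1}`, with zero trace. -/
theorem exists_H11_of_prim {t₀ : ℝ} (ht₀ : t₀ ∈ Icc 0 T) {u : Spacetime n → ℝ}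
    {g : Option (Fin n) → Spacetime n → ℝ} (hm : StronglyMeasurable (g none))
    (hg : ∀ j, MemLp (g j) 2 (volume.restrict (cyl Ω 0 T : Set (Spacetime n))))
    (hs : ∀ᵐ t ∂volume.restrict (Ioo 0 T),
      IsH10With Ω (spaceDir n) (fun x => u (x, t)) (fun i x => g (some i) (x, t)))
    (hu : u =ᵐ[volume.restrict (cyl Ω 0 T : Set (Spacetime n))] prim t₀ (g none)) :
    ∃ q : Energy (H11 Ω T t₀), q.toL2 =ᵐ[volume.restrict (cyl Ω 0 T : Set (Spacetime n))] u ∧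
      ∀ j, weakDeriv (cyl Ω 0 T) j q.toH1
        =ᵐ[volume.restrict (cyl Ω 0 T : Set (Spacetime n))] g j := by
  have pL := memLp_prim ht₀ hm (hg none)
  have uL : MemLp u 2 (volume.restrict (cyl Ω 0 T : Set (Spacetime n))) :=
    pL.ae_eq hu.symm
  have hweak : ∀ j, IsWeakDeriv (cyl Ω 0 T) (stDir n j) (uL.toLp u) ((hg j).toLp (g j)) := by
    intro j φ
    have e1 : ∫ z in (cyl Ω 0 T : Set (Spacetime n)), uL.toLp u z * fderiv ℝ φ z (stDir n j) =
        ∫ z in (cyl Ω 0 T : Set (Spacetime n)), u z * fderiv ℝ φ z (stDir n j) := by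
      refine integral_congr_ae ?_
      filter_upwards [uL.coeFn_toLp] with z hz
      rw [hz]
    have e2 : ∫ z in (cyl Ω 0 T : Set (Spacetime n)), (hg j).toLp (g j) z * φ z =
        ∫ z in (cyl Ω 0 T : Set (Spacetime n)), g j z * φ z := by
      refine integral_congr_ae ?_
      filter_upwards [(hg j).coeFn_toLp] with z hz
      rw [hz]
    rw [e1, e2]
    cases j with
    | none =>
      rw [← integral_prim_mul_fderiv ht₀ hm (hg none) (test_contDiff_one φ) φ.hasCompactSupport
        (Or.inr fun x _ => test_eq_zero φ fun h => lt_irrefl _ h.2.1)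
        (Or.inr fun x _ => test_eq_zero φ fun h => lt_irrefl _ h.2.2)]
      refine integral_congr_ae ?_
      filter_upwards [hu] with z hz
      rw [hz]
    | some i =>
      exact integral_cyl_mul_fderiv_space uL (fun i => hg (some i)) hs (test_contDiff_one φ)
        φ.hasCompactSupport i
  let q₀ : H1 (cyl Ω 0 T) := ⟨uL.toLp u, fun j => ⟨_, hweak j⟩⟩
  have hd : ∀ j, weakDeriv (cyl Ω 0 T) j q₀ = (hg j).toLp (g j) := fun j => weakDeriv_eq (hweak j)
  have hq : q₀ ∈ H11 Ω T t₀ := by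
    refine ⟨?_, ?_⟩
    · have h1 := ae_slice uL.coeFn_toLp
      have h2 := ae_all_iff.2 fun i : Fin n => ae_slice (hg (some i)).coeFn_toLp
      filter_upwards [hs, h1, h2] with t a b c
      refine a.congr b.symm fun i => ?_
      rw [hd]
      exact (c i).symm
    · obtain ⟨γ, hγc, hγ, hγ0⟩ := exists_continuousOn_prim ht₀ hm (hg none)
      refine ⟨γ, hγc, ?_, hγ0⟩
      filter_upwards [ae_slice (uL.coeFn_toLp.trans hu), ae_restrict_mem measurableSet_Ioo]
        with t h1 h2
      exact (hγ t ⟨h2.1.le, h2.2.le⟩).trans h1.symm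
  refine ⟨(⟨q₀, hq⟩ : H11 Ω T t₀), uL.coeFn_toLp, fun j => ?_⟩
  show weakDeriv (cyl Ω 0 T) j q₀ =ᵐ[_] g j
  rw [hd]
  exact (hg j).coeFn_toLp

end Trace

/-! ### Completeness of the energy spaces -/

section Complete

theorem jet_norm_sub_sq {F ι : Type} [NormedAddCommGroup F] [NormedSpace ℝ F] [MeasureSpace F]
    [Fintype ι] {U : Opens F} {f f' : F → ℝ} {g g' : ι → F → ℝ}
    (hf : MemLp f 2 (volume.restrict (U : Set F)))
    (hg : ∀ i, MemLp (g i) 2 (volume.restrict (U : Set F)))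
    (hf' : MemLp f' 2 (volume.restrict (U : Set F)))
    (hg' : ∀ i, MemLp (g' i) 2 (volume.restrict (U : Set F))) :
    ‖jet hf hg - jet hf' hg'‖ ^ 2 = ∫ x in (U : Set F),
      ((f x - f' x) ^ 2 + ∑ i, (g i x - g' i x) ^ 2) := by
  have key : ∀ {a b : F → ℝ} (ha : MemLp a 2 (volume.restrict (U : Set F)))
      (hb : MemLp b 2 (volume.restrict (U : Set F))),
      ‖ha.toLp a - hb.toLp b‖ ^ 2 = ∫ x in (U : Set F), (a x - b x) ^ 2 := by
    intro a b ha hb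
    rw [← MemLp.toLp_sub, norm_toLp_sq]
    rfl
  have i1 : Integrable (fun x => (f x - f' x) ^ 2) (volume.restrict (U : Set F)) :=
    (hf.sub hf').integrable_sq
  have i2 : ∀ i, Integrable (fun x => (g i x - g' i x) ^ 2) (volume.restrict (U : Set F)) :=
    fun i => ((hg i).sub (hg' i)).integrable_sq
  rw [integral_add i1 (integrable_finsetSum _ fun i _ => i2 i),
    integral_finsetSum _ fun i _ => i2 i, PiLp.norm_sq_eq_of_L2, Fintype.sum_option, ← key hf hf']
  simp only [← fun i => key (hg i) (hg' i)]
  rfl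

/-- `H¹₀(U)` is closed under convergence in `H¹(U)`. -/
theorem isH10With_of_tendsto {F ι : Type} [NormedAddCommGroup F] [NormedSpace ℝ F]
    [MeasureSpace F] [BorelSpace F] [SecondCountableTopology F]
    [IsFiniteMeasureOnCompacts (volume : Measure F)] [Fintype ι] {U : Opens F} {e : ι → F}
    {f : F → ℝ} {g : ι → F → ℝ} {fk : ℕ → F → ℝ} {gk : ℕ → ι → F → ℝ}
    (hf : MemLp f 2 (volume.restrict (U : Set F)))
    (hg : ∀ i, MemLp (g i) 2 (volume.restrict (U : Set F)))
    (hfk : ∀ k, MemLp (fk k) 2 (volume.restrict (U : Set F)))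
    (hgk : ∀ k i, MemLp (gk k i) 2 (volume.restrict (U : Set F)))
    (h : ∀ k, IsH10With U e (fk k) (gk k))
    (hlim : Tendsto (fun k => ∫ x in (U : Set F),
      ((fk k x - f x) ^ 2 + ∑ i, (gk k i x - g i x) ^ 2)) atTop (𝓝 0)) :
    IsH10With U e f g := by
  rw [isH10With_iff_mem_closure hf hg]
  refine isClosed_closure.mem_of_tendsto (b := atTop) (f := fun k => jet (hfk k) (hgk k)) ?_
    (Eventually.of_forall fun k => (isH10With_iff_mem_closure (hfk k) (hgk k)).1 (h k))
  rw [tendsto_iff_norm_sub_tendsto_zero]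
  have h1 := (Real.continuous_sqrt.tendsto _).comp hlim
  rw [Real.sqrt_zero] at h1
  refine h1.congr fun k => ?_
  rw [Function.comp_apply, ← jet_norm_sub_sq (hfk k) (hgk k) hf hg, Real.sqrt_sq (norm_nonneg _)]

theorem norm_Lp_sq {α : Type*} [MeasurableSpace α] {μ : Measure α} (f : Lp ℝ 2 μ) :
    ‖f‖ ^ 2 = ∫ x, f x ^ 2 ∂μ := by
  rw [← real_inner_self_eq_norm_sq, L2.inner_def]
  simp [pow_two]

theorem norm_Lp_sub_sq {α : Type*} [MeasurableSpace α] {μ : Measure α} (f g : Lp ℝ 2 μ) :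
    ‖f - g‖ ^ 2 = ∫ x, (f x - g x) ^ 2 ∂μ := by
  rw [norm_Lp_sq]
  refine integral_congr_ae ?_
  filter_upwards [Lp.coeFn_sub f g] with x hx
  rw [hx, Pi.sub_apply]

variable {n : ℕ} {Ω : Opens (Space n)} {T t₀ : ℝ}

/-- Convergence to zero in `L¹(Q)` implies convergence to zero in `L¹(Ω)` of almost all slices,
along a subsequence. -/
theorem exists_subseq_slice_tendsto {h : ℕ → Spacetime n → ℝ} (h0 : ∀ k z, 0 ≤ h k z)
    (hi : ∀ k, Integrable (h k) (volume.restrict (cyl Ω 0 T : Set (Spacetime n))))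
    (hlim : Tendsto (fun k => ∫ z in (cyl Ω 0 T : Set (Spacetime n)), h k z) atTop (𝓝 0)) :
    ∃ ns : ℕ → ℕ, StrictMono ns ∧ ∀ᵐ t ∂volume.restrict (Ioo 0 T),
      Tendsto (fun k => ∫ x in (Ω : Set (Space n)), h (ns k) (x, t)) atTop (𝓝 0) := by
  have hi' : ∀ k, Integrable (fun t => ∫ x in (Ω : Set (Space n)), h k (x, t))
      (volume.restrict (Ioo 0 T)) := fun k => by
    have := hi k
    rw [restrict_cyl] at this
    exact this.integral_prod_right
  refine (tendstoInMeasure_of_tendsto_eLpNorm (p := 1) one_ne_zero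
    (fun k => (hi' k).aestronglyMeasurable) (g := 0) aestronglyMeasurable_zero
    ?_).exists_seq_tendsto_ae
  have e : ∀ k, eLpNorm ((fun t => ∫ x in (Ω : Set (Space n)), h k (x, t)) - 0) 1
      (volume.restrict (Ioo 0 T)) =
      ENNReal.ofReal (∫ z in (cyl Ω 0 T : Set (Spacetime n)), h k z) := by
    intro k
    rw [sub_zero, eLpNorm_one_eq_lintegral_enorm, ← ofReal_integral_norm_eq_lintegral_enorm (hi' k),
      integral_cyl_swap (hi k)]
    congr 1
    refine integral_congr_ae (Eventually.of_forall fun t => ?_)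
    exact Real.norm_of_nonneg (integral_nonneg fun x => h0 k _)
  simp only [e]
  simpa using ENNReal.tendsto_ofReal hlim

theorem Energy.norm_sq {U : Opens (Spacetime n)} {V : Submodule ℝ (H1 U)} (q : Energy V) :
    ‖q‖ ^ 2 = ∑ j, ‖weakDeriv U j q.toH1‖ ^ 2 := by
  rw [Energy.norm_eq, PiLp.norm_sq_eq_of_L2]
  rfl

theorem Energy.norm_weakDeriv_le {U : Opens (Spacetime n)} {V : Submodule ℝ (H1 U)}
    (q : Energy V) (j : Option (Fin n)) : ‖weakDeriv U j q.toH1‖ ≤ ‖q‖ := by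
  refine le_of_sq_le_sq ?_ (norm_nonneg _)
  rw [Energy.norm_sq]
  exact Finset.single_le_sum (f := fun j => ‖weakDeriv U j q.toH1‖ ^ 2)
    (fun j _ => sq_nonneg _) (Finset.mem_univ j)

theorem Energy.ae_eq_prim (hT : 0 < T) (ht₀ : t₀ ∈ Icc 0 T) (q : Energy (H11 Ω T t₀)) :
    q.toL2 =ᵐ[volume.restrict (cyl Ω 0 T : Set (Spacetime n))]
      prim t₀ (weakDeriv (cyl Ω 0 T) none q.toH1) :=
  TraceZeroAt.ae_eq_prim hT ht₀ q.2.2 (isWeakDeriv_weakDeriv none q.toH1)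

theorem Energy.slice_isH10With (q : Energy (H11 Ω T t₀)) :
    ∀ᵐ t ∂volume.restrict (Ioo 0 T), IsH10With Ω (spaceDir n) (fun x => q.toL2 (x, t))
      (fun i x => weakDeriv (cyl Ω 0 T) (some i) q.toH1 (x, t)) := q.2.1

/-- The Poincaré inequality in time. -/
theorem Energy.norm_toL2_le (hT : 0 < T) (ht₀ : t₀ ∈ Icc 0 T) (q : Energy (H11 Ω T t₀)) :
    ‖q.toL2‖ ≤ T * ‖q‖ := by
  refine le_of_sq_le_sq ?_ (by positivity)
  rw [norm_Lp_sq]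
  have h1 : ∫ z in (cyl Ω 0 T : Set (Spacetime n)), q.toL2 z ^ 2 =
      ∫ z in (cyl Ω 0 T : Set (Spacetime n)),
        prim t₀ (weakDeriv (cyl Ω 0 T) none q.toH1) z ^ 2 := by
    refine integral_congr_ae ?_
    filter_upwards [q.ae_eq_prim hT ht₀] with z hz
    rw [hz]
  rw [h1]
  refine (integral_prim_sq_le ht₀ (Lp.stronglyMeasurable _) (Lp.memLp _)).2.trans ?_
  rw [← norm_Lp_sq, mul_pow]
  gcongr
  exact q.norm_weakDeriv_le none

theorem prim_sub {g g' : Spacetime n → ℝ} (ht₀ : t₀ ∈ Icc 0 T)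
    (hg : MemLp g 2 (volume.restrict (cyl Ω 0 T : Set (Spacetime n))))
    (hg' : MemLp g' 2 (volume.restrict (cyl Ω 0 T : Set (Spacetime n)))) :
    prim t₀ (fun z => g z - g' z) =ᵐ[volume.restrict (cyl Ω 0 T : Set (Spacetime n))]
      fun z => prim t₀ g z - prim t₀ g' z := by
  filter_upwards [ae_cyl_of_fst (memLp_fst hg), ae_cyl_of_fst (memLp_fst hg'),
    ae_cyl_mem Ω 0 T] with z h1 h2 h3
  have hz : z.2 ∈ Icc 0 T := ⟨h3.2.1.le, h3.2.2.le⟩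
  exact intervalIntegral.integral_sub (intervalIntegrable_of_memLp ht₀ hz h1)
    (intervalIntegrable_of_memLp ht₀ hz h2)

/-- The gradients of the functions in `H^{1,1}` with vanishing trace form a closed set: the limit is
the gradient of the primitive of its time component, and almost all slices of this primitive are
limits of functions in `H¹₀(Ω)`. -/
theorem isClosed_range_grad (hT : 0 < T) (ht₀ : t₀ ∈ Icc 0 T) :
    IsClosed (range (Energy.grad (V := H11 Ω T t₀))) := by
  refine isClosed_of_closure_subset fun a ha => ?_
  obtain ⟨b, hb, hlim⟩ := mem_closure_iff_seq_limit.1 ha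
  choose q hq using hb
  obtain rfl : (fun k => Energy.grad (q k)) = b := funext hq
  have gm : StronglyMeasurable (a none) := Lp.stronglyMeasurable _
  have aL : ∀ j, MemLp (a j) 2 (volume.restrict (cyl Ω 0 T : Set (Spacetime n))) :=
    fun j => Lp.memLp _
  have pL := memLp_prim ht₀ gm (aL none)
  -- the quadratic distance between the jets of `q k` and of the limit, as a function on `Q`
  let h : ℕ → Spacetime n → ℝ := fun k z => ((q k).toL2 z - prim t₀ (a none) z) ^ 2 +
    ∑ i : Fin n, (weakDeriv (cyl Ω 0 T) (some i) (q k).toH1 z - a (some i) z) ^ 2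
  have hi1 : ∀ k, Integrable (fun z => ((q k).toL2 z - prim t₀ (a none) z) ^ 2)
      (volume.restrict (cyl Ω 0 T : Set (Spacetime n))) := fun k =>
    ((Lp.memLp (q k).toL2).sub pL).integrable_sq
  have hi2 : ∀ k, ∀ i : Fin n, Integrable
      (fun z => (weakDeriv (cyl Ω 0 T) (some i) (q k).toH1 z - a (some i) z) ^ 2)
      (volume.restrict (cyl Ω 0 T : Set (Spacetime n))) := fun k i =>
    ((Lp.memLp (weakDeriv (cyl Ω 0 T) (some i) (q k).toH1)).sub (aL (some i))).integrable_sq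
  have hi : ∀ k, Integrable (h k) (volume.restrict (cyl Ω 0 T : Set (Spacetime n))) := fun k =>
    (hi1 k).add (integrable_finsetSum _ fun i _ => hi2 k i)
  have hcomp : ∀ j, Tendsto (fun k => ‖weakDeriv (cyl Ω 0 T) j (q k).toH1 - a j‖ ^ 2)
      atTop (𝓝 0) := by
    intro j
    have h1 : Tendsto (fun k => (Energy.grad (q k)) j) atTop (𝓝 (a j)) :=
      ((PiLp.continuous_apply 2 _ j).tendsto a).comp hlim
    have h2 := (tendsto_iff_norm_sub_tendsto_zero.1 h1).pow 2
    rwa [zero_pow two_ne_zero] at h2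
  have hle : ∀ k, ∫ z in (cyl Ω 0 T : Set (Spacetime n)), h k z ≤
      T ^ 2 * ‖weakDeriv (cyl Ω 0 T) none (q k).toH1 - a none‖ ^ 2 +
        ∑ i : Fin n, ‖weakDeriv (cyl Ω 0 T) (some i) (q k).toH1 - a (some i)‖ ^ 2 := by
    intro k
    simp only [h, norm_Lp_sub_sq]
    rw [integral_add (hi1 k) (integrable_finsetSum _ fun i _ => hi2 k i),
      integral_finsetSum _ fun i _ => hi2 k i]
    gcongr
    have dm : StronglyMeasurable (fun z => weakDeriv (cyl Ω 0 T) none (q k).toH1 z - a none z) :=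
      (Lp.stronglyMeasurable _).sub gm
    refine le_trans (le_of_eq ?_) (integral_prim_sq_le (Ω := Ω) ht₀ dm
      ((Lp.memLp (weakDeriv (cyl Ω 0 T) none (q k).toH1)).sub (aL none))).2
    refine integral_congr_ae ?_
    filter_upwards [(q k).ae_eq_prim hT ht₀, prim_sub ht₀
      (Lp.memLp (weakDeriv (cyl Ω 0 T) none (q k).toH1)) (aL none)] with z h1 h2
    rw [h1, h2]
  have h0 : ∀ k z, 0 ≤ h k z := fun k z => by positivity
  have hlim' : Tendsto (fun k => ∫ z in (cyl Ω 0 T : Set (Spacetime n)), h k z) atTop (𝓝 0) := by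
    refine squeeze_zero (fun k => integral_nonneg (h0 k)) hle ?_
    simpa using ((hcomp none).const_mul (T ^ 2)).add
      (tendsto_finsetSum Finset.univ fun i _ => hcomp (some i))
  obtain ⟨ns, -, hns⟩ := exists_subseq_slice_tendsto h0 hi hlim'
  have hs : ∀ᵐ t ∂volume.restrict (Ioo 0 T), IsH10With Ω (spaceDir n)
      (fun x => prim t₀ (a none) (x, t)) (fun i x => a (some i) (x, t)) := by
    filter_upwards [hns, memLp_snd pL, ae_all_iff.2 fun i : Fin n => memLp_snd (aL (some i)),
      ae_all_iff.2 fun k => (q k).slice_isH10With,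
      ae_all_iff.2 fun k => memLp_snd (Lp.memLp (q k).toL2),
      ae_all_iff.2 fun k => ae_all_iff.2 fun i : Fin n =>
        memLp_snd (Lp.memLp (weakDeriv (cyl Ω 0 T) (some i) (q k).toH1))] with t h1 h2 h3 h4 h5 h6
    exact isH10With_of_tendsto h2 h3 (fun k => h5 (ns k)) (fun k i => h6 (ns k) i)
      (fun k => h4 (ns k)) h1
  obtain ⟨v, -, hv⟩ := exists_H11_of_prim (u := prim t₀ (a none)) (g := fun j => a j) ht₀ gm aL hs
    (EventuallyEq.refl _ _)
  exact ⟨v, PiLp.ext fun j => Lp.ext (hv j)⟩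

theorem grad_injective (hT : 0 < T) (ht₀ : t₀ ∈ Icc 0 T) :
    Function.Injective (Energy.grad (V := H11 Ω T t₀)) := by
  refine (injective_iff_map_eq_zero _).2 fun q hq => ?_
  have h0 : ‖q‖ = 0 := by rw [Energy.norm_eq, hq, norm_zero]
  have h1 := q.norm_toL2_le hT ht₀
  rw [h0, mul_zero] at h1
  have h2 : q.toL2 = 0 := norm_le_zero_iff.1 h1
  exact Subtype.ext (Subtype.ext h2)

theorem opA_apply {U : Opens (Spacetime n)} (V : Submodule ℝ (H1 U)) (w q : Energy V) :
    opA V w q = inner ℝ (Energy.grad w) (Energy.grad q) := rfl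

theorem opA_self {U : Opens (Spacetime n)} (V : Submodule ℝ (H1 U)) (w : Energy V) :
    opA V w w = ‖w‖ ^ 2 := by
  rw [opA_apply, real_inner_self_eq_norm_sq, Energy.norm_eq]

/-- The Riesz map is an isometry. -/
theorem norm_opA {U : Opens (Spacetime n)} (V : Submodule ℝ (H1 U)) (w : Energy V) :
    ‖opA V w‖ = ‖w‖ := by
  refine le_antisymm (ContinuousLinearMap.opNorm_le_bound _ (norm_nonneg _) fun q => ?_) ?_
  · rw [opA_apply, Energy.norm_eq, Energy.norm_eq]
    exact norm_inner_le_norm _ _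
  · rcases (norm_nonneg w).eq_or_lt with h | h
    · rw [← h]
      exact norm_nonneg _
    · have := (opA V w).le_opNorm w
      rw [opA_self, Real.norm_of_nonneg (sq_nonneg _), pow_two] at this
      exact le_of_mul_le_mul_right this h

/-- The Riesz representation theorem for a complete energy space. -/
theorem opA_isInvertible_of_isClosed {U : Opens (Spacetime n)} (V : Submodule ℝ (H1 U))
    (hc : IsClosed (range (Energy.grad (V := V))))
    (hinj : Function.Injective (Energy.grad (V := V))) : (opA V).IsInvertible := by
  let G : Submodule ℝ (PiLp 2 (fun _ : Option (Fin n) => L2 U)) :=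
    LinearMap.range (Energy.grad (V := V))
  have : CompleteSpace G := by
    have h : IsClosed (G : Set (PiLp 2 (fun _ : Option (Fin n) => L2 U))) := by
      rwa [LinearMap.coe_range]
    exact h.completeSpace_coe
  let e₀ : Energy V ≃ₗ[ℝ] G := LinearEquiv.ofInjective Energy.grad hinj
  let e : Energy V ≃ₗᵢ[ℝ] G := ⟨e₀, fun w => rfl⟩
  have he : ∀ w, ((e w : G) : PiLp 2 (fun _ : Option (Fin n) => L2 U)) = Energy.grad w :=
    fun w => rfl
  have hbij : Function.Bijective (opA V).toLinearMap := by
    constructor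
    · refine (injective_iff_map_eq_zero _).2 fun w hw => hinj ?_
      rw [map_zero, ← norm_eq_zero, ← Energy.norm_eq, ← norm_opA]
      have hw' : opA V w = 0 := hw
      rw [hw', norm_zero]
    · intro ℓ
      let ℓ' : StrongDual ℝ G := ℓ ∘L (e.symm.toContinuousLinearEquiv : G →L[ℝ] Energy V)
      refine ⟨e.symm ((InnerProductSpace.toDual ℝ G).symm ℓ'), ?_⟩
      ext q
      show opA V _ q = _
      rw [opA_apply, ← he, ← he, e.apply_symm_apply, ← Submodule.coe_inner,
        InnerProductSpace.toDual_symm_apply]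
      show ℓ (e.symm (e q)) = _
      rw [e.symm_apply_apply]
  let A : Energy V ≃ₗᵢ[ℝ] StrongDual ℝ (Energy V) :=
    ⟨LinearEquiv.ofBijective (opA V).toLinearMap hbij, norm_opA V⟩
  exact ⟨A.toContinuousLinearEquiv, rfl⟩

/-- The energy space `H^{1,1}` with vanishing trace is complete, so `A` is an isomorphism onto the
dual space. -/
theorem opA_isInvertible (hT : 0 < T) (ht₀ : t₀ ∈ Icc 0 T) : (opA (H11 Ω T t₀)).IsInvertible :=
  opA_isInvertible_of_isClosed _ (isClosed_range_grad hT ht₀) (grad_injective hT ht₀)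

end Complete

/-! ### The wave operator as a bilinear form -/

section Form

variable {n : ℕ} {Ω : Opens (Space n)} {T : ℝ}

theorem cyl_subset_cyl (hT : 0 < T) :
    (cyl Ω 0 T : Set (Spacetime n)) ⊆ (cyl Ω (-T) T : Set (Spacetime n)) :=
  prod_mono subset_rfl (Ioo_subset_Ioo (by linarith) le_rfl)

theorem restrict_cyl_le (hT : 0 < T) :
    volume.restrict (cyl Ω 0 T : Set (Spacetime n)) ≤
      volume.restrict (cyl Ω (-T) T : Set (Spacetime n)) :=
  Measure.restrict_mono (cyl_subset_cyl hT) le_rfl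

/-- The slice `φ(·, t)` of a test function on a cylinder. -/
noncomputable def sliceTest {a b : ℝ} (φ : 𝓓(cyl Ω a b, ℝ)) (t : ℝ) : 𝓓(Ω, ℝ) where
  toFun x := φ (x, t)
  contDiff' := φ.contDiff.comp (contDiff_id.prodMk contDiff_const)
  hasCompactSupport' := hasCompactSupport_slice φ.hasCompactSupport t
  tsupport_subset' := by
    have h : tsupport (fun x => φ (x, t)) ⊆ Prod.fst '' tsupport φ :=
      closure_minimal (fun x hx => ⟨(x, t), subset_tsupport _ hx, rfl⟩)
        (φ.hasCompactSupport.isCompact.image continuous_fst).isClosed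
    rintro x hx
    obtain ⟨z, hz, rfl⟩ := h hx
    exact (φ.tsupport_subset hz).1

theorem prim_fderiv_test {φ : Spacetime n → ℝ} (hφ : ContDiff ℝ 1 φ) {t₀ : ℝ} {x : Space n}
    (h0 : φ (x, t₀) = 0) (t : ℝ) :
    prim t₀ (fun z => fderiv ℝ φ z (stDir n none)) (x, t) = φ (x, t) := by
  have hx : ContDiff ℝ 1 fun t => φ (x, t) := hφ.comp (contDiff_const.prodMk contDiff_id)
  have h := intervalIntegral.integral_deriv_eq_sub' (a := t₀) (b := t) (fun t => φ (x, t)) rfl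
    (fun s _ => hx.differentiable one_ne_zero s) (hx.continuous_deriv le_rfl).continuousOn
  rw [h0, sub_zero] at h
  simp only [deriv_slice_time hφ] at h
  exact h

/-- The restriction to `Q` of a test function on `Q₋` belongs to the test space `Y`. -/
theorem exists_restrict_test (hT : 0 < T) (φ : 𝓓(cyl Ω (-T) T, ℝ)) :
    ∃ q : Y Ω T, q.toL2 =ᵐ[volume.restrict (cyl Ω 0 T : Set (Spacetime n))] φ ∧
      ‖q‖ ≤ ‖testH10 φ‖ := by
  have hc := test_contDiff_one φ
  have hgL : ∀ j, MemLp (fun z => fderiv ℝ φ z (stDir n j)) 2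
      (volume.restrict (cyl Ω 0 T : Set (Spacetime n))) := fun j =>
    (memLp_fderiv_test φ (stDir n j)).mono_measure (restrict_cyl_le hT)
  obtain ⟨q, hq, hq'⟩ := exists_H11_of_prim (Ω := Ω) (T := T) (t₀ := T) (u := φ)
    (g := fun j z => fderiv ℝ φ z (stDir n j)) ⟨hT.le, le_rfl⟩
    (continuous_fderiv_dir hc (stDir n none)).stronglyMeasurable hgL
    (Eventually.of_forall fun t => by
      have h := IsH10With.of_test (e := spaceDir n) (sliceTest φ t)
      refine h.congr (EventuallyEq.refl _ _) fun i => Eventually.of_forall fun x => ?_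
      exact fderiv_slice_space hc x (spaceDir n i) t)
    (Eventually.of_forall fun z => (prim_fderiv_test hc
      (test_eq_zero φ fun h => lt_irrefl _ h.2.2) z.2).symm)
  refine ⟨q, hq, ?_⟩
  refine le_of_sq_le_sq ?_ (norm_nonneg _)
  rw [Energy.norm_sq, Energy.norm_sq]
  refine Finset.sum_le_sum fun j _ => ?_
  have e : weakDeriv (cyl Ω (-T) T) j (testH10 φ).toH1 =
    (memLp_fderiv_test φ (stDir n j)).toLp _ := weakDeriv_testH1 φ j
  rw [e, norm_Lp_sq, norm_toLp_sq]
  refine le_trans (le_of_eq (integral_congr_ae ?_)) (integral_mono_measure (restrict_cyl_le hT)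
    (Eventually.of_forall fun z => sq_nonneg (fderiv ℝ φ z (stDir n j)))
    (memLp_fderiv_test φ (stDir n j)).integrable_sq)
  filter_upwards [hq' j] with z hz
  rw [hz]

/-- Weak derivatives are local. -/
theorem weakDeriv_restrict (hT : 0 < T) {z : H1 (cyl Ω (-T) T)} {v : H1 (cyl Ω 0 T)}
    (h : (z : L2 (cyl Ω (-T) T)) =ᵐ[volume.restrict (cyl Ω 0 T : Set (Spacetime n))]
      (v : L2 (cyl Ω 0 T))) (j : Option (Fin n)) :
    weakDeriv (cyl Ω (-T) T) j z =ᵐ[volume.restrict (cyl Ω 0 T : Set (Spacetime n))]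
      weakDeriv (cyl Ω 0 T) j v := by
  have hL : MemLp (weakDeriv (cyl Ω (-T) T) j z) 2
      (volume.restrict (cyl Ω 0 T : Set (Spacetime n))) :=
    (Lp.memLp _).mono_measure (restrict_cyl_le hT)
  have hw : IsWeakDeriv (cyl Ω 0 T) (stDir n j) v (hL.toLp _) := by
    intro φ
    let φ' : 𝓓(cyl Ω (-T) T, ℝ) :=
      ⟨φ, φ.contDiff, φ.hasCompactSupport, φ.tsupport_subset.trans (cyl_subset_cyl hT)⟩
    have h1 := isWeakDeriv_weakDeriv j z φ'
    have hset : ∀ {f ψ : Spacetime n → ℝ},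
        (∀ x ∉ (cyl Ω 0 T : Set (Spacetime n)), ψ x = 0) →
        ∫ x in (cyl Ω (-T) T : Set (Spacetime n)), f x * ψ x =
          ∫ x in (cyl Ω 0 T : Set (Spacetime n)), f x * ψ x := by
      intro f ψ hψ
      exact setIntegral_eq_of_subset_of_forall_sdiff_eq_zero
        (cyl Ω (-T) T).isOpen.measurableSet (cyl_subset_cyl hT)
        fun x hx => by rw [hψ x hx.2, mul_zero]
    rw [hset (f := (z : L2 (cyl Ω (-T) T))) (ψ := fun x => fderiv ℝ φ' x (stDir n j))
      fun x hx => fderiv_test_eq_zero φ hx _,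
      hset (f := weakDeriv (cyl Ω (-T) T) j z) (ψ := φ') fun x hx => test_eq_zero φ hx] at h1
    refine Eq.trans ?_ (h1.trans (congrArg Neg.neg ?_))
    · refine integral_congr_ae ?_
      filter_upwards [h] with x hx
      rw [hx]
      rfl
    · refine integral_congr_ae ?_
      filter_upwards [hL.coeFn_toLp] with x hx
      rw [hx]
      rfl
  rw [weakDeriv_eq hw]
  exact hL.coeFn_toLp.symm

theorem memLp_zeroExt (u : L2 (cyl Ω 0 T)) (s : Set (Spacetime n)) :
    MemLp (zeroExt Ω T u) 2 (volume.restrict s) :=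
  ((memLp_indicator_iff_restrict (cyl Ω 0 T).isOpen.measurableSet).2 (Lp.memLp u)).restrict s

/-- The weak derivative as a bounded operator on an energy space. -/
noncomputable def Energy.derivL {U : Opens (Spacetime n)} (V : Submodule ℝ (H1 U))
    (j : Option (Fin n)) : Energy V →L[ℝ] L2 U :=
  LinearMap.mkContinuous (weakDeriv U j ∘ₗ Energy.toH1) 1 fun q => by
    rw [one_mul]
    exact q.norm_weakDeriv_le j

/-- The functional `z ↦ ∫_Q g ∂ⱼ z` on `H¹₀(Q₋)`. -/
noncomputable def derivPairing (j : Option (Fin n)) (g : L2 (cyl Ω 0 T)) :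
    StrongDual ℝ (H10m Ω T) :=
  innerSL ℝ ((memLp_zeroExt g (cyl Ω (-T) T)).toLp _ : L2 (cyl Ω (-T) T)) ∘L
    Energy.derivL (H10 (cyl Ω (-T) T)) j

theorem derivPairing_apply (j : Option (Fin n)) (g : L2 (cyl Ω 0 T)) (z : H10m Ω T) :
    derivPairing j g z = ∫ x in (cyl Ω 0 T : Set (Spacetime n)),
      g x * weakDeriv (cyl Ω (-T) T) j z.toH1 x := by
  rw [← zeroExt_integral]
  show inner ℝ ((memLp_zeroExt g (cyl Ω (-T) T)).toLp _ : L2 (cyl Ω (-T) T))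
    (weakDeriv (cyl Ω (-T) T) j z.toH1) = _
  rw [L2.inner_def]
  refine integral_congr_ae ?_
  filter_upwards [(memLp_zeroExt g (cyl Ω (-T) T)).coeFn_toLp] with x hx
  rw [hx]
  simp [mul_comm]

/-- For `u ∈ H^{1,1}_{0;0,}(Q)`, two integrations by parts give
`⟨□ ũ, z⟩ = -⟨∂ₜ u, ∂ₜ z⟩_Q + ⟨∇ₓ u, ∇ₓ z⟩_Q` for all `z ∈ H¹₀(Q₋)`. -/
theorem boxDual_eq_derivPairing (hT : 0 < T) {w : calH Ω T} {u : Energy (H11init Ω T)}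
    (huw : u.toL2 = w) :
    boxDual Ω T w = -derivPairing none (weakDeriv (cyl Ω 0 T) none u.toH1) +
      ∑ i : Fin n, derivPairing (some i) (weakDeriv (cyl Ω 0 T) (some i) u.toH1) := by
  refine DFunLike.coe_injective (denseRange_testH10.equalizer (ContinuousLinearMap.continuous _)
    (ContinuousLinearMap.continuous _) (funext fun φ => ?_))
  have huL : MemLp u.toL2 2 (volume.restrict (cyl Ω 0 T : Set (Spacetime n))) := Lp.memLp _
  have hd : ∀ (j : Option (Fin n)) (g : L2 (cyl Ω 0 T)), derivPairing j g (testH10 φ) =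
      ∫ x in (cyl Ω 0 T : Set (Spacetime n)), g x * fderiv ℝ φ x (stDir n j) := by
    intro j g
    rw [derivPairing_apply]
    refine integral_congr_ae ?_
    have e : weakDeriv (cyl Ω (-T) T) j (testH10 φ).toH1 =
      (memLp_fderiv_test φ (stDir n j)).toLp _ := weakDeriv_testH1 φ j
    rw [e]
    filter_upwards [ae_mono (restrict_cyl_le hT) (memLp_fderiv_test φ (stDir n j)).coeFn_toLp]
      with x hx
    rw [hx]
  have hψ : ∀ j, ContDiff ℝ 1 fun y => fderiv ℝ φ y (stDir n j) := fun j =>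
    (contDiff_fderiv_test φ (stDir n j)).of_le (by simp)
  have hψc : ∀ j, HasCompactSupport fun y => fderiv ℝ φ y (stDir n j) := fun j =>
    φ.hasCompactSupport.fderiv_apply (𝕜 := ℝ) (stDir n j)
  have hL : ∀ j, MemLp (fun z => fderiv ℝ (fun y => fderiv ℝ φ y (stDir n j)) z (stDir n j)) 2
      (volume.restrict (cyl Ω 0 T : Set (Spacetime n))) := fun j =>
    memLp_of_contDiff (continuous_fderiv_dir (hψ j) _) ((hψc j).fderiv_apply (𝕜 := ℝ) _) _
  have e1 : ∫ z in (cyl Ω 0 T : Set (Spacetime n)),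
      u.toL2 z * fderiv ℝ (fun y => fderiv ℝ φ y (stDir n none)) z (stDir n none) =
      -derivPairing none (weakDeriv (cyl Ω 0 T) none u.toH1) (testH10 φ) := by
    rw [hd, ← integral_prim_mul_fderiv (t₀ := 0) ⟨le_rfl, hT.le⟩ (Lp.stronglyMeasurable _)
      (Lp.memLp _) (hψ none) (hψc none) (Or.inl rfl)
      (Or.inr fun x _ => fderiv_test_eq_zero φ (fun h => lt_irrefl _ h.2.2) _)]
    refine integral_congr_ae ?_
    filter_upwards [u.ae_eq_prim hT ⟨le_rfl, hT.le⟩] with z hz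
    rw [hz]
  have e2 : ∀ i : Fin n, ∫ z in (cyl Ω 0 T : Set (Spacetime n)),
      u.toL2 z * fderiv ℝ (fun y => fderiv ℝ φ y (stDir n (some i))) z (stDir n (some i)) =
      -derivPairing (some i) (weakDeriv (cyl Ω 0 T) (some i) u.toH1) (testH10 φ) := fun i => by
    rw [hd]
    exact integral_cyl_mul_fderiv_space huL (fun i => Lp.memLp _) u.slice_isH10With
      (hψ (some i)) (hψc (some i)) i
  show boxDual Ω T w (testH10 φ) = _
  rw [isBox_boxDual w φ, zeroExt_integral, ← huw]
  have e3 : ∀ z, u.toL2 z * box φ z =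
      u.toL2 z * fderiv ℝ (fun y => fderiv ℝ φ y (stDir n none)) z (stDir n none) -
      ∑ i : Fin n, u.toL2 z *
        fderiv ℝ (fun y => fderiv ℝ φ y (stDir n (some i))) z (stDir n (some i)) := fun z => by
    rw [box, mul_sub, Finset.mul_sum]
  simp only [e3]
  rw [integral_sub (integrable_mul_of_memLp huL (hL none))
    (integrable_finsetSum _ fun i _ => integrable_mul_of_memLp huL (hL (some i))),
    integral_finsetSum _ fun i _ => integrable_mul_of_memLp huL (hL (some i)), e1]
  simp only [e2, Finset.sum_neg_distrib, sub_neg_eq_add]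
  simp

/-- `⟨□ ũ, z⟩` in terms of the restriction `v` of `z` to `Q`. -/
theorem boxDual_apply_of_ae_eq (hT : 0 < T) {w : calH Ω T} {u : Energy (H11init Ω T)}
    (huw : u.toL2 = w) {z : H10m Ω T} {v : H1 (cyl Ω 0 T)}
    (h : z.toL2 =ᵐ[volume.restrict (cyl Ω 0 T : Set (Spacetime n))] (v : L2 (cyl Ω 0 T))) :
    boxDual Ω T w z =
      -(∫ x in (cyl Ω 0 T : Set (Spacetime n)), weakDeriv (cyl Ω 0 T) none u.toH1 x *
        weakDeriv (cyl Ω 0 T) none v x) +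
      ∑ i : Fin n, ∫ x in (cyl Ω 0 T : Set (Spacetime n)),
        weakDeriv (cyl Ω 0 T) (some i) u.toH1 x * weakDeriv (cyl Ω 0 T) (some i) v x := by
  have hd : ∀ (j : Option (Fin n)) (g : L2 (cyl Ω 0 T)), derivPairing j g z =
      ∫ x in (cyl Ω 0 T : Set (Spacetime n)), g x * weakDeriv (cyl Ω 0 T) j v x := by
    intro j g
    rw [derivPairing_apply]
    refine integral_congr_ae ?_
    filter_upwards [weakDeriv_restrict hT h j] with x hx
    rw [hx]
  rw [boxDual_eq_derivPairing hT huw]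
  simp [hd]

theorem norm_le_graphH (u : calH Ω T) :
    ‖(u : L2 (cyl Ω 0 T))‖ ≤ ‖graphH Ω T u‖ ∧ ‖boxDual Ω T u‖ ≤ ‖graphH Ω T u‖ := by
  have h : ‖graphH Ω T u‖ ^ 2 = ‖(u : L2 (cyl Ω 0 T))‖ ^ 2 + ‖boxDual Ω T u‖ ^ 2 :=
    WithLp.prod_norm_sq_eq_of_L2 _
  constructor <;> refine le_of_sq_le_sq ?_ (norm_nonneg _) <;> rw [h]
  · linarith [sq_nonneg ‖boxDual Ω T u‖]
  · linarith [sq_nonneg ‖(u : L2 (cyl Ω 0 T))‖]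

/-- For `u ∈ X`, the functional `□ ũ` annihilates the functions that vanish on `Q`. -/
theorem X.box_eq_zero (hT : 0 < T) (u : X Ω T) {z : H10m Ω T}
    (h : z.toL2 =ᵐ[volume.restrict (cyl Ω 0 T : Set (Spacetime n))] (0 : Spacetime n → ℝ)) :
    X.box u z = 0 := by
  rw [← norm_eq_zero]
  refine le_antisymm (le_of_forall_pos_le_add fun ε hε => ?_) (norm_nonneg _)
  let u' : calH Ω T := (calH0 Ω T).subtype u
  obtain ⟨w, ⟨v, hv, hvw⟩, hlt⟩ := u.2 (ε / (‖z‖ + 1)) (by positivity)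
  have h0 : boxDual Ω T w z = 0 := by
    rw [boxDual_apply_of_ae_eq hT (u := (⟨v, hv⟩ : H11init Ω T)) hvw (v := 0)
      (h.trans (Lp.coeFn_zero ℝ 2 _).symm)]
    have : ∀ (j : Option (Fin n)) (g : L2 (cyl Ω 0 T)),
        ∫ x in (cyl Ω 0 T : Set (Spacetime n)), g x * weakDeriv (cyl Ω 0 T) j 0 x = 0 := by
      intro j g
      rw [map_zero]
      refine integral_eq_zero_of_ae ?_
      filter_upwards [Lp.coeFn_zero ℝ 2 (volume.restrict (cyl Ω 0 T : Set (Spacetime n)))] with x hx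
      rw [hx]
      simp
    simp only [this, neg_zero, Finset.sum_const_zero, add_zero]
  have e : X.box u z = boxDual Ω T (u' - w) z := by
    rw [map_sub, sub_apply, h0, sub_zero]
    rfl
  rw [e, zero_add]
  calc ‖boxDual Ω T (u' - w) z‖ ≤ ‖boxDual Ω T (u' - w)‖ * ‖z‖ :=
        ContinuousLinearMap.le_opNorm _ _
    _ ≤ ε / (‖z‖ + 1) * ‖z‖ := by
        gcongr
        exact (norm_le_graphH _).2.trans hlt.le
    _ ≤ ε / (‖z‖ + 1) * (‖z‖ + 1) := by gcongr; linarith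
    _ = ε := by field_simp

theorem opB_apply (E : Y Ω T →L[ℝ] H10m Ω T) (u : X Ω T) (q : Y Ω T) :
    opB E u q = X.box u (E q) := rfl

/-- `‖u‖_X ≤ ‖B u‖`: the value `⟨□ ũ, φ⟩` only depends on the restriction of `φ` to `Q`, which may
hence be replaced by its extension by `E`. -/
theorem norm_le_norm_opB (hT : 0 < T) {E : Y Ω T →L[ℝ] H10m Ω T} (hE : IsExtension E)
    (u : X Ω T) : ‖u‖ ≤ ‖opB E u‖ := by
  rw [X.norm_eq]
  refine ContinuousLinearMap.opNorm_le_bound _ (norm_nonneg _) fun z => ?_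
  refine denseRange_testH10.induction_on z (isClosed_le (by fun_prop) (by fun_prop)) fun φ => ?_
  obtain ⟨q, hq, hle⟩ := exists_restrict_test hT φ
  have h0 : X.box u (testH10 φ - E q) = 0 := by
    refine X.box_eq_zero hT u ?_
    rw [map_sub]
    filter_upwards [ae_mono (restrict_cyl_le hT) (Lp.coeFn_sub (testH10 φ).toL2 (E q).toL2),
      hE q, hq, ae_mono (restrict_cyl_le hT) (memLp_test φ).coeFn_toLp] with x h1 h2 h3 h4
    have h5 : (testH10 φ).toL2 x = φ x := h4
    rw [h1, Pi.sub_apply, h2, h3, h5, sub_self, Pi.zero_apply]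
  rw [map_sub, sub_eq_zero] at h0
  rw [h0, ← opB_apply]
  exact ((opB E u).le_opNorm q).trans (by gcongr)

end Form

/-! ### Injectivity of the wave operator -/

section Coercive

variable {n : ℕ} {Ω : Opens (Space n)} {T t₀ : ℝ}

theorem integrable_slice_mul {p : Space n → ℝ} {f : Spacetime n → ℝ}
    (hp : MemLp p 2 (volume.restrict (Ω : Set (Space n))))
    (hf : MemLp f 2 (volume.restrict (cyl Ω 0 T : Set (Spacetime n)))) :
    Integrable (fun z => p z.1 * f z) (volume.restrict (cyl Ω 0 T : Set (Spacetime n))) := by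
  refine integrable_mul_of_memLp ?_ hf
  rw [restrict_cyl]
  exact (memLp_two_iff_integrable_sq hp.aestronglyMeasurable.comp_fst).2
    (hp.integrable_sq.comp_fst _)

theorem integral_mul_prim_slice (ht₀ : t₀ ∈ Icc 0 T) {p : Space n → ℝ} {f : Spacetime n → ℝ}
    (hp : MemLp p 2 (volume.restrict (Ω : Set (Space n))))
    (hf : MemLp f 2 (volume.restrict (cyl Ω 0 T : Set (Spacetime n)))) {t : ℝ}
    (ht : t ∈ Icc 0 T) :
    ∫ x in (Ω : Set (Space n)), p x * prim t₀ f (x, t) =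
      ∫ s in t₀..t, ∫ x in (Ω : Set (Space n)), p x * f (x, s) := by
  have hle : volume.restrict (uIoc t₀ t) ≤ volume.restrict (Ioo 0 T) := by
    rw [Measure.restrict_congr_set (Ioo_ae_eq_Icc (a := 0) (b := T))]
    exact Measure.restrict_mono (uIoc_subset_uIcc.trans (uIcc_subset_Icc ht₀ ht)) le_rfl
  have hint : Integrable (fun z : Spacetime n => p z.1 * f z)
      ((volume.restrict (Ω : Set (Space n))).prod (volume.restrict (uIoc t₀ t))) := by
    have := integrable_slice_mul hp hf
    rw [restrict_cyl] at this
    exact this.mono_measure (Measure.prod_mono le_rfl hle)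
  rw [intervalIntegral.intervalIntegral_eq_integral_uIoc, ← integral_integral_swap hint,
    smul_eq_mul, ← integral_const_mul]
  refine integral_congr_ae (Eventually.of_forall fun x => ?_)
  simp only [prim]
  rw [intervalIntegral.intervalIntegral_eq_integral_uIoc, integral_const_mul, smul_eq_mul]
  ring

/-- Primitives in time preserve the Dirichlet condition of the slices: by Fubini's theorem they
preserve the orthogonality relations that characterize `H¹₀(Ω)`. -/
theorem isH10With_prim_slice (ht₀ : t₀ ∈ Icc 0 T) {u : Spacetime n → ℝ}
    {g : Fin n → Spacetime n → ℝ} (hum : StronglyMeasurable u)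
    (hgm : ∀ i, StronglyMeasurable (g i))
    (hu : MemLp u 2 (volume.restrict (cyl Ω 0 T : Set (Spacetime n))))
    (hg : ∀ i, MemLp (g i) 2 (volume.restrict (cyl Ω 0 T : Set (Spacetime n))))
    (hs : ∀ᵐ t ∂volume.restrict (Ioo 0 T),
      IsH10With Ω (spaceDir n) (fun x => u (x, t)) (fun i x => g i (x, t)))
    {t : ℝ} (ht : t ∈ Icc 0 T) :
    IsH10With Ω (spaceDir n) (fun x => prim t₀ u (x, t)) (fun i x => prim t₀ (g i) (x, t)) := by
  rw [isH10With_iff_orthogonal (memLp_prim_slice ht₀ hum hu ht)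
    (fun i => memLp_prim_slice ht₀ (hgm i) (hg i) ht)]
  intro p hp
  have pL : ∀ j, MemLp (p j) 2 (volume.restrict (Ω : Set (Space n))) := fun j => Lp.memLp _
  have hint : ∀ {q : Space n → ℝ} {f : Spacetime n → ℝ},
      MemLp q 2 (volume.restrict (Ω : Set (Space n))) →
      MemLp f 2 (volume.restrict (cyl Ω 0 T : Set (Spacetime n))) →
      IntervalIntegrable (fun s => ∫ x in (Ω : Set (Space n)), q x * f (x, s)) volume t₀ t := by
    intro q f hq hf
    have h := integrable_slice_mul hq hf
    rw [restrict_cyl] at h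
    have h' : IntegrableOn (fun s => ∫ x in (Ω : Set (Space n)), q x * f (x, s)) (Icc 0 T) :=
      (integrableOn_Icc_iff_integrableOn_Ioo).2 h.integral_prod_right
    exact (h'.mono_set (uIcc_subset_Icc ht₀ ht)).intervalIntegrable
  rw [integral_mul_prim_slice ht₀ (pL none) hu ht]
  simp only [fun i => integral_mul_prim_slice ht₀ (pL (some i)) (hg i) ht]
  have hsum : IntervalIntegrable
      (fun s => ∑ i, ∫ x in (Ω : Set (Space n)), p (some i) x * g i (x, s)) volume t₀ t := by
    have := IntervalIntegrable.sum Finset.univ fun i _ => hint (pL (some i)) (hg i)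
    simpa only [Finset.sum_fn] using this
  rw [← intervalIntegral.integral_finsetSum fun i _ => hint (pL (some i)) (hg i),
    ← intervalIntegral.integral_add (hint (pL none) hu) hsum]
  refine intervalIntegral.integral_zero_ae ?_
  have h1 : ∀ᵐ s ∂volume.restrict (uIoc t₀ t), (∫ x in (Ω : Set (Space n)), p none x * u (x, s)) +
      ∑ i, ∫ x in (Ω : Set (Space n)), p (some i) x * g i (x, s) = 0 := by
    refine ae_restrict_of_ae_restrict_of_subset
      (uIoc_subset_uIcc.trans (uIcc_subset_Icc ht₀ ht)) ?_
    rw [← Measure.restrict_congr_set (Ioo_ae_eq_Icc (a := 0) (b := T))]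
    filter_upwards [hs, memLp_snd hu, ae_all_iff.2 fun i => memLp_snd (hg i)] with s h1 h2 h3
    exact (isH10With_iff_orthogonal h2 h3).1 h1 p hp
  exact (ae_restrict_iff' measurableSet_uIoc).1 h1

/-- The a priori estimate for the wave equation. The test function
`v(·, t) = ∫ₜᵀ e^{-2s} u(·, s) ds` satisfies
`-⟨∂ₜ u, ∂ₜ v⟩ + ⟨∇ₓ u, ∇ₓ v⟩ ≥ ∫ e^{-2t} |u|² + ∫ e^{2t} |∇ₓ v|²`, which controls both
the norm of `u` in `L²(Q)` and the norm of `v` in `Y`. -/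
theorem norm_le_norm_boxDual (hT : 0 < T) {E : Y Ω T →L[ℝ] H10m Ω T} (hE : IsExtension E)
    (hE2 : ∀ q, ‖E q‖ ≤ 2 * ‖q‖) {w : calH Ω T} {u : Energy (H11init Ω T)} (huw : u.toL2 = w) :
    Real.exp (-2 * T) * ‖(w : L2 (cyl Ω 0 T))‖ ^ 2 ≤ 4 * ‖boxDual Ω T w‖ ^ 2 := by
  have hT0 : (0 : ℝ) ∈ Icc 0 T := ⟨le_rfl, hT.le⟩
  have hTT : T ∈ Icc 0 T := ⟨hT.le, le_rfl⟩
  have hexp : Continuous fun t : ℝ => -Real.exp (-2 * t) := by fun_prop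
  -- `∂ₜ v = W u`, and `∂ᵢ v` is the primitive of `W (∂ᵢ u)`, where `W f = -e^{-2t} f`
  let W : (Spacetime n → ℝ) → Spacetime n → ℝ := fun f z => -Real.exp (-2 * z.2) * f z
  have Wm : ∀ {f : Spacetime n → ℝ}, StronglyMeasurable f → StronglyMeasurable (W f) := fun hf =>
    (hexp.comp continuous_snd).stronglyMeasurable.mul hf
  have WL : ∀ {f : Spacetime n → ℝ},
      MemLp f 2 (volume.restrict (cyl Ω 0 T : Set (Spacetime n))) →
      MemLp (W f) 2 (volume.restrict (cyl Ω 0 T : Set (Spacetime n))) := fun hf =>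
    memLp_weight hexp hf
  have um : StronglyMeasurable u.toL2 := Lp.stronglyMeasurable _
  have uL : MemLp u.toL2 2 (volume.restrict (cyl Ω 0 T : Set (Spacetime n))) := Lp.memLp _
  let d : Option (Fin n) → L2 (cyl Ω 0 T) := fun j => weakDeriv (cyl Ω 0 T) j u.toH1
  have dm : ∀ j, StronglyMeasurable (d j) := fun j => Lp.stronglyMeasurable _
  have dL : ∀ j, MemLp (d j) 2 (volume.restrict (cyl Ω 0 T : Set (Spacetime n))) :=
    fun j => Lp.memLp _
  have hW : ∀ᵐ t ∂volume.restrict (Ioo 0 T), IsH10With Ω (spaceDir n)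
      (fun x => W u.toL2 (x, t)) (fun i x => W (d (some i)) (x, t)) := by
    filter_upwards [u.slice_isH10With] with t ht
    exact ht.smul (-Real.exp (-2 * t))
  obtain ⟨v, -, hv⟩ := exists_H11_of_prim (Ω := Ω) (t₀ := T) (u := prim T (W u.toL2))
    (g := fun j => j.elim (W u.toL2) fun i => prim T (W (d (some i)))) hTT (Wm um)
    (fun j => by
      cases j with
      | none => exact WL uL
      | some i => exact memLp_prim hTT (Wm (dm _)) (WL (dL _)))
    (by
      filter_upwards [ae_restrict_mem measurableSet_Ioo] with t ht
      exact isH10With_prim_slice hTT (Wm um) (fun i => Wm (dm (some i))) (WL uL)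
        (fun i => WL (dL (some i))) hW ⟨ht.1.le, ht.2.le⟩)
    (EventuallyEq.refl _ _)
  have hbox := boxDual_apply_of_ae_eq hT huw (z := E v) (v := v.toH1) (hE v)
  have i0 := integrable_mul_of_memLp (memLp_weight (w := fun t => Real.exp (-2 * t))
    (by fun_prop) uL) uL
  -- the kinetic term
  have e0 : ∫ z in (cyl Ω 0 T : Set (Spacetime n)), Real.exp (-2 * z.2) * u.toL2 z * u.toL2 z ≤
      -∫ z in (cyl Ω 0 T : Set (Spacetime n)), d none z * weakDeriv (cyl Ω 0 T) none v.toH1 z := by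
    have h1 := integral_mul_prim_zero (Ω := Ω) hT.le (dm none) (dL none)
    rw [← integral_neg]
    refine le_trans (le_of_eq (integral_congr_ae ?_)) (h1.trans (le_of_eq (integral_congr_ae ?_)))
    · filter_upwards [u.ae_eq_prim hT hT0] with z hz
      rw [hz]
    · filter_upwards [u.ae_eq_prim hT hT0, hv none] with z hz hz'
      rw [hz']
      simp only [Option.elim_none, W]
      rw [hz]
      ring
  -- the potential term
  have e1 : ∀ i : Fin n, ∫ z in (cyl Ω 0 T : Set (Spacetime n)),
      weakDeriv (cyl Ω 0 T) (some i) v.toH1 z ^ 2 ≤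
      ∫ z in (cyl Ω 0 T : Set (Spacetime n)),
        d (some i) z * weakDeriv (cyl Ω 0 T) (some i) v.toH1 z := by
    intro i
    have PL := memLp_prim hTT (Wm (dm (some i))) (WL (dL (some i)))
    have h1 := integral_mul_prim_final (Ω := Ω) hT.le (Wm (dm (some i))) (WL (dL (some i)))
    have h2 : ∫ z in (cyl Ω 0 T : Set (Spacetime n)),
        weakDeriv (cyl Ω 0 T) (some i) v.toH1 z ^ 2 ≤
        ∫ z in (cyl Ω 0 T : Set (Spacetime n)), Real.exp (2 * z.2) *
          prim T (W (d (some i))) z * prim T (W (d (some i))) z := by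
      refine integral_mono_ae (Lp.memLp _).integrable_sq
        (integrable_mul_of_memLp (memLp_weight (w := fun t => Real.exp (2 * t)) (by fun_prop) PL)
          PL) ?_
      filter_upwards [hv (some i), ae_cyl_mem Ω 0 T] with z hz hz'
      rw [hz]
      have : 1 ≤ Real.exp (2 * z.2) := Real.one_le_exp (by linarith [hz'.2.1])
      simp only [Option.elim_some]
      nlinarith [sq_nonneg (prim T (W (d (some i))) z)]
    refine h2.trans (h1.trans (le_of_eq ?_))
    rw [← integral_neg]
    refine integral_congr_ae ?_
    filter_upwards [hv (some i)] with z hz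
    rw [hz]
    simp only [Option.elim_some, W]
    have : Real.exp (2 * z.2) * Real.exp (-2 * z.2) = 1 := by
      rw [← Real.exp_add]
      simp
    linear_combination d (some i) z * prim T (W (d (some i))) z * this
  have hsum := Finset.sum_le_sum fun (i : Fin n) (_ : i ∈ Finset.univ) => e1 i
  have hvnorm : ‖v‖ ^ 2 ≤ boxDual Ω T w (E v) := by
    rw [Energy.norm_sq, Fintype.sum_option, hbox]
    simp only [norm_Lp_sq]
    refine add_le_add (le_trans ?_ e0) hsum
    refine integral_mono_ae (Lp.memLp _).integrable_sq i0 ?_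
    filter_upwards [hv none, ae_cyl_mem Ω 0 T] with z hz hz'
    rw [hz]
    simp only [Option.elim_none, W]
    have h1 : Real.exp (-2 * z.2) ≤ 1 := Real.exp_le_one_iff.2 (by linarith [hz'.2.1])
    have h2 := Real.exp_pos (-2 * z.2)
    have h3 : Real.exp (-2 * z.2) ^ 2 ≤ Real.exp (-2 * z.2) := by nlinarith
    nlinarith [sq_nonneg (u.toL2 z)]
  have hunorm : Real.exp (-2 * T) * ‖(w : L2 (cyl Ω 0 T))‖ ^ 2 ≤ boxDual Ω T w (E v) := by
    rw [hbox]
    have hnn : 0 ≤ ∑ i : Fin n, ∫ z in (cyl Ω 0 T : Set (Spacetime n)),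
        weakDeriv (cyl Ω 0 T) (some i) v.toH1 z ^ 2 :=
      Finset.sum_nonneg fun i _ => integral_nonneg fun z => sq_nonneg _
    refine le_trans ?_ (le_add_of_le_of_nonneg e0 (hnn.trans hsum))
    rw [← huw, norm_Lp_sq, ← integral_const_mul]
    refine integral_mono_ae (uL.integrable_sq.const_mul _) i0 ?_
    filter_upwards [ae_cyl_mem Ω 0 T] with z hz
    have h1 : Real.exp (-2 * T) ≤ Real.exp (-2 * z.2) :=
      Real.exp_le_exp.2 (by linarith [hz.2.2])
    nlinarith [sq_nonneg (u.toL2 z)]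
  have hup : boxDual Ω T w (E v) ≤ ‖boxDual Ω T w‖ * (2 * ‖v‖) :=
    (le_abs_self _).trans (((boxDual Ω T w).le_opNorm _).trans (by gcongr; exact hE2 v))
  have hv2 : ‖v‖ ≤ 2 * ‖boxDual Ω T w‖ := by
    rcases (norm_nonneg v).eq_or_lt with h | h
    · rw [← h]
      positivity
    · refine le_of_mul_le_mul_right ?_ h
      nlinarith
  nlinarith [norm_nonneg (boxDual Ω T w)]

/-- The norm of `X` is definite: the a priori estimate on `H^{1,1}_{0;0,}(Q)` extends to its closure
in the graph norm. -/
theorem X.eq_zero_of_norm_eq_zero (hT : 0 < T) {E : Y Ω T →L[ℝ] H10m Ω T} (hE : IsExtension E)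
    (hE2 : ∀ q, ‖E q‖ ≤ 2 * ‖q‖) {u : X Ω T} (hu : ‖u‖ = 0) : u = 0 := by
  let u' : calH Ω T := (calH0 Ω T).subtype u
  have hu' : ‖boxDual Ω T u'‖ = 0 := hu
  set c := Real.exp T with hc
  have hcpos : 0 < c := Real.exp_pos _
  have hbound : ∀ (w : calH Ω T) (v : Energy (H11init Ω T)), v.toL2 = w →
      ‖(w : L2 (cyl Ω 0 T))‖ ≤ 2 * c * ‖boxDual Ω T w‖ := by
    intro w v hvw
    have h := norm_le_norm_boxDual hT hE hE2 hvw
    refine le_of_sq_le_sq ?_ (by positivity)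
    have e : Real.exp (-2 * T) * c ^ 2 = 1 := by
      rw [hc, ← Real.exp_nat_mul, ← Real.exp_add]
      simp
    calc ‖(w : L2 (cyl Ω 0 T))‖ ^ 2
        = c ^ 2 * (Real.exp (-2 * T) * ‖(w : L2 (cyl Ω 0 T))‖ ^ 2) := by
          linear_combination -‖(w : L2 (cyl Ω 0 T))‖ ^ 2 * e
      _ ≤ c ^ 2 * (4 * ‖boxDual Ω T w‖ ^ 2) := by gcongr
      _ = (2 * c * ‖boxDual Ω T w‖) ^ 2 := by ring
  have h0 : ‖(u' : L2 (cyl Ω 0 T))‖ = 0 := by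
    refine le_antisymm (le_of_forall_pos_le_add fun ε hε => ?_) (norm_nonneg _)
    obtain ⟨w, ⟨v, hv, hvw⟩, hlt⟩ := u.2 (ε / (2 * c + 1)) (by positivity)
    have hlt' : ‖graphH Ω T (u' - w)‖ < ε / (2 * c + 1) := hlt
    have h1 := hbound w (⟨v, hv⟩ : H11init Ω T) hvw
    have h2 := norm_le_graphH (u' - w)
    have h3 : ‖boxDual Ω T w‖ ≤ ‖graphH Ω T (u' - w)‖ := by
      have : ‖boxDual Ω T w‖ ≤ ‖boxDual Ω T u'‖ + ‖boxDual Ω T (u' - w)‖ := by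
        rw [map_sub]
        exact norm_le_insert _ _
      rw [hu', zero_add] at this
      exact this.trans h2.2
    have h4 : ‖(u' : L2 (cyl Ω 0 T))‖ ≤
        ‖(w : L2 (cyl Ω 0 T))‖ + ‖((u' - w : calH Ω T) : L2 (cyl Ω 0 T))‖ := by
      have := norm_le_insert' (u' : L2 (cyl Ω 0 T)) (w : L2 (cyl Ω 0 T))
      exact this
    have h5 : ‖graphH Ω T (u' - w)‖ * (2 * c + 1) < ε := (lt_div_iff₀ (by positivity)).1 hlt'
    rw [zero_add]
    nlinarith [h2.1]
  have h1 : (u' : L2 (cyl Ω 0 T)) = 0 := norm_eq_zero.1 h0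
  exact Subtype.ext (Subtype.ext h1)

end Coercive

/-! ### Mollification of functions of compact support -/

section Mollify

open scoped Convolution

variable {F : Type} [NormedAddCommGroup F] [NormedSpace ℝ F] [FiniteDimensional ℝ F]
  [MeasureSpace F] [BorelSpace F] [(volume : Measure F).IsAddHaarMeasure]

/-- `G` is the weak derivative of `W` on the whole space in the direction `v`. -/
def IsGlobalWeakDeriv (v : F) (W G : F → ℝ) : Prop :=
  ∀ φ : F → ℝ, ContDiff ℝ ((⊤ : ℕ∞) : WithTop ℕ∞) φ → HasCompactSupport φ →
    ∫ x, W x * fderiv ℝ φ x v = -∫ x, G x * φ x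

theorem mollify_apply (W ρ : F → ℝ) (x : F) :
    (W ⋆[ContinuousLinearMap.lsmul ℝ ℝ, volume] ρ) x = ∫ y, ρ y * W (x - y) := by
  rw [convolution_def, ← integral_sub_left_eq_self _ volume x]
  refine integral_congr_ae (Eventually.of_forall fun y => ?_)
  simp [mul_comm]

/-- Mollification commutes with weak derivatives. -/
theorem IsGlobalWeakDeriv.fderiv_mollify {v : F} {W G : F → ℝ} (h : IsGlobalWeakDeriv v W G)
    (hW : LocallyIntegrable W) {ρ : F → ℝ} (hρ : ContDiff ℝ ((⊤ : ℕ∞) : WithTop ℕ∞) ρ)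
    (hc : HasCompactSupport ρ) (x : F) :
    fderiv ℝ (W ⋆[ContinuousLinearMap.lsmul ℝ ℝ, volume] ρ) x v =
      (G ⋆[ContinuousLinearMap.lsmul ℝ ℝ, volume] ρ) x := by
  have hρ1 : ContDiff ℝ 1 ρ := hρ.of_le (by simp)
  have hρ' : ContDiff ℝ ((⊤ : ℕ∞) : WithTop ℕ∞) fun t => ρ (x - t) :=
    hρ.comp (contDiff_const.sub contDiff_id)
  have hcc : HasCompactSupport fun t => ρ (x - t) :=
    hc.comp_homeomorph (Homeomorph.subLeft x)
  have hd : ∀ t, fderiv ℝ (fun t => ρ (x - t)) t v = -fderiv ℝ ρ (x - t) v := by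
    intro t
    have h1 := (hρ1.differentiable one_ne_zero (x - t)).hasFDerivAt.comp (f := fun t => x - t) t
      ((hasFDerivAt_id t).const_sub x)
    have e : (ρ ∘ fun t => x - t) = fun t => ρ (x - t) := rfl
    rw [e] at h1
    rw [h1.fderiv]
    simp
  have h2 := h _ hρ' hcc
  simp only [hd, mul_neg, integral_neg, neg_inj] at h2
  rw [(hc.hasFDerivAt_convolution_right (ContinuousLinearMap.lsmul ℝ ℝ) hW hρ1 x).fderiv,
    convolution_precompR_apply _ hW (hc.fderiv ℝ) (hρ1.continuous_fderiv one_ne_zero)]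
  exact h2

/-- The mollification, at a small scale, of a function that vanishes off a compact subset of `U` is
a test function on `U`. -/
noncomputable def mollifyTest {U : Opens F} {K : Set F} {δ : ℝ} (hK : IsCompact K)
    (hKU : Metric.cthickening δ K ⊆ U) (W ρ : F → ℝ) (hW : LocallyIntegrable W)
    (hW0 : ∀ x ∉ K, W x = 0) (hρ : ContDiff ℝ ((⊤ : ℕ∞) : WithTop ℕ∞) ρ)
    (hc : HasCompactSupport ρ) (hρδ : tsupport ρ ⊆ Metric.ball 0 δ) : 𝓓(U, ℝ) :=
  have hsub : tsupport (W ⋆[ContinuousLinearMap.lsmul ℝ ℝ, volume] ρ) ⊆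
      Metric.cthickening δ K := by
    refine closure_minimal (fun x hx => ?_) Metric.isClosed_cthickening
    by_contra h
    refine hx ?_
    rw [mollify_apply]
    refine integral_eq_zero_of_ae (Eventually.of_forall fun y => ?_)
    by_contra hne
    have h1 : x - y ∈ K := by
      by_contra h1
      exact hne (by simp [hW0 _ h1])
    have h2 : y ∈ Metric.ball 0 δ := hρδ (subset_tsupport _ (left_ne_zero_of_mul hne))
    refine h (Metric.mem_cthickening_of_dist_le x (x - y) δ K h1 ?_)
    rw [mem_ball_zero_iff] at h2
    simpa [dist_eq_norm] using h2.le
  { toFun := W ⋆[ContinuousLinearMap.lsmul ℝ ℝ, volume] ρ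
    contDiff' := hc.contDiff_convolution_right _ hW hρ
    hasCompactSupport' := (hK.cthickening).of_isClosed_subset (isClosed_tsupport _) hsub
    tsupport_subset' := hsub.trans hKU }

/-- Translations act continuously on `L²`. -/
theorem continuous_integral_mul_translate {P W : F → ℝ} (hP : MemLp P 2 volume)
    (hW : MemLp W 2 volume) : Continuous fun y : F => ∫ x, P x * W (x - y) := by
  let τ : F → C(F, F) := fun y => ⟨fun x => x - y, by fun_prop⟩
  have hτ : Continuous τ := by
    let f : C(F × F, F) := ⟨fun p => p.2 - p.1, by fun_prop⟩
    exact f.curry.continuous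
  have hmp : ∀ y, MeasurePreserving (τ y) volume volume := fun y =>
    measurePreserving_sub_right volume y
  have hcont : Continuous fun y => Lp.compMeasurePreserving (τ y) (hmp y) (hW.toLp W) :=
    continuous_const.compMeasurePreservingLp hτ hmp (by norm_num)
  have e : (fun y : F => ∫ x, P x * W (x - y)) = fun y =>
      inner ℝ (Lp.compMeasurePreserving (τ y) (hmp y) (hW.toLp W)) (hP.toLp P) := by
    ext y
    rw [L2.inner_def]
    refine integral_congr_ae ?_
    filter_upwards [hP.coeFn_toLp, Lp.coeFn_compMeasurePreserving (hW.toLp W) (hmp y),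
      (hmp y).quasiMeasurePreserving.ae hW.coeFn_toLp] with x h1 h2 h3
    rw [h1, h2, Function.comp_apply, h3]
    simp [τ]
  rw [e]
  exact hcont.inner continuous_const

theorem integral_mul_mollify {P W ρ : F → ℝ} (hP : MemLp P 2 volume) (hW : MemLp W 2 volume)
    (hρ : Continuous ρ) (hc : HasCompactSupport ρ) :
    ∫ x, P x * (W ⋆[ContinuousLinearMap.lsmul ℝ ℝ, volume] ρ) x =
      ∫ y, ρ y * ∫ x, P x * W (x - y) := by
  have hρi : Integrable ρ := hρ.integrable_of_hasCompactSupport hc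
  have hmeas : AEStronglyMeasurable (fun p : F × F => ρ p.2 * (P p.1 * W (p.1 - p.2)))
      (volume.prod volume) := by
    have h1 : AEStronglyMeasurable (fun p : F × F => ρ p.2 * W (p.1 - p.2))
        (volume.prod volume) :=
      hρ.aestronglyMeasurable.convolution_integrand (ContinuousLinearMap.mul ℝ ℝ)
        hW.aestronglyMeasurable
    have h2 : AEStronglyMeasurable (fun p : F × F => P p.1) (volume.prod volume) :=
      hP.aestronglyMeasurable.comp_fst
    refine (h2.mul h1).congr (Eventually.of_forall fun p => ?_)
    simp only [Pi.mul_apply]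
    ring
  have hdom : Integrable (fun p : F × F => P p.1 ^ 2 * |ρ p.2| + |ρ p.2| * W (p.1 - p.2) ^ 2)
      (volume.prod volume) := by
    refine (hP.integrable_sq.mul_prod hρi.abs).add ?_
    exact hρi.abs.convolution_integrand (ContinuousLinearMap.mul ℝ ℝ) hW.integrable_sq
  have hint : Integrable (fun p : F × F => ρ p.2 * (P p.1 * W (p.1 - p.2)))
      (volume.prod volume) := by
    refine hdom.mono' hmeas (Eventually.of_forall fun p => ?_)
    rw [Real.norm_eq_abs, abs_mul, abs_mul]
    have h1 := two_mul_le_add_sq |P p.1| |W (p.1 - p.2)|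
    rw [sq_abs, sq_abs] at h1
    nlinarith [abs_nonneg (ρ p.2), mul_nonneg (abs_nonneg (P p.1)) (abs_nonneg (W (p.1 - p.2)))]
  have h1 : ∀ x, P x * (W ⋆[ContinuousLinearMap.lsmul ℝ ℝ, volume] ρ) x =
      ∫ y, ρ y * (P x * W (x - y)) := by
    intro x
    rw [mollify_apply, ← integral_const_mul]
    refine integral_congr_ae (Eventually.of_forall fun y => ?_)
    simp only []
    ring
  simp only [h1]
  rw [integral_integral_swap hint]
  simp only [integral_const_mul]

/-- A weakly differentiable function that vanishes off a compact subset of `U` is in `H¹₀(U)`. If `p`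
is orthogonal to all test functions, it is orthogonal to all mollifications of `W`. Hence its
pairing with the translate of `W` by `y`, which is continuous in `y`, vanishes for small `y`, and in
particular for `y = 0`. -/
theorem isH10With_of_compact {ι : Type} [Fintype ι] {U : Opens F} {e : ι → F} {K : Set F}
    (hK : IsCompact K) (hKU : K ⊆ U) {W : F → ℝ} {G : ι → F → ℝ} (hW : MemLp W 2 volume)
    (hG : ∀ i, MemLp (G i) 2 volume) (hW0 : ∀ x ∉ K, W x = 0)
    (h : ∀ i, IsGlobalWeakDeriv (e i) W (G i)) : IsH10With U e W G := by
  rw [isH10With_iff_orthogonal (hW.restrict _) fun i => (hG i).restrict _]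
  intro p hp
  obtain ⟨δ, hδ, hδU⟩ := hK.exists_cthickening_subset_open U.isOpen hKU
  -- extend `p` by zero
  let P : Option ι → F → ℝ := fun o => (U : Set F).indicator (p o)
  have PL : ∀ o, MemLp (P o) 2 volume := fun o =>
    (memLp_indicator_iff_restrict U.isOpen.measurableSet).2 (Lp.memLp (p o))
  have hPint : ∀ o (f : F → ℝ), ∫ x in (U : Set F), p o x * f x = ∫ x, P o x * f x := by
    intro o f
    rw [← integral_indicator U.isOpen.measurableSet]
    refine integral_congr_ae (Eventually.of_forall fun x => ?_)
    simp only [P]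
    rw [indicator_mul_left]
  have hWl : LocallyIntegrable W := hW.locallyIntegrable (by norm_num)
  -- the pairing of `p` with the translates of `(W, G)`
  let c : F → ℝ := fun y => (∫ x, P none x * W (x - y)) +
    ∑ i, ∫ x, P (some i) x * G i (x - y)
  have hcc : ∀ o {f : F → ℝ}, MemLp f 2 volume → Continuous fun y => ∫ x, P o x * f (x - y) :=
    fun o f hf => continuous_integral_mul_translate (PL o) hf
  have hcont : Continuous c :=
    (hcc none hW).add (continuous_finsetSum _ fun i _ => hcc (some i) (hG i))
  have hae : ∀ᵐ y, y ∈ Metric.ball (0 : F) δ → c y = 0 := by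
    refine Metric.isOpen_ball.ae_eq_zero_of_integral_contDiff_smul_eq_zero
      (hcont.locallyIntegrable.locallyIntegrableOn _) ?_
    intro ρ hρ hρc hρs
    let φ := mollifyTest hK hδU W ρ hWl hW0 hρ hρc hρs
    have hi : ∀ o {f : F → ℝ}, MemLp f 2 volume →
        Integrable fun y => ρ y * ∫ x, P o x * f (x - y) := fun o f hf =>
      (hρ.continuous.mul (hcc o hf)).integrable_of_hasCompactSupport hρc.mul_right
    have e1 := hp φ
    rw [hPint] at e1
    simp only [fun i => hPint (some i)] at e1
    have e2 : ∀ i x, fderiv ℝ φ x (e i) =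
        (G i ⋆[ContinuousLinearMap.lsmul ℝ ℝ, volume] ρ) x := fun i x =>
      (h i).fderiv_mollify hWl hρ hρc x
    simp only [e2] at e1
    have e3 : ∫ x, P none x * φ x = ∫ y, ρ y * ∫ x, P none x * W (x - y) :=
      integral_mul_mollify (PL none) hW hρ.continuous hρc
    rw [e3] at e1
    simp only [fun i => integral_mul_mollify (PL (some i)) (hG i) hρ.continuous hρc] at e1
    rw [← e1, ← integral_finsetSum _ fun i _ => hi (some i) (hG i),
      ← integral_add (hi none hW) (integrable_finsetSum _ fun i _ => hi (some i) (hG i))]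
    refine integral_congr_ae (Eventually.of_forall fun y => ?_)
    simp only [c, smul_eq_mul, mul_add, Finset.mul_sum]
  have h0 : c 0 = 0 := by
    refine Measure.eqOn_open_of_ae_eq (μ := volume) (g := fun _ => 0) ?_ Metric.isOpen_ball
      hcont.continuousOn continuousOn_const (Metric.mem_ball_self hδ)
    exact (ae_restrict_iff' Metric.isOpen_ball.measurableSet).2 hae
  rw [hPint]
  simp only [fun i => hPint (some i)]
  simpa only [c, sub_zero] using h0

end Mollify

/-! ### Dilation on convex domains -/

section Dilation

set_option linter.unusedSectionVars false

variable {F : Type} [NormedAddCommGroup F] [NormedSpace ℝ F] [FiniteDimensional ℝ F]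
  [MeasureSpace F] [BorelSpace F] [(volume : Measure F).IsAddHaarMeasure]

/-- The dilation by the factor `s` with centre `x₀`. -/
def dil (x₀ : F) (s : ℝ) (x : F) : F := s • (x - x₀) + x₀

theorem dil_dil {x₀ : F} {s r : ℝ} (h : s * r = 1) (x : F) : dil x₀ s (dil x₀ r x) = x := by
  simp [dil, smul_smul, h]

theorem continuous_dil (x₀ : F) (s : ℝ) : Continuous (dil x₀ s) := by
  unfold dil
  fun_prop

theorem integral_comp_dil (x₀ : F) (s : ℝ) (f : F → ℝ) :
    ∫ x, f (dil x₀ s x) = |(s ^ Module.finrank ℝ F)⁻¹| * ∫ x, f x := by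
  unfold dil
  rw [integral_sub_right_eq_self (fun x => f (s • x + x₀)) x₀]
  rw [Measure.integral_comp_smul volume (fun x => f (x + x₀)) s,
    integral_add_right_eq_self f x₀, smul_eq_mul]

theorem quasiMeasurePreserving_dil (x₀ : F) {s : ℝ} (hs : s ≠ 0) :
    Measure.QuasiMeasurePreserving (dil x₀ s) (volume : Measure F) volume := by
  have h1 : Measure.QuasiMeasurePreserving (fun x : F => s • x) volume volume :=
    ⟨by fun_prop, by
      rw [Measure.map_addHaar_smul volume hs]
      exact Measure.smul_absolutelyContinuous⟩
  exact ((measurePreserving_add_right volume x₀).quasiMeasurePreserving.comp h1).comp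
    (measurePreserving_sub_right volume x₀).quasiMeasurePreserving

theorem memLp_comp_dil (x₀ : F) {s : ℝ} (hs : s ≠ 0) {f : F → ℝ} (hf : MemLp f 2 volume) :
    MemLp (fun x => f (dil x₀ s x)) 2 volume := by
  have hm : AEStronglyMeasurable (fun x => f (dil x₀ s x)) volume :=
    hf.aestronglyMeasurable.comp_quasiMeasurePreserving (quasiMeasurePreserving_dil x₀ hs)
  refine (memLp_two_iff_integrable_sq hm).2 ?_
  have h1 : Integrable (fun x => f (x + x₀) ^ 2) volume := hf.integrable_sq.comp_add_right x₀
  exact (h1.comp_smul hs).comp_sub_right x₀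

theorem integral_sq_comp_dil_le (x₀ : F) {s : ℝ} (hs : 1 ≤ s) (f : F → ℝ) :
    ∫ x, f (dil x₀ s x) ^ 2 ≤ ∫ x, f x ^ 2 := by
  rw [integral_comp_dil x₀ s fun x => f x ^ 2]
  refine mul_le_of_le_one_left (integral_nonneg fun x => sq_nonneg _) ?_
  have h := one_le_pow₀ hs (n := Module.finrank ℝ F)
  rw [abs_of_nonneg (by positivity)]
  exact inv_le_one_of_one_le₀ h

/-- Weak derivatives scale under dilations. -/
theorem IsGlobalWeakDeriv.comp_dil {v : F} {W G : F → ℝ} (h : IsGlobalWeakDeriv v W G) (x₀ : F)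
    {s : ℝ} (hs : 0 < s) :
    IsGlobalWeakDeriv v (fun x => W (dil x₀ s x)) (fun x => s * G (dil x₀ s x)) := by
  intro φ hφ hc
  set r := s⁻¹ with hr
  have hrs : r * s = 1 := inv_mul_cancel₀ hs.ne'
  have hsr : s * r = 1 := mul_inv_cancel₀ hs.ne'
  let ψ : F → ℝ := fun x => φ (dil x₀ r x)
  have hψ : ContDiff ℝ ((⊤ : ℕ∞) : WithTop ℕ∞) ψ := by
    refine hφ.comp ?_
    unfold dil
    fun_prop
  have hψc : HasCompactSupport ψ := by
    let e : F ≃ₜ F := ⟨⟨dil x₀ r, dil x₀ s, dil_dil hsr, dil_dil hrs⟩, continuous_dil _ _,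
      continuous_dil _ _⟩
    exact hc.comp_homeomorph e
  have hφψ : ∀ x, φ x = ψ (dil x₀ s x) := fun x => by simp only [ψ, dil_dil hrs]
  have hd : ∀ x, fderiv ℝ φ x v = s * fderiv ℝ ψ (dil x₀ s x) v := by
    intro x
    have h1 : HasFDerivAt (dil x₀ s) (s • ContinuousLinearMap.id ℝ F) x :=
      (((hasFDerivAt_id x).sub_const x₀).const_smul s).add_const x₀
    have h2 := (hψ.differentiable (by simp) (dil x₀ s x)).hasFDerivAt.comp x h1
    have e : ψ ∘ dil x₀ s = φ := funext fun x => (hφψ x).symm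
    rw [e] at h2
    rw [h2.fderiv]
    simp
  have h1 := h ψ hψ hψc
  have e1 : ∫ x, W (dil x₀ s x) * fderiv ℝ φ x v =
      |(s ^ Module.finrank ℝ F)⁻¹| * (s * ∫ x, W x * fderiv ℝ ψ x v) := by
    rw [← integral_const_mul, ← integral_comp_dil x₀ s fun x => s * (W x * fderiv ℝ ψ x v)]
    refine integral_congr_ae (Eventually.of_forall fun x => ?_)
    simp only [hd]
    ring
  have e2 : ∫ x, s * G (dil x₀ s x) * φ x =
      |(s ^ Module.finrank ℝ F)⁻¹| * (s * ∫ x, G x * ψ x) := by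
    rw [← integral_const_mul, ← integral_comp_dil x₀ s fun x => s * (G x * ψ x)]
    refine integral_congr_ae (Eventually.of_forall fun x => ?_)
    simp only [← hφψ]
    ring
  rw [e1, e2, h1]
  ring

/-- Dilations act continuously on `C_c`, in the norm of `L²`. -/
theorem tendsto_integral_sq_dil_of_continuous (x₀ : F) {s : ℕ → ℝ} (hs1 : ∀ k, 1 ≤ s k)
    (hs : Tendsto s atTop (𝓝 1)) {h : F → ℝ} (hh : Continuous h) (hc : HasCompactSupport h) :
    Tendsto (fun k => ∫ x, (h (dil x₀ (s k) x) - h x) ^ 2) atTop (𝓝 0) := by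
  obtain ⟨C, hC⟩ := hh.bounded_above_of_compact_support hc
  obtain ⟨R, hR⟩ := hc.isCompact.isBounded.subset_closedBall x₀
  have hout : ∀ k x, x ∉ Metric.closedBall x₀ R → h (dil x₀ (s k) x) = 0 ∧ h x = 0 := by
    intro k x hx
    have hz : ∀ y, y ∉ Metric.closedBall x₀ R → h y = 0 := fun y hy =>
      image_eq_zero_of_notMem_tsupport fun h => hy (hR h)
    refine ⟨hz _ fun hy => hx ?_, hz _ hx⟩
    rw [mem_closedBall_iff_norm] at hy ⊢
    have : dil x₀ (s k) x - x₀ = s k • (x - x₀) := by simp [dil]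
    rw [this, norm_smul, Real.norm_of_nonneg (by linarith [hs1 k])] at hy
    nlinarith [hs1 k, norm_nonneg (x - x₀)]
  have hlim : ∀ x, Tendsto (fun k => (h (dil x₀ (s k) x) - h x) ^ 2) atTop (𝓝 0) := by
    intro x
    have h1 : Continuous fun r : ℝ => (h (dil x₀ r x) - h x) ^ 2 := by
      unfold dil
      fun_prop
    have h2 := (h1.tendsto 1).comp hs
    simpa [dil, Function.comp_def] using h2
  have := tendsto_integral_of_dominated_convergence
    (bound := (Metric.closedBall x₀ R).indicator fun _ => (2 * C) ^ 2)
    (F := fun k x => (h (dil x₀ (s k) x) - h x) ^ 2) (f := fun _ => 0) (μ := volume)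
    (fun k => (((hh.comp (continuous_dil x₀ (s k))).sub hh).pow 2).aestronglyMeasurable)
    ((integrable_indicator_iff Metric.isClosed_closedBall.measurableSet).2
      (integrableOn_const (measure_closedBall_lt_top).ne))
    (fun k => Eventually.of_forall fun x => ?_) (Eventually.of_forall hlim)
  · simpa using this
  · by_cases hx : x ∈ Metric.closedBall x₀ R
    · rw [indicator_of_mem hx, Real.norm_of_nonneg (sq_nonneg _), ← sq_abs]
      have h1 := hC (dil x₀ (s k) x)
      have h2 := hC x
      rw [Real.norm_eq_abs] at h1 h2
      have h3 := abs_sub (h (dil x₀ (s k) x)) (h x)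
      gcongr
      linarith
    · rw [indicator_of_notMem hx, (hout k x hx).1, (hout k x hx).2]
      simp

theorem integral_add_sq_le {f g : F → ℝ} (hf : MemLp f 2 volume) (hg : MemLp g 2 volume) :
    ∫ x, (f x + g x) ^ 2 ≤ 2 * (∫ x, f x ^ 2) + 2 * ∫ x, g x ^ 2 := by
  rw [← integral_const_mul, ← integral_const_mul,
    ← integral_add (hf.integrable_sq.const_mul 2) (hg.integrable_sq.const_mul 2)]
  refine integral_mono (hf.add hg).integrable_sq
    ((hf.integrable_sq.const_mul 2).add (hg.integrable_sq.const_mul 2)) fun x => ?_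
  show (f x + g x) ^ 2 ≤ 2 * f x ^ 2 + 2 * g x ^ 2
  nlinarith [sq_nonneg (f x - g x)]

/-- Dilations act continuously on `L²`, since they do so on the dense subspace `C_c` and are
contractions for factors `≥ 1`. -/
theorem tendsto_integral_sq_dil (x₀ : F) {s : ℕ → ℝ} (hs1 : ∀ k, 1 ≤ s k)
    (hs : Tendsto s atTop (𝓝 1)) {f : F → ℝ} (hf : MemLp f 2 volume) :
    Tendsto (fun k => ∫ x, (f (dil x₀ (s k) x) - f x) ^ 2) atTop (𝓝 0) := by
  rw [Metric.tendsto_atTop]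
  intro ε hε
  obtain ⟨h, hc, hle, hh, hL⟩ := hf.exists_hasCompactSupport_eLpNorm_sub_le (p := 2) (by norm_num)
    (ε := ENNReal.ofReal (Real.sqrt (ε / 16))) (by simpa using hε)
  have hd : MemLp (fun x => f x - h x) 2 volume := hf.sub hL
  have hle' : ∫ x, (f x - h x) ^ 2 ≤ ε / 16 := by
    rw [← norm_toLp_sq hd, Lp.norm_toLp]
    have h1 : (eLpNorm (fun x => f x - h x) 2 volume).toReal ≤ Real.sqrt (ε / 16) :=
      ENNReal.toReal_le_of_le_ofReal (Real.sqrt_nonneg _) hle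
    calc _ ≤ Real.sqrt (ε / 16) ^ 2 := by gcongr
      _ = ε / 16 := Real.sq_sqrt (by positivity)
  obtain ⟨N, hN⟩ := Metric.tendsto_atTop.1
    (tendsto_integral_sq_dil_of_continuous x₀ hs1 hs hh hc) (ε / 16) (by positivity)
  refine ⟨N, fun k hk => ?_⟩
  have hk' := hN k hk
  rw [Real.dist_eq, sub_zero, abs_of_nonneg (integral_nonneg fun x => sq_nonneg _)] at hk' ⊢
  have hne : s k ≠ 0 := by linarith [hs1 k]
  have hdk : MemLp (fun x => f (dil x₀ (s k) x) - h (dil x₀ (s k) x)) 2 volume :=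
    memLp_comp_dil x₀ hne hd
  have hhk : MemLp (fun x => h (dil x₀ (s k) x) - h x) 2 volume :=
    (memLp_comp_dil x₀ hne hL).sub hL
  have h1 := integral_add_sq_le hdk (hhk.sub hd)
  have h2 := integral_add_sq_le hhk hd.neg
  have h3 := integral_sq_comp_dil_le x₀ (hs1 k) fun x => f x - h x
  have e1 : ∀ x, f (dil x₀ (s k) x) - h (dil x₀ (s k) x) +
      ((fun x => h (dil x₀ (s k) x) - h x) - fun x => f x - h x) x =
      f (dil x₀ (s k) x) - f x := fun x => by
    simp only [Pi.sub_apply]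
    ring
  have e2 : ∀ x, ((fun x => h (dil x₀ (s k) x) - h x) - fun x => f x - h x) x =
      h (dil x₀ (s k) x) - h x + (-fun x => f x - h x) x := fun x => by
    simp only [Pi.sub_apply, Pi.neg_apply]
    ring
  simp only [e1] at h1
  simp only [e2] at h1
  simp only [Pi.neg_apply, neg_sq] at h1 h2
  linarith

/-- On a bounded convex open set, a function whose extension by zero is weakly differentiable on
the whole space belongs to `H¹₀`: after a dilation it vanishes off a compact subset. -/
theorem isH10With_of_convex {ι : Type} [Fintype ι] {U : Opens F} {e : ι → F}
    (hU : Convex ℝ (U : Set F)) (hb : Bornology.IsBounded (U : Set F)) {x₀ : F} (hx₀ : x₀ ∈ U)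
    {W : F → ℝ} {G : ι → F → ℝ} (hW : MemLp W 2 volume) (hG : ∀ i, MemLp (G i) 2 volume)
    (hW0 : ∀ x ∉ U, W x = 0) (h : ∀ i, IsGlobalWeakDeriv (e i) W (G i)) :
    IsH10With U e W G := by
  let s : ℕ → ℝ := fun k => 1 + 1 / ((k : ℝ) + 1)
  have hs1 : ∀ k, 1 < s k := fun k => by
    have : 0 < 1 / ((k : ℝ) + 1) := by positivity
    simp only [s]
    linarith
  have hs : Tendsto s atTop (𝓝 1) := by
    simpa only [s, add_zero] using (tendsto_one_div_add_atTop_nhds_zero_nat (𝕜 := ℝ)).const_add 1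
  have hspos : ∀ k, 0 < s k := fun k => zero_lt_one.trans (hs1 k)
  have hWk : ∀ k, MemLp (fun x => W (dil x₀ (s k) x)) 2 volume := fun k =>
    memLp_comp_dil x₀ (hspos k).ne' hW
  have hGk : ∀ k i, MemLp (fun x => s k * G i (dil x₀ (s k) x)) 2 volume := fun k i =>
    (memLp_comp_dil x₀ (hspos k).ne' (hG i)).const_mul (s k)
  have hclosed : IsCompact (closure (U : Set F)) := hb.isCompact_closure
  have hk : ∀ k, IsH10With U e (fun x => W (dil x₀ (s k) x))
      (fun i x => s k * G i (dil x₀ (s k) x)) := by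
    intro k
    have hr : (s k)⁻¹ * s k = 1 := inv_mul_cancel₀ (hspos k).ne'
    refine isH10With_of_compact (K := dil x₀ (s k)⁻¹ '' closure (U : Set F))
      (hclosed.image (continuous_dil _ _)) ?_ (hWk k) (hGk k) ?_
      fun i => (h i).comp_dil x₀ (hspos k)
    -- contracting the closure of `U` towards an interior point moves it into `U`
    · rintro _ ⟨y, hy, rfl⟩
      have h1 := hU.combo_interior_closure_mem_interior (x := x₀) (y := y)
        (by rwa [U.isOpen.interior_eq]) hy (a := 1 - (s k)⁻¹) (b := (s k)⁻¹)
        (sub_pos.2 (inv_lt_one_of_one_lt₀ (hs1 k))) (inv_nonneg.2 (hspos k).le) (by ring)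
      rw [U.isOpen.interior_eq] at h1
      convert h1 using 1
      simp only [dil, smul_sub, sub_smul, one_smul]
      abel
    · intro x hx
      refine hW0 _ fun hU' => hx ⟨_, subset_closure hU', dil_dil hr x⟩
  refine isH10With_of_tendsto (hW.restrict _) (fun i => (hG i).restrict _)
    (fun k => (hWk k).restrict _) (fun k i => (hGk k i).restrict _) hk ?_
  -- the gradient is the dilation of `G`, multiplied by `s k → 1`
  have hGlim : ∀ i, Tendsto (fun k => ∫ x, (s k * G i (dil x₀ (s k) x) - G i x) ^ 2)
      atTop (𝓝 0) := by
    intro i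
    have hle : ∀ k, ∫ x, (s k * G i (dil x₀ (s k) x) - G i x) ^ 2 ≤
        2 * (∫ x, (G i (dil x₀ (s k) x) - G i x) ^ 2) + 2 * ((s k - 1) ^ 2 * ∫ x, G i x ^ 2) := by
      intro k
      have hm := memLp_comp_dil x₀ (hspos k).ne' (hG i)
      have h1 := integral_add_sq_le (hm.sub (hG i)) (hm.const_mul (s k - 1))
      have e1 : ∀ x, G i (dil x₀ (s k) x) - G i x + (s k - 1) * G i (dil x₀ (s k) x) =
          s k * G i (dil x₀ (s k) x) - G i x := fun x => by ring
      simp only [Pi.sub_apply, e1, mul_pow, integral_const_mul] at h1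
      refine h1.trans ?_
      exact add_le_add le_rfl (mul_le_mul_of_nonneg_left (mul_le_mul_of_nonneg_left
        (integral_sq_comp_dil_le x₀ (hs1 k).le (G i)) (sq_nonneg _)) zero_le_two)
    refine squeeze_zero (fun k => integral_nonneg fun x => sq_nonneg _) hle ?_
    have h1 := (tendsto_integral_sq_dil x₀ (fun k => (hs1 k).le) hs (hG i)).const_mul 2
    have h2 := (((hs.sub_const 1).pow 2).mul_const (∫ x, G i x ^ 2)).const_mul 2
    simpa using h1.add h2
  have hi0 : ∀ k, Integrable (fun x => (W (dil x₀ (s k) x) - W x) ^ 2) volume := fun k =>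
    ((hWk k).sub hW).integrable_sq
  have hi1 : ∀ k i, Integrable (fun x => (s k * G i (dil x₀ (s k) x) - G i x) ^ 2) volume :=
    fun k i => ((hGk k i).sub (hG i)).integrable_sq
  refine squeeze_zero (fun k => integral_nonneg fun x => by positivity) (fun k =>
    setIntegral_le_integral ((hi0 k).add (integrable_finsetSum _ fun i _ => hi1 k i))
      (Eventually.of_forall fun x => by simp only [Pi.zero_apply]; positivity)) ?_
  have e : ∀ k, ∫ x, ((W (dil x₀ (s k) x) - W x) ^ 2 +
      ∑ i, (s k * G i (dil x₀ (s k) x) - G i x) ^ 2) =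
      (∫ x, (W (dil x₀ (s k) x) - W x) ^ 2) +
        ∑ i, ∫ x, (s k * G i (dil x₀ (s k) x) - G i x) ^ 2 := fun k => by
    rw [integral_add (hi0 k) (integrable_finsetSum _ fun i _ => hi1 k i),
      integral_finsetSum _ fun i _ => hi1 k i]
  simp only [e]
  simpa using (tendsto_integral_sq_dil x₀ (fun k => (hs1 k).le) hs hW).add
    (tendsto_finsetSum Finset.univ fun i _ => hGlim i)

end Dilation

/-! ### Reflection in time -/

section Reflection

variable {n : ℕ} {Ω : Opens (Space n)} {T : ℝ}

/-- The reflection in time `(x, t) ↦ (x, -t)`. -/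
def reflect (z : Spacetime n) : Spacetime n := (z.1, -z.2)

@[simp]
theorem reflect_reflect (z : Spacetime n) : reflect (reflect z) = z := by simp [reflect]

/-- The reflection in time as a continuous linear map. -/
def reflectCLM (n : ℕ) : Spacetime n →L[ℝ] Spacetime n :=
  (ContinuousLinearMap.id ℝ (Space n)).prodMap (-ContinuousLinearMap.id ℝ ℝ)

theorem coe_reflectCLM : (reflectCLM n : Spacetime n → Spacetime n) = reflect := rfl

theorem continuous_reflect : Continuous (reflect (n := n)) := (reflectCLM n).continuous

theorem measurableEmbedding_reflect : MeasurableEmbedding (reflect (n := n)) :=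
  (MeasurableEquiv.measurableEmbedding
    { toFun := reflect, invFun := reflect, left_inv := reflect_reflect,
      right_inv := reflect_reflect, measurable_toFun := continuous_reflect.measurable,
      measurable_invFun := continuous_reflect.measurable })

theorem restrict_Ioo_symm (hT : 0 < T) : (volume : Measure ℝ).restrict (Ioo (-T) T) =
    volume.restrict (Ioo 0 T) + (volume.restrict (Ioo 0 T)).map (fun t => -t) := by
  have h1 := ((Measure.measurePreserving_neg (volume : Measure ℝ)).restrict_preimage
    (measurableSet_Ioo (a := -T) (b := 0))).map_eq
  have h2 : Neg.neg ⁻¹' Ioo (-T) 0 = Ioo 0 T := by simp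
  rw [h2] at h1
  have h3 : (volume : Measure ℝ).restrict (Ioo 0 T) + volume.restrict (Ioo (-T) 0) =
      volume.restrict (Ioo (-T) T) := by
    rw [Measure.restrict_congr_set (Ioo_ae_eq_Ioc (a := -T) (b := (0 : ℝ))), add_comm,
      ← Measure.restrict_union _ measurableSet_Ioo, Ioc_union_Ioo_eq_Ioo (by linarith) hT]
    exact Set.disjoint_left.2 fun t h h' => absurd h.2 (not_le.2 h'.1)
  rw [← h3, ← h1]

theorem restrict_cyl_symm (hT : 0 < T) :
    volume.restrict (cyl Ω (-T) T : Set (Spacetime n)) =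
      volume.restrict (cyl Ω 0 T : Set (Spacetime n)) +
        (volume.restrict (cyl Ω 0 T : Set (Spacetime n))).map reflect := by
  rw [restrict_cyl, restrict_cyl, restrict_Ioo_symm hT, Measure.prod_add]
  congr 1
  have := Measure.map_prod_map (volume.restrict (Ω : Set (Space n)))
    ((volume : Measure ℝ).restrict (Ioo 0 T)) measurable_id (measurable_neg (G := ℝ))
  rw [Measure.map_id] at this
  exact this

theorem ae_cyl_symm (hT : 0 < T) {p : Spacetime n → Prop}
    (h1 : ∀ᵐ z ∂volume.restrict (cyl Ω 0 T : Set (Spacetime n)), p z)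
    (h2 : ∀ᵐ z ∂volume.restrict (cyl Ω 0 T : Set (Spacetime n)), p (reflect z)) :
    ∀ᵐ z ∂volume.restrict (cyl Ω (-T) T : Set (Spacetime n)), p z := by
  rw [restrict_cyl_symm hT, ae_add_measure_iff]
  exact ⟨h1, measurableEmbedding_reflect.ae_map_iff.2 h2⟩

theorem integrable_cyl_symm (hT : 0 < T) {f : Spacetime n → ℝ}
    (h1 : Integrable f (volume.restrict (cyl Ω 0 T : Set (Spacetime n))))
    (h2 : Integrable (fun z => f (reflect z))
      (volume.restrict (cyl Ω 0 T : Set (Spacetime n)))) :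
    Integrable f (volume.restrict (cyl Ω (-T) T : Set (Spacetime n))) := by
  rw [restrict_cyl_symm hT]
  exact h1.add_measure (measurableEmbedding_reflect.integrable_map_iff.2 h2)

theorem integral_cyl_symm (hT : 0 < T) {f : Spacetime n → ℝ}
    (h1 : Integrable f (volume.restrict (cyl Ω 0 T : Set (Spacetime n))))
    (h2 : Integrable (fun z => f (reflect z))
      (volume.restrict (cyl Ω 0 T : Set (Spacetime n)))) :
    ∫ z in (cyl Ω (-T) T : Set (Spacetime n)), f z =
      (∫ z in (cyl Ω 0 T : Set (Spacetime n)), f z) +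
        ∫ z in (cyl Ω 0 T : Set (Spacetime n)), f (reflect z) := by
  rw [restrict_cyl_symm hT, integral_add_measure h1
    (measurableEmbedding_reflect.integrable_map_iff.2 h2),
    measurableEmbedding_reflect.integral_map]

/-- The extension of `f` from positive to negative times by `c • f(x, -t)`: the even extension
for `c = 1`, the odd one for `c = -1`. -/
noncomputable def reflExt (c : ℝ) (f : Spacetime n → ℝ) (z : Spacetime n) : ℝ :=
  if 0 < z.2 then f z else c * f (reflect z)

theorem reflExt_of_pos (c : ℝ) (f : Spacetime n → ℝ) {z : Spacetime n} (hz : 0 < z.2) :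
    reflExt c f z = f z := if_pos hz

theorem reflExt_reflect (c : ℝ) (f : Spacetime n → ℝ) {z : Spacetime n} (hz : 0 < z.2) :
    reflExt c f (reflect z) = c * f z := by
  rw [reflExt, if_neg (by simp [reflect, hz.le]), reflect_reflect]

theorem ae_reflExt (c : ℝ) (f : Spacetime n → ℝ) :
    ∀ᵐ z ∂volume.restrict (cyl Ω 0 T : Set (Spacetime n)),
      reflExt c f z = f z ∧ reflExt c f (reflect z) = c * f z := by
  filter_upwards [ae_cyl_mem Ω 0 T] with z hz
  exact ⟨reflExt_of_pos c f hz.2.1, reflExt_reflect c f hz.2.1⟩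

variable {f : Spacetime n → ℝ}

theorem memLp_reflExt (hT : 0 < T) (c : ℝ)
    (hf : MemLp f 2 (volume.restrict (cyl Ω 0 T : Set (Spacetime n)))) :
    MemLp (reflExt c f) 2 (volume.restrict (cyl Ω (-T) T : Set (Spacetime n))) := by
  have h1 : MemLp (reflExt c f) 2 (volume.restrict (cyl Ω 0 T : Set (Spacetime n))) :=
    (memLp_congr_ae ((ae_reflExt c f).mono fun z h => h.1)).2 hf
  have h2 : MemLp (reflExt c f ∘ reflect) 2 (volume.restrict (cyl Ω 0 T : Set (Spacetime n))) :=
    (memLp_congr_ae ((ae_reflExt c f).mono fun z h => h.2)).2 (hf.const_mul c)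
  refine (memLp_two_iff_integrable_sq ?_).2
    (integrable_cyl_symm hT h1.integrable_sq h2.integrable_sq)
  rw [restrict_cyl_symm hT, aestronglyMeasurable_add_measure_iff]
  exact ⟨h1.1, (measurableEmbedding_reflect.aestronglyMeasurable_map_iff).2 h2.1⟩

theorem integral_reflExt_mul (hT : 0 < T) (c : ℝ)
    (hf : MemLp f 2 (volume.restrict (cyl Ω 0 T : Set (Spacetime n)))) {ψ : Spacetime n → ℝ}
    (hψ : Continuous ψ) (hc : HasCompactSupport ψ) :
    ∫ z in (cyl Ω (-T) T : Set (Spacetime n)), reflExt c f z * ψ z =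
      ∫ z in (cyl Ω 0 T : Set (Spacetime n)), f z * (ψ z + c * ψ (reflect z)) := by
  have m1 := memLp_of_contDiff hψ hc (cyl Ω 0 T : Set (Spacetime n))
  have hc' : HasCompactSupport fun z => ψ (reflect z) :=
    HasCompactSupport.intro (hc.isCompact.image continuous_reflect) fun z hz => by
      by_contra h
      exact hz ⟨reflect z, subset_tsupport _ h, reflect_reflect z⟩
  have m2 := memLp_of_contDiff (hψ.comp continuous_reflect) hc' (cyl Ω 0 T : Set (Spacetime n))
  have i1 : Integrable (fun z => f z * ψ z) (volume.restrict (cyl Ω 0 T : Set (Spacetime n))) :=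
    integrable_mul_of_memLp hf m1
  have i2 : Integrable (fun z => c * (f z * ψ (reflect z)))
      (volume.restrict (cyl Ω 0 T : Set (Spacetime n))) :=
    (integrable_mul_of_memLp hf m2).const_mul c
  have e1 : (fun z => reflExt c f z * ψ z)
      =ᵐ[volume.restrict (cyl Ω 0 T : Set (Spacetime n))] fun z => f z * ψ z := by
    filter_upwards [ae_reflExt c f] with z hz
    rw [hz.1]
  have e2 : (fun z => reflExt c f (reflect z) * ψ (reflect z))
      =ᵐ[volume.restrict (cyl Ω 0 T : Set (Spacetime n))]
        fun z => c * (f z * ψ (reflect z)) := by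
    filter_upwards [ae_reflExt c f] with z hz
    rw [hz.2, mul_assoc]
  rw [integral_cyl_symm hT (i1.congr e1.symm) (i2.congr e2.symm), integral_congr_ae e1,
    integral_congr_ae e2, ← integral_add i1 i2]
  refine integral_congr_ae (Eventually.of_forall fun z => ?_)
  show f z * ψ z + c * (f z * ψ (reflect z)) = f z * (ψ z + c * ψ (reflect z))
  ring

theorem integral_reflExt_sq (hT : 0 < T) {c : ℝ} (hc : c ^ 2 = 1)
    (hf : MemLp f 2 (volume.restrict (cyl Ω 0 T : Set (Spacetime n)))) :
    ∫ z in (cyl Ω (-T) T : Set (Spacetime n)), reflExt c f z ^ 2 =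
      2 * ∫ z in (cyl Ω 0 T : Set (Spacetime n)), f z ^ 2 := by
  have e1 : (fun z => reflExt c f z ^ 2)
      =ᵐ[volume.restrict (cyl Ω 0 T : Set (Spacetime n))] fun z => f z ^ 2 := by
    filter_upwards [ae_reflExt c f] with z hz
    rw [hz.1]
  have e2 : (fun z => reflExt c f (reflect z) ^ 2)
      =ᵐ[volume.restrict (cyl Ω 0 T : Set (Spacetime n))] fun z => f z ^ 2 := by
    filter_upwards [ae_reflExt c f] with z hz
    rw [hz.2, mul_pow, hc, one_mul]
  rw [integral_cyl_symm hT (hf.integrable_sq.congr e1.symm) (hf.integrable_sq.congr e2.symm),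
    integral_congr_ae e1, integral_congr_ae e2, two_mul]

/-- The sign by which the reflection in time acts on a coordinate direction. -/
def reflSign : Option (Fin n) → ℝ
  | none => -1
  | some _ => 1

theorem reflSign_sq (j : Option (Fin n)) : reflSign j ^ 2 = 1 := by
  cases j <;> simp [reflSign]

theorem reflect_stDir (j : Option (Fin n)) :
    reflect (stDir n j) = reflSign j • stDir n j := by
  cases j <;> simp [reflect, stDir, reflSign]

/-- The `j`-th derivative of the even extension of `q` is the even (`j` spatial) or odd (`j` the
time) extension of `∂ⱼ q`. The even extension turns a test function `φ` into
`φ(x, t) ± φ(x, -t)`, which in the case of the time derivative vanishes at `t = 0`. -/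
theorem integral_reflExt_mul_fderiv (hT : 0 < T) (q : Y Ω T) (j : Option (Fin n))
    {φ : Spacetime n → ℝ} (hφ : ContDiff ℝ 1 φ) (hc : HasCompactSupport φ) :
    ∫ z in (cyl Ω (-T) T : Set (Spacetime n)), reflExt 1 q.toL2 z * fderiv ℝ φ z (stDir n j) =
      -∫ z in (cyl Ω (-T) T : Set (Spacetime n)),
        reflExt (reflSign j) (weakDeriv (cyl Ω 0 T) j q.toH1) z * φ z := by
  rw [integral_reflExt_mul hT _ (Lp.memLp _) (continuous_fderiv_dir hφ _)
    (hc.fderiv_apply (𝕜 := ℝ) _), integral_reflExt_mul hT _ (Lp.memLp _) hφ.continuous hc]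
  set ψ : Spacetime n → ℝ := fun z => φ z + reflSign j * φ (reflect z) with hψdef
  have hr : ContDiff ℝ 1 fun z => φ (reflect z) := hφ.comp (reflectCLM n).contDiff
  have hψ : ContDiff ℝ 1 ψ := hφ.add (contDiff_const.mul hr)
  have hψc : HasCompactSupport ψ := by
    refine HasCompactSupport.intro
      (hc.isCompact.union (hc.isCompact.image continuous_reflect)) fun z hz => ?_
    rw [mem_union, not_or] at hz
    have h1 : φ z = 0 := image_eq_zero_of_notMem_tsupport hz.1
    have h2 : φ (reflect z) = 0 := by
      by_contra h
      exact hz.2 ⟨reflect z, subset_tsupport _ h, reflect_reflect z⟩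
    simp [hψdef, h1, h2]
  have hd : ∀ z, fderiv ℝ φ z (stDir n j) + 1 * fderiv ℝ φ (reflect z) (stDir n j) =
      fderiv ℝ ψ z (stDir n j) := by
    intro z
    have d1 : HasFDerivAt φ (fderiv ℝ φ z) z := (hφ.differentiable one_ne_zero z).hasFDerivAt
    have d2 : HasFDerivAt φ (fderiv ℝ φ (reflect z)) (reflectCLM n z) :=
      (hφ.differentiable one_ne_zero _).hasFDerivAt
    have d3 : HasFDerivAt (fun z => φ (reflect z))
        ((fderiv ℝ φ (reflect z)).comp (reflectCLM n)) z :=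
      d2.comp z (reflectCLM n).hasFDerivAt
    have d4 : HasFDerivAt ψ _ z := d1.add (d3.const_mul (reflSign j))
    rw [d4.fderiv]
    simp only [FunLike.coe_add, Pi.add_apply, FunLike.coe_smul, Pi.smul_apply,
      ContinuousLinearMap.comp_apply, smul_eq_mul]
    rw [coe_reflectCLM, reflect_stDir, map_smul, smul_eq_mul, ← mul_assoc, ← pow_two,
      reflSign_sq]
  simp only [hd]
  cases j with
  | none =>
    have h := integral_prim_mul_fderiv (Ω := Ω) (T := T) (t₀ := T) ⟨hT.le, le_rfl⟩
      (Lp.stronglyMeasurable (weakDeriv (cyl Ω 0 T) none q.toH1)) (Lp.memLp _) hψ hψc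
      (Or.inr fun x _ => by simp [hψdef, reflect, reflSign]) (Or.inl rfl)
    rw [← h]
    refine integral_congr_ae ?_
    filter_upwards [q.ae_eq_prim hT ⟨hT.le, le_rfl⟩] with z hz
    rw [hz]
  | some i =>
    exact integral_cyl_mul_fderiv_space (Lp.memLp _)
      (g := fun i => weakDeriv (cyl Ω 0 T) (some i) q.toH1) (fun i => Lp.memLp _)
      q.slice_isH10With hψ hψc i

/-- `reflExt` as a linear map from `L²(Q)` to `L²(Q₋)`. -/
noncomputable def reflL2 (hT : 0 < T) (c : ℝ) : L2 (cyl Ω 0 T) →ₗ[ℝ] L2 (cyl Ω (-T) T) where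
  toFun f := (memLp_reflExt hT c (Lp.memLp f)).toLp _
  map_add' f g := by
    refine Lp.ext ((MemLp.coeFn_toLp _).trans (EventuallyEq.trans ?_ (Lp.coeFn_add _ _).symm))
    refine EventuallyEq.trans ?_ ((MemLp.coeFn_toLp _).add (MemLp.coeFn_toLp _)).symm
    refine ae_cyl_symm hT ?_ ?_
    all_goals
      filter_upwards [Lp.coeFn_add f g, ae_reflExt c (f + g : L2 (cyl Ω 0 T)), ae_reflExt c f,
        ae_reflExt c g] with z h h1 h2 h3
      simp only [Pi.add_apply] at h ⊢
      simp only [h1, h2, h3, h, mul_add]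
  map_smul' r f := by
    refine Lp.ext ((MemLp.coeFn_toLp _).trans (EventuallyEq.trans ?_ (Lp.coeFn_smul _ _).symm))
    refine EventuallyEq.trans ?_ ((MemLp.coeFn_toLp _).const_smul r).symm
    refine ae_cyl_symm hT ?_ ?_
    all_goals
      filter_upwards [Lp.coeFn_smul r f, ae_reflExt c (r • f : L2 (cyl Ω 0 T)),
        ae_reflExt c f] with z h h1 h2
      simp only [Pi.smul_apply, smul_eq_mul] at h ⊢
      simp only [h1, h2, h, mul_left_comm c r]

theorem coeFn_reflL2 (hT : 0 < T) (c : ℝ) (f : L2 (cyl Ω 0 T)) :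
    reflL2 hT c f =ᵐ[volume.restrict (cyl Ω (-T) T : Set (Spacetime n))] reflExt c f :=
  (memLp_reflExt hT c (Lp.memLp f)).coeFn_toLp

theorem norm_reflL2_sq (hT : 0 < T) {c : ℝ} (hc : c ^ 2 = 1) (f : L2 (cyl Ω 0 T)) :
    ‖reflL2 hT c f‖ ^ 2 = 2 * ‖f‖ ^ 2 := by
  rw [norm_Lp_sq, norm_Lp_sq, ← integral_reflExt_sq hT hc (Lp.memLp f)]
  refine integral_congr_ae ?_
  filter_upwards [coeFn_reflL2 hT c f] with z hz
  rw [hz]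

theorem isWeakDeriv_reflL2 (hT : 0 < T) (q : Y Ω T) (j : Option (Fin n)) :
    IsWeakDeriv (cyl Ω (-T) T) (stDir n j) (reflL2 hT 1 q.toL2)
      (reflL2 hT (reflSign j) (weakDeriv (cyl Ω 0 T) j q.toH1)) := by
  intro φ
  have h := integral_reflExt_mul_fderiv hT q j (φ.contDiff.of_le (by simp)) φ.hasCompactSupport
  refine Eq.trans (integral_congr_ae ?_) (h.trans (congrArg _ (integral_congr_ae ?_)))
  · filter_upwards [coeFn_reflL2 hT 1 q.toL2] with z hz
    rw [hz]
  · filter_upwards [coeFn_reflL2 hT (reflSign j) (weakDeriv (cyl Ω 0 T) j q.toH1)] with z hz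
    rw [hz]

/-- The extension of `q ∈ Y` by reflection in time, as an element of `H¹(Q₋)`. -/
noncomputable def reflH1 (hT : 0 < T) (q : Y Ω T) : H1 (cyl Ω (-T) T) :=
  ⟨reflL2 hT 1 q.toL2, fun j => ⟨_, isWeakDeriv_reflL2 hT q j⟩⟩

theorem weakDeriv_reflH1 (hT : 0 < T) (q : Y Ω T) (j : Option (Fin n)) :
    weakDeriv (cyl Ω (-T) T) j (reflH1 hT q) =
      reflL2 hT (reflSign j) (weakDeriv (cyl Ω 0 T) j q.toH1) :=
  weakDeriv_eq (isWeakDeriv_reflL2 hT q j)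

theorem reflH1_mem_H10 (hT : 0 < T) (hne : (Ω : Set (Space n)).Nonempty)
    (hbdd : Bornology.IsBounded (Ω : Set (Space n))) (hconv : Convex ℝ (Ω : Set (Space n)))
    (q : Y Ω T) : reflH1 hT q ∈ H10 (cyl Ω (-T) T) := by
  have : (volume : Measure (Spacetime n)).IsAddHaarMeasure :=
    inferInstanceAs ((volume : Measure (Space n)).prod (volume : Measure ℝ)).IsAddHaarMeasure
  obtain ⟨x₀, hx₀⟩ := hne
  have hmeas := (cyl Ω (-T) T).isOpen.measurableSet
  have hm : ∀ (c : ℝ) (f : L2 (cyl Ω 0 T)), MemLp ((cyl Ω (-T) T : Set (Spacetime n)).indicator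
      (reflExt c f)) 2 volume := fun c f =>
    (memLp_indicator_iff_restrict hmeas).2 (memLp_reflExt hT c (Lp.memLp f))
  have hind : ∀ f : Spacetime n → ℝ, (cyl Ω (-T) T : Set (Spacetime n)).indicator f
      =ᵐ[volume.restrict (cyl Ω (-T) T : Set (Spacetime n))] f := fun f =>
    indicator_ae_eq_restrict hmeas
  have hint : ∀ f g : Spacetime n → ℝ,
      ∫ z, (cyl Ω (-T) T : Set (Spacetime n)).indicator f z * g z =
        ∫ z in (cyl Ω (-T) T : Set (Spacetime n)), f z * g z := fun f g => by
    rw [← integral_indicator hmeas]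
    refine integral_congr_ae (Eventually.of_forall fun z => ?_)
    by_cases hz : z ∈ (cyl Ω (-T) T : Set (Spacetime n)) <;> simp [hz]
  refine (isH10With_of_convex (U := cyl Ω (-T) T) (e := stDir n) (x₀ := (x₀, 0))
    (hconv.prod (convex_Ioo _ _)) (hbdd.prod (Metric.isBounded_Ioo _ _))
    ⟨hx₀, neg_lt_zero.2 hT, hT⟩ (hm 1 q.toL2)
    (fun j => hm (reflSign j) (weakDeriv (cyl Ω 0 T) j q.toH1))
    (fun z hz => indicator_of_notMem hz _) fun j φ hφ hc => ?_).congr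
    ((hind _).trans (coeFn_reflL2 hT 1 q.toL2).symm) fun j => ?_
  · rw [hint, hint]
    exact integral_reflExt_mul_fderiv hT q j (hφ.of_le (by simp)) hc
  · rw [weakDeriv_reflH1]
    exact (hind _).trans (coeFn_reflL2 hT _ _).symm

/-- The extension operator `q ↦ q(x, |t|)`. It multiplies norms by `√2`. -/
theorem exists_timeReflection (hT : 0 < T) (hne : (Ω : Set (Space n)).Nonempty)
    (hbdd : Bornology.IsBounded (Ω : Set (Space n))) (hconv : Convex ℝ (Ω : Set (Space n))) :
    ∃ E : Y Ω T →L[ℝ] H10m Ω T, IsTimeReflection E ∧ IsExtension E ∧ ∀ q, ‖E q‖ ≤ 2 * ‖q‖ := by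
  let E₀ : Y Ω T →ₗ[ℝ] H10m Ω T :=
    { toFun := fun q => (⟨reflH1 hT q, reflH1_mem_H10 hT hne hbdd hconv q⟩ : H10 (cyl Ω (-T) T))
      map_add' := fun p q => Subtype.ext (Subtype.ext ((reflL2 hT 1 ∘ₗ Energy.toL2).map_add p q))
      map_smul' := fun c q =>
        Subtype.ext (Subtype.ext ((reflL2 hT 1 ∘ₗ Energy.toL2).map_smul c q)) }
  have hnorm : ∀ q, ‖E₀ q‖ ≤ 2 * ‖q‖ := by
    intro q
    refine le_of_sq_le_sq ?_ (by positivity)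
    have h : ‖E₀ q‖ ^ 2 = 2 * ‖q‖ ^ 2 := by
      rw [Energy.norm_sq, Energy.norm_sq, Finset.mul_sum]
      refine Finset.sum_congr rfl fun j _ => ?_
      rw [← norm_reflL2_sq hT (reflSign_sq j), ← weakDeriv_reflH1]
      rfl
    rw [h, mul_pow]
    nlinarith [sq_nonneg ‖q‖]
  have hE : ∀ q, ∀ᵐ z ∂volume.restrict (cyl Ω (-T) T : Set (Spacetime n)),
      (E₀ q).toL2 z = reflExt 1 q.toL2 z := fun q => coeFn_reflL2 hT 1 q.toL2
  refine ⟨E₀.mkContinuous 2 hnorm, fun q => ?_, fun q => ?_, hnorm⟩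
  · filter_upwards [hE q] with z hz
    refine hz.trans ?_
    rcases lt_or_ge 0 z.2 with h | h
    · rw [reflExt_of_pos _ _ h, abs_of_pos h]
    · rw [reflExt, if_neg (not_lt.2 h), one_mul, abs_of_nonpos h, reflect]
  · filter_upwards [ae_mono (restrict_cyl_le hT) (hE q), ae_reflExt 1 q.toL2] with z hz h
    exact hz.trans h.1

end Reflection

/-! ### The energy norm of `S` -/

section EnergyNorm

variable {n : ℕ} {Ω : Opens (Space n)} {T : ℝ}

theorem norm_opB_le {E : Y Ω T →L[ℝ] H10m Ω T} {C : ℝ} (hC : 0 ≤ C)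
    (hE : ∀ q, ‖E q‖ ≤ C * ‖q‖) (u : X Ω T) : ‖opB E u‖ ≤ C * ‖u‖ := by
  refine ContinuousLinearMap.opNorm_le_bound _ (by positivity) fun q => ?_
  rw [opB_apply]
  calc ‖X.box u (E q)‖ ≤ ‖X.box u‖ * ‖E q‖ := (X.box u).le_opNorm _
    _ ≤ ‖X.box u‖ * (C * ‖q‖) := by
      gcongr
      exact hE q
    _ = C * ‖u‖ * ‖q‖ := by rw [← X.norm_eq]; ring

/-- `A⁻¹` is an isometry, by the Riesz representation theorem, so that
`⟨S u, u⟩ = ⟨A w, w⟩ = ‖w‖² = ‖B u‖²` for `w = A⁻¹ B u`. -/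
theorem exists_opS_eq (hT : 0 < T) (E : Y Ω T →L[ℝ] H10m Ω T) (u : X Ω T) :
    ∃ w : Y Ω T, opA (H11term Ω T) w = opB E u ∧ ‖w‖ = ‖opB E u‖ ∧
      ∀ v, opS E u v = opB E v w := by
  have hA : (opA (H11term Ω T)).IsInvertible := opA_isInvertible hT ⟨hT.le, le_rfl⟩
  have h : opA (H11term Ω T) ((opA (H11term Ω T)).inverse (opB E u)) = opB E u :=
    hA.self_apply_inverse _
  refine ⟨_, h, ?_, fun v => rfl⟩
  rw [← norm_opA, h]

theorem opS_self (hT : 0 < T) (E : Y Ω T →L[ℝ] H10m Ω T) (u : X Ω T) :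
    opS E u u = ‖opB E u‖ ^ 2 := by
  obtain ⟨w, h1, h2, h3⟩ := exists_opS_eq hT E u
  rw [h3, ← h1, opA_self, h1, h2]

theorem normS_eq (hT : 0 < T) (E : Y Ω T →L[ℝ] H10m Ω T) (u : X Ω T) :
    normS E u = ‖opB E u‖ := by
  rw [normS, opS_self hT, Real.sqrt_sq (norm_nonneg _)]

theorem norm_opS_le (hT : 0 < T) {E : Y Ω T →L[ℝ] H10m Ω T} {C : ℝ} (hC : 0 ≤ C)
    (hE : ∀ q, ‖E q‖ ≤ C * ‖q‖) (u : X Ω T) : ‖opS E u‖ ≤ C ^ 2 * ‖u‖ := by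
  obtain ⟨w, h1, h2, h3⟩ := exists_opS_eq hT E u
  refine ContinuousLinearMap.opNorm_le_bound _ (by positivity) fun v => ?_
  rw [h3]
  calc ‖opB E v w‖ ≤ ‖opB E v‖ * ‖w‖ := (opB E v).le_opNorm w
    _ ≤ (C * ‖v‖) * (C * ‖u‖) := by
      rw [h2]
      exact mul_le_mul (norm_opB_le hC hE v) (norm_opB_le hC hE u) (norm_nonneg _) (by positivity)
    _ = C ^ 2 * ‖u‖ * ‖v‖ := by ring

end EnergyNorm

end WaveControl

theorem mainTheorem6 (n : ℕ) (hn : 1 ≤ n ∧ n ≤ 3)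
    (Ω : TopologicalSpace.Opens (Space n)) (hne : (Ω : Set (Space n)).Nonempty)
    (hbdd : Bornology.IsBounded (Ω : Set (Space n))) (hconv : Convex ℝ (Ω : Set (Space n)))
    (T : ℝ) (hT : 0 < T) :
    (∃ E : Y Ω T →L[ℝ] H10m Ω T, IsTimeReflection E ∧ IsExtension E ∧ ∀ q, ‖E q‖ ≤ 2 * ‖q‖) ∧
    (opA (H11term Ω T)).IsInvertible ∧
    ∀ E : Y Ω T →L[ℝ] H10m Ω T, IsExtension E → (∀ q, ‖E q‖ ≤ 2 * ‖q‖) →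
      (∀ u : X Ω T, ‖opS E u‖ ≤ 4 * ‖u‖) ∧
      (∀ u : X Ω T, ‖u‖ ^ 2 ≤ opS E u u) ∧
      ((∀ u : X Ω T, normS E u = 0 ↔ u = 0) ∧
        (∀ (c : ℝ) (u : X Ω T), normS E (c • u) = |c| * normS E u) ∧
        (∀ u v : X Ω T, normS E (u + v) ≤ normS E u + normS E v)) ∧
      (∀ u : X Ω T, ‖u‖ ≤ normS E u ∧ normS E u ≤ 2 * ‖u‖) := by
  refine ⟨exists_timeReflection hT hne hbdd hconv, opA_isInvertible hT ⟨hT.le, le_rfl⟩,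
    fun E hE hE2 => ⟨fun u => ?_, fun u => ?_, ⟨fun u => ⟨fun h => ?_, fun h => ?_⟩,
      fun c u => ?_, fun u v => ?_⟩, fun u => ⟨?_, ?_⟩⟩⟩
  · exact (norm_opS_le hT zero_le_two hE2 u).trans_eq (by norm_num)
  · rw [opS_self hT]
    exact pow_le_pow_left₀ (norm_nonneg u) (norm_le_norm_opB hT hE u) 2
  · rw [normS_eq hT] at h
    exact X.eq_zero_of_norm_eq_zero hT hE hE2
      (le_antisymm (h ▸ norm_le_norm_opB hT hE u) (norm_nonneg u))
  · rw [normS_eq hT, h, map_zero, norm_zero]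
  · simp only [normS_eq hT, map_smul, norm_smul, Real.norm_eq_abs]
  · simp only [normS_eq hT, map_add]
    exact norm_add_le _ _
  · rw [normS_eq hT]
    exact norm_le_norm_opB hT hE u
  · rw [normS_eq hT]
    exact norm_opB_le zero_le_two hE2 u
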